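/- **Conventions.** Regard $\mathbb{R}^2\subset\mathbb{P}^2(\mathbb{R})$ as the chart $(x,y)\mapsto(x:y:1)$. A rational $2$-form $\omega$ on $\mathbb{P}^2_{\mathbb C}$ has *logarithmic poles precisely along* a hypersurface $Y$ if it has at most simple poles along $Y$, is logarithmic along the total transform of $Y$ on an embedded resolution (a succession of point blow-ups making that transform a simple normal crossings divisor), is holomorphic off $Y$, and has a pole at every point of $Y$. Its residue along a prime divisor $D\subset Y$ with local equation $f$ is $\eta|_D$, where $\omega=\frac{df}{f}\wedge\eta+\eta'$ with $\eta,\eta'$ holomorphic at the generic point of $D$. A rational $1$-form on a (possibly singular) plane curve $D$ has logarithmic poles precisely along a set $Y$ of points if its pullback to the normalization has at most simple poles over $Y$, is holomorphic elsewhere, and has a pole over each point of $Y$; its residue at a point of $D$ is the sum of the residues at the points of the normalization above it. *Positive geometries* $(X,X_{\ge 0})$, for $X$ equal to $\mathbb{P}^2$, an irreducible plane curve or a point, are defined recursively. In dimension $0$, a point is a positive geometry with canonical form $\pm1$. In dimension $d\in\{1,2\}$, $X$ is defined over $\mathbb{R}$, $X_{\ge0}\subset X(\mathbb{R})$ is nonempty,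 closed, semialgebraic and of dimension $d$, and there is a rational $d$-form $\omega$ on $X$ (the *canonical form*), unique up to a global sign (orientation), such that $\omega$ has logarithmic poles precisely along the Zariski closure of the topological boundary of $X_{\ge 0}$ in $X(\mathbb{R})$, and for every prime divisor $D$ of $X$ contained in this closure, $(D,\,D\cap X_{\ge 0})$ is a positive geometry with canonical form $\operatorname{Res}_D(\omega)$. **Lemma.** Let $$A_{II}:=\{(x,y)\in\mathbb{R}^2 \mid y-\tfrac32x+\tfrac12\ge 0,\ y^2\le x^3,\ y\le 1\}\subset\mathbb{P}^2(\mathbb{R}).$$ The Zariski closure in $\mathbb{P}^2(\mathbb{C})$ of the topological boundary of $A_{II}$ is the union of (the projective closures of) the line $y-\tfrac32x+\tfrac12=0$ and the cuspidal cubic $y^2=x^3$, and $(\mathbb{P}^2,A_{II})$ is a positive geometry. Its canonical form (up to sign) is $$\omega_{A_{II}}=\frac32\,\frac{y-x}{\bigl(y-\tfrac32x+\tfrac12\bigr)\,(y^2-x^3)}\,dx\wedge dy .$$ -/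

import Mathlib

open scoped LinearAlgebra.Projectivization

noncomputable section

namespace PosGeom

/-! ### The projective plane, its real points and its function field -/

/-- The complex projective plane `ℙ²(ℂ)`. -/
abbrev CP2 : Type := ℙ ℂ (Fin 3 → ℂ)

/-- The real projective plane `ℙ²(ℝ)`. -/
abbrev RP2 : Type := ℙ ℝ (Fin 3 → ℝ)

/-- The Euclidean topology of `ℙ²(ℝ)`, as a quotient of `ℝ³ ∖ {0}`. -/
instance instTopologicalSpaceRP2 : TopologicalSpace RP2 :=
  TopologicalSpace.coinduced (fun v : {v : Fin 3 → ℝ // v ≠ 0} => Projectivization.mk ℝ v.1 v.2)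
    inferInstance

theorem ofReal_ne_zero {v : Fin 3 → ℝ} (hv : v ≠ 0) : (fun i => (v i : ℂ)) ≠ 0 := by
  intro h
  apply hv
  funext i
  simpa using congrFun h i

/-- The inclusion `ℙ²(ℝ) ⊂ ℙ²(ℂ)`. -/
def RP2.toComplex (p : RP2) : CP2 :=
  Projectivization.mk ℂ (fun i => (p.rep i : ℂ)) (ofReal_ne_zero p.rep_nonzero)

/-- The affine point `(x, y)` of `ℝ² ⊂ ℙ²(ℝ)`, that is `(x : y : 1)`. -/
def affinePoint (x y : ℝ) : RP2 :=
  Projectivization.mk ℝ ![x, y, 1] (fun h => one_ne_zero (congrFun h 2))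

/-- Vanishing of a (homogeneous) polynomial at a point of `ℙ²(ℂ)`. -/
def VanishesAt (G : MvPolynomial (Fin 3) ℂ) (p : CP2) : Prop :=
  MvPolynomial.eval p.rep G = 0

/-- The zero locus in `ℙ²(ℂ)` of a (homogeneous) polynomial. -/
def zeroLocus (G : MvPolynomial (Fin 3) ℂ) : Set CP2 := {p | VanishesAt G p}

/-- The Zariski closure in `ℙ²(ℂ)` of a set of real points. -/
def zariskiClosure (S : Set RP2) : Set CP2 :=
  {p | ∀ (n : ℕ) (G : MvPolynomial (Fin 3) ℂ), G.IsHomogeneous n →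
    (∀ s ∈ S, VanishesAt G s.toComplex) → VanishesAt G p}

/-- Semialgebraic subsets of `ℝⁿ`: the Boolean algebra generated by the sets `{P > 0}`. -/
inductive IsSemialgebraic {n : ℕ} : Set (Fin n → ℝ) → Prop
  | pos (P : MvPolynomial (Fin n) ℝ) : IsSemialgebraic {v | 0 < MvPolynomial.eval v P}
  | compl {S : Set (Fin n → ℝ)} : IsSemialgebraic S → IsSemialgebraic Sᶜ
  | inter {S T : Set (Fin n → ℝ)} :
      IsSemialgebraic S → IsSemialgebraic T → IsSemialgebraic (S ∩ T)

/-- Semialgebraic subsets of `ℙ²(ℝ)`: the punctured cone over the set is semialgebraic in `ℝ³`. -/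
def IsSemialgebraicRP2 (A : Set RP2) : Prop :=
  IsSemialgebraic {v : Fin 3 → ℝ | ∃ hv : v ≠ 0, Projectivization.mk ℝ v hv ∈ A}

/-- The function field `ℂ(x, y)` of `ℙ²`, in the affine coordinates `(x : y : 1)`. -/
abbrev K2 : Type := FractionRing (MvPolynomial (Fin 2) ℂ)

/-- The affine coordinate function `x`. -/
def xCoord : K2 := algebraMap (MvPolynomial (Fin 2) ℂ) K2 (MvPolynomial.X 0)

/-- The affine coordinate function `y`. -/
def yCoord : K2 := algebraMap (MvPolynomial (Fin 2) ℂ) K2 (MvPolynomial.X 1)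

/-- Homogeneous coordinates `(x : y : 1)` of the generic point of `ℙ²`. -/
def xi : Fin 3 → K2 := ![xCoord, yCoord, 1]

/-! ### Rational differential forms on the plane -/

/-- Rational `2`-forms on `ℙ²`. -/
abbrev Form2 : Type := ⋀[K2]^2 (Ω[K2⁄ℂ])

/-- The differential `df` of a rational function. -/
def d (f : K2) : Ω[K2⁄ℂ] := KaehlerDifferential.D ℂ K2 f

/-- The wedge product of two rational `1`-forms on `ℙ²`. -/
def wedge (a b : Ω[K2⁄ℂ]) : Form2 := exteriorPower.ιMulti K2 2 ![a, b]

/-! ### Local rings of points on smooth models of the plane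

A closed point on a smooth surface birational to `ℙ²` is described by a system of local coordinates
`u, v ∈ ℂ(x, y)` there; its local ring is the localization of `ℂ[u, v]` at `(u, v)`. -/

/-- `f` is regular at the point with local coordinates `u, v` and takes the value `c` there. -/
def HasValue (u v f : K2) (c : ℂ) : Prop :=
  ∃ P Q : MvPolynomial (Fin 2) ℂ, MvPolynomial.constantCoeff Q ≠ 0 ∧
    f = MvPolynomial.aeval ![u, v] P / MvPolynomial.aeval ![u, v] Q ∧
    c = MvPolynomial.constantCoeff P / MvPolynomial.constantCoeff Q

/-- `f` belongs to the local ring of the point with local coordinates `u, v`. -/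
def IsRegular (u v f : K2) : Prop := ∃ c, HasValue u v f c

/-- `s, t` generate the maximal ideal of the local ring of the point with local coordinates
`u, v`, that is, they form another system of local coordinates (regular parameters). -/
def IsParameters (u v s t : K2) : Prop :=
  HasValue u v s 0 ∧ HasValue u v t 0 ∧
  ∃ a b a' b' : K2, IsRegular u v a ∧ IsRegular u v b ∧ IsRegular u v a' ∧ IsRegular u v b' ∧
    u = a * s + b * t ∧ v = a' * s + b' * t

/-- The `2`-form `ω` is holomorphic at the point with local coordinates `u, v`. -/
def IsHolomorphicAt (ω : Form2) (u v : K2) : Prop :=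
  ∃ h, IsRegular u v h ∧ ω = h • wedge (d u) (d v)

/-- The `2`-form `ω` has at most a simple pole along the reduced divisor with local equation `g` at
the point with local coordinates `u, v`: the form `g ω` is holomorphic there. -/
def HasSimplePoleAt (ω : Form2) (u v g : K2) : Prop := IsHolomorphicAt (g • ω) u v

/-- The `2`-form `ω` is logarithmic along the divisor with local equation `g` over the point with
local coordinates `u, v`, tested on an embedded resolution, which is a succession of blow-ups of
points:
* either the support of the divisor has simple normal crossings at the point, i.e. `g` is a unit
  times a monomial in suitable local coordinates `s, t`, and `ω = h (ds/s) ∧ (dt/t)`, where only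
  those of the two denominators that divide `g` are present, with `h` holomorphic;
* or the point is blown up, and `ω` is logarithmic along the total transform of the divisor over all
  points of the exceptional curve, whose local coordinates are `u, v / u - c` with `c ∈ ℂ`, and
  `u / v, v` at the remaining point. -/
inductive IsLogAt (ω : Form2) : K2 → K2 → K2 → Prop
  | snc {u v g : K2} (s t e h : K2) (c : ℂ) (a b : ℕ)
      (hst : IsParameters u v s t) (he : HasValue u v e c) (hc : c ≠ 0)
      (hg : g = e * s ^ a * t ^ b) (hh : IsRegular u v h)
      (hω : ω = (h / (s ^ min a 1 * t ^ min b 1)) • wedge (d s) (d t)) : IsLogAt ω u v g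
  | blowup {u v g : K2}
      (h₁ : ∀ c : ℂ, IsLogAt ω u (v / u - algebraMap ℂ K2 c) g)
      (h₂ : IsLogAt ω (u / v) v g) : IsLogAt ω u v g

/-- The standard affine chart `{X_i ≠ 0}` used around a point of `ℙ²(ℂ)`: the largest `i` for which
the point lies in it. -/
def chart (p : CP2) : Fin 3 := if p.rep 2 ≠ 0 then 2 else if p.rep 1 ≠ 0 then 1 else 0

/-- The local coordinate at `p` given by the `j`-th affine coordinate of the chart at `p`. -/
def localCoord (p : CP2) (j : Fin 3) : K2 :=
  xi j / xi (chart p) - algebraMap ℂ K2 (p.rep j / p.rep (chart p))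

/-- The first local coordinate at a point of `ℙ²(ℂ)`. -/
def uAt (p : CP2) : K2 := localCoord p (chart p + 1)

/-- The second local coordinate at a point of `ℙ²(ℂ)`. -/
def vAt (p : CP2) : K2 := localCoord p (chart p + 2)

/-- The local equation at `p` of the curve with the homogeneous equation `G` of degree `n`. -/
def localEquation (p : CP2) (n : ℕ) (G : MvPolynomial (Fin 3) ℂ) : K2 :=
  MvPolynomial.aeval xi G / xi (chart p) ^ n

/-- `ω` has logarithmic poles precisely along `Y ⊂ ℙ²(ℂ)`: the set `Y` is a hypersurface, `ω` has at
most simple poles along it and is logarithmic on an embedded resolution (in particular it is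
holomorphic off `Y`), and `ω` does have a pole at each point of `Y`. -/
def HasLogPolesPrecisely (ω : Form2) (Y : Set CP2) : Prop :=
  ∃ (n : ℕ) (G : MvPolynomial (Fin 3) ℂ), G.IsHomogeneous n ∧ Squarefree G ∧ zeroLocus G = Y ∧
    ∀ p : CP2, HasSimplePoleAt ω (uAt p) (vAt p) (localEquation p n G) ∧
      IsLogAt ω (uAt p) (vAt p) (localEquation p n G) ∧
      (p ∈ Y → ¬ IsHolomorphicAt ω (uAt p) (vAt p))

/-! ### Prime divisors of the plane -/

/-- A prime divisor of `ℙ²`: an irreducible complex projective plane curve. -/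
structure PlaneCurve where
  /-- the homogeneous equation -/
  F : MvPolynomial (Fin 3) ℂ
  homogeneous : F.IsHomogeneous F.totalDegree
  irreducible : Irreducible F

theorem eval_smul_of_isHomogeneous {n : ℕ} {Q : MvPolynomial (Fin 3) ℂ} (hQ : Q.IsHomogeneous n)
    (c : ℂ) (v : Fin 3 → ℂ) :
    MvPolynomial.eval (c • v) Q = c ^ n * MvPolynomial.eval v Q := by
  rw [MvPolynomial.eval_eq', MvPolynomial.eval_eq', Finset.mul_sum]
  refine Finset.sum_congr rfl fun m hm => ?_
  have h1 : ∑ i, m i = n := by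
    have := hQ (MvPolynomial.mem_support_iff.mp hm)
    rw [← this, Finsupp.weight_apply, Finsupp.sum_fintype _ _ (by simp)]
    simp
  simp only [Pi.smul_apply, smul_eq_mul, mul_pow, Finset.prod_mul_distrib,
    Finset.prod_pow_eq_pow_sum, h1]
  ring

theorem aeval_xi_ne_zero {n : ℕ} {Q : MvPolynomial (Fin 3) ℂ} (hQ : Q.IsHomogeneous n)
    (h0 : Q ≠ 0) : MvPolynomial.aeval xi Q ≠ 0 := by
  intro h
  apply h0
  have key : MvPolynomial.aeval
      (![MvPolynomial.X 0, MvPolynomial.X 1, 1] : Fin 3 → MvPolynomial (Fin 2) ℂ) Q = 0 := by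
    apply IsFractionRing.injective (MvPolynomial (Fin 2) ℂ) K2
    rw [map_zero, ← h, ← MvPolynomial.aeval_algebraMap_apply]
    congr 2
    funext i
    fin_cases i <;> simp [xi, xCoord, yCoord]
  have hX : MvPolynomial.X 2 * Q = 0 := by
    apply MvPolynomial.funext
    intro w
    rw [map_mul, MvPolynomial.eval_X, map_zero]
    by_cases hw : w 2 = 0
    · simp [hw]
    · have h2 : MvPolynomial.eval ![w 0 / w 2, w 1 / w 2, 1] Q = 0 := by
        have h3 := congrArg (MvPolynomial.aeval ![w 0 / w 2, w 1 / w 2]) key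
        rw [map_zero, ← AlgHom.comp_apply, MvPolynomial.comp_aeval] at h3
        rw [← h3, ← MvPolynomial.coe_aeval_eq_eval]
        change MvPolynomial.aeval _ Q = MvPolynomial.aeval _ Q
        congr 2
        funext i
        fin_cases i <;> simp
      have h4 : w = w 2 • ![w 0 / w 2, w 1 / w 2, 1] := by
        funext i
        fin_cases i <;> simp <;> field_simp
      have h5 : MvPolynomial.eval w Q = 0 := by
        rw [h4, eval_smul_of_isHomogeneous hQ, h2, mul_zero]
      rw [h5, mul_zero]
  exact (mul_eq_zero.mp hX).resolve_left (MvPolynomial.X_ne_zero 2)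

namespace PlaneCurve

variable (D : PlaneCurve)

theorem not_dvd_mul {P Q : MvPolynomial (Fin 3) ℂ} (hP : ¬ D.F ∣ P) (hQ : ¬ D.F ∣ Q) :
    ¬ D.F ∣ P * Q := fun h => (D.irreducible.prime.dvd_or_dvd h).elim hP hQ

theorem aeval_ne_zero {n : ℕ} {Q : MvPolynomial (Fin 3) ℂ} (hQ : Q.IsHomogeneous n)
    (h : ¬ D.F ∣ Q) : MvPolynomial.aeval xi Q ≠ 0 :=
  aeval_xi_ne_zero hQ (fun h0 => h (h0 ▸ dvd_zero _))

/-- The local ring of `ℙ²` at the generic point of the curve `D = {F = 0}`: the rational functions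
`P / Q` with `P, Q` homogeneous of the same degree and `F` not dividing `Q`. -/
def localRing : Subalgebra ℂ K2 where
  carrier := {f | ∃ (n : ℕ) (P Q : MvPolynomial (Fin 3) ℂ), P.IsHomogeneous n ∧ Q.IsHomogeneous n ∧
    ¬ D.F ∣ Q ∧ f = MvPolynomial.aeval xi P / MvPolynomial.aeval xi Q}
  mul_mem' := by
    rintro _ _ ⟨n, P, Q, hP, hQ, hd, rfl⟩ ⟨m, P', Q', hP', hQ', hd', rfl⟩
    exact ⟨n + m, P * P', Q * Q', hP.mul hP', hQ.mul hQ', D.not_dvd_mul hd hd', by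
      rw [map_mul, map_mul, div_mul_div_comm]⟩
  add_mem' := by
    rintro _ _ ⟨n, P, Q, hP, hQ, hd, rfl⟩ ⟨m, P', Q', hP', hQ', hd', rfl⟩
    exact ⟨n + m, P * Q' + Q * P', Q * Q', (hP.mul hQ').add (hQ.mul hP'), hQ.mul hQ',
      D.not_dvd_mul hd hd', by
      rw [map_add, map_mul, map_mul, map_mul,
        div_add_div _ _ (D.aeval_ne_zero hQ hd) (D.aeval_ne_zero hQ' hd')]⟩
  algebraMap_mem' := fun c => ⟨0, MvPolynomial.C c, 1, MvPolynomial.isHomogeneous_C _ _,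
    MvPolynomial.isHomogeneous_one _ _,
    fun h => D.irreducible.not_isUnit (isUnit_of_dvd_one h), by simp⟩

theorem isUnit_of_not_dvd {f : D.localRing} {n : ℕ} {P Q : MvPolynomial (Fin 3) ℂ}
    (hP : P.IsHomogeneous n) (hQ : Q.IsHomogeneous n) (hdP : ¬ D.F ∣ P) (hdQ : ¬ D.F ∣ Q)
    (hf : (f : K2) = MvPolynomial.aeval xi P / MvPolynomial.aeval xi Q) : IsUnit f := by
  refine IsUnit.of_mul_eq_one
    (⟨MvPolynomial.aeval xi Q / MvPolynomial.aeval xi P, n, Q, P, hQ, hP, hdP, rfl⟩ : D.localRing) ?_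
  apply Subtype.ext
  have h1 := D.aeval_ne_zero hP hdP
  have h2 := D.aeval_ne_zero hQ hdQ
  change (f : K2) * (MvPolynomial.aeval xi Q / MvPolynomial.aeval xi P) = 1
  rw [hf]
  field_simp

instance isLocalRing_localRing : IsLocalRing D.localRing := by
  refine IsLocalRing.of_nonunits_add ?_
  rintro f g hf hg hfg
  obtain ⟨n, P, Q, hP, hQ, hd, h1⟩ := f.2
  obtain ⟨m, P', Q', hP', hQ', hd', h2⟩ := g.2
  have hPd : D.F ∣ P := by
    by_contra h
    exact hf (D.isUnit_of_not_dvd hP hQ h hd h1)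
  have hPd' : D.F ∣ P' := by
    by_contra h
    exact hg (D.isUnit_of_not_dvd hP' hQ' h hd' h2)
  obtain ⟨k, hk⟩ := hfg.exists_right_inv
  obtain ⟨l, R, S, hR, hS, hdS, h3⟩ := k.2
  have e1 := D.aeval_ne_zero hQ hd
  have e2 := D.aeval_ne_zero hQ' hd'
  have e3 := D.aeval_ne_zero hS hdS
  have hk' : ((f : K2) + (g : K2)) * (k : K2) = 1 := congrArg Subtype.val hk
  rw [h1, h2, h3] at hk'
  have h4 : MvPolynomial.aeval xi ((P * Q' + Q * P') * R - Q * Q' * S) = 0 := by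
    simp only [map_sub, map_mul, map_add]
    field_simp at hk'
    linear_combination hk'
  have h5 : (P * Q' + Q * P') * R - Q * Q' * S = 0 := by
    by_contra h
    exact aeval_xi_ne_zero
      ((((hP.mul hQ').add (hQ.mul hP')).mul hR).sub ((hQ.mul hQ').mul hS)) h h4
  have h6 : D.F ∣ Q * Q' * S := by
    rw [← sub_eq_zero.mp h5]
    exact ((hPd.mul_right _).add (hPd'.mul_left _)).mul_right _
  exact D.not_dvd_mul (D.not_dvd_mul hd hd') hdS h6

/-- The function field `ℂ(D)` of the curve `D`. -/
abbrev FunctionField : Type := IsLocalRing.ResidueField D.localRing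

/-- Rational `1`-forms on the (possibly singular) curve `D`. -/
abbrev Form1 : Type := Ω[D.FunctionField⁄ℂ]

/-- The set of real points `D(ℝ)`. -/
def realPoints : Set RP2 := {p | VanishesAt D.F p.toComplex}

/-- The curve `D` is defined over `ℝ`. -/
def IsDefinedOverReal : Prop :=
  ∃ G : MvPolynomial (Fin 3) ℝ, Associated D.F (MvPolynomial.map (algebraMap ℝ ℂ) G)

/-! ### Points of the normalization of a plane curve, and `1`-forms there -/

/-- A point of the normalization of `D`: a nontrivial valuation ring of `ℂ(D)` over `ℂ`. -/
def IsPlace (V : ValuationSubring D.FunctionField) : Prop :=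
  V ≠ ⊤ ∧ ∀ c : ℂ, algebraMap ℂ D.FunctionField c ∈ V

/-- The point `V` of the normalization of `D` lies over `p ∈ ℙ²(ℂ)`: each rational function `f` on
`ℙ²` that is regular at `p` and along `D` restricts to a function on `D` with value `f(p)` at
`V`. -/
def LiesOver (V : ValuationSubring D.FunctionField) (p : CP2) : Prop :=
  ∀ (f : D.localRing) (c : ℂ), HasValue (uAt p) (vAt p) (f : K2) c →
    IsLocalRing.residue D.localRing f - algebraMap ℂ D.FunctionField c ∈ V.nonunits

/-- The points of the normalization of `D` over `p`. -/
def placesOver (p : CP2) : Set (ValuationSubring D.FunctionField) :=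
  {V | D.IsPlace V ∧ D.LiesOver V p}

/-- `t` is a uniformizer at `V`, that is, a local coordinate on the normalization. -/
def IsUniformizer (V : ValuationSubring D.FunctionField) (t : D.FunctionField) : Prop :=
  t ≠ 0 ∧ t ∈ V.nonunits ∧ ∀ a ∈ V.nonunits, a / t ∈ V

/-- The `1`-form `θ` is holomorphic at the point `V` of the normalization. -/
def IsHolomorphic (V : ValuationSubring D.FunctionField) (θ : D.Form1) : Prop :=
  ∃ t h, D.IsUniformizer V t ∧ h ∈ V ∧ θ = h • KaehlerDifferential.D ℂ D.FunctionField t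

/-- The `1`-form `θ` has at most a simple pole at the point `V` of the normalization, with residue
`r` there: `θ = h dt / t` with `h` regular of value `r`. -/
def HasResidue (V : ValuationSubring D.FunctionField) (θ : D.Form1) (r : ℂ) : Prop :=
  ∃ t h, D.IsUniformizer V t ∧ h ∈ V ∧
    h - algebraMap ℂ D.FunctionField r ∈ V.nonunits ∧
    θ = (h / t) • KaehlerDifferential.D ℂ D.FunctionField t

/-- `θ` has logarithmic poles precisely along the set of points `Y`: pulled back to the
normalization, it has at most simple poles over `Y`, it is holomorphic elsewhere, and it does have
a pole over each point of `Y`. -/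
def HasLogPolesPrecisely (θ : D.Form1) (Y : Set CP2) : Prop :=
  (∀ p : CP2, ∀ V ∈ D.placesOver p, (p ∈ Y → ∃ r, D.HasResidue V θ r) ∧
    (p ∉ Y → D.IsHolomorphic V θ)) ∧
  ∀ p ∈ Y, ∃ V ∈ D.placesOver p, ¬ D.IsHolomorphic V θ

/-- The residue of `θ` at `p ∈ D` is `r`: the residues on the normalization, pushed forward to `D`,
that is, summed over the points above `p`. -/
def HasResidueAt (θ : D.Form1) (p : CP2) (r : ℂ) : Prop :=
  ∃ ρ : ValuationSubring D.FunctionField → ℂ,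
    (∀ V ∈ D.placesOver p, D.HasResidue V θ (ρ V)) ∧ ∑ᶠ V ∈ D.placesOver p, ρ V = r

/-! ### One-dimensional positive geometries -/

/-- The topological boundary of `A` in `D(ℝ)`. -/
def boundary (A : Set RP2) : Set RP2 :=
  D.realPoints ∩ closure A ∩ closure (D.realPoints \ A)

/-- `r` is a canonical form of the zero-dimensional positive geometry given by a point. -/
def _root_.PosGeom.IsCanonicalPointForm (r : ℂ) : Prop := r = 1 ∨ r = -1

/-- `θ` is a canonical form of `(D, A)`: it has logarithmic poles precisely along the (Zariski
closure of the) topological boundary of `A` in `D(ℝ)`, and its residue at each boundary point is a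
canonical form of that point. -/
def IsCanonicalForm (A : Set RP2) (θ : D.Form1) : Prop :=
  D.HasLogPolesPrecisely θ (zariskiClosure (D.boundary A)) ∧
  ∀ p ∈ zariskiClosure (D.boundary A), ∃ r, D.HasResidueAt θ p r ∧ IsCanonicalPointForm r

/-- `(D, A)` is a one-dimensional positive geometry. The set `A` is full-dimensional, i.e. of
dimension one, iff it is infinite, and canonical forms are unique up to the choice of an
orientation, i.e. up to a global sign. -/
def IsPositiveGeometry (A : Set RP2) : Prop :=
  D.IsDefinedOverReal ∧ A ⊆ D.realPoints ∧ A.Nonempty ∧ IsClosed A ∧ IsSemialgebraicRP2 A ∧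
  A.Infinite ∧
  ∃ θ, D.IsCanonicalForm A θ ∧ ∀ θ', D.IsCanonicalForm A θ' → θ' = θ ∨ θ' = -θ

/-! ### Residues of `2`-forms along a curve -/

/-- The `2`-forms that are holomorphic at the generic point of `D`. -/
def holomorphicForms : Submodule D.localRing Form2 :=
  Submodule.span D.localRing {ω | ∃ a b : D.localRing, ω = wedge (d a) (d b)}

/-- `θ` is the Poincaré residue of `ω` along `D`: for a local equation `f` of `D` one has
`ω = (df / f) ∧ η + η'` with `η, η'` holomorphic at the generic point of `D` and `η|_D = θ`. -/
def IsResidue (ω : Form2) (θ : D.Form1) : Prop :=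
  ∃ (f : D.localRing) (η : Ω[D.localRing⁄ℂ]) (η' : Form2),
    IsLocalRing.maximalIdeal D.localRing = Ideal.span {f} ∧ η' ∈ D.holomorphicForms ∧
    ω = wedge ((f : K2)⁻¹ • d f) (KaehlerDifferential.map ℂ ℂ D.localRing K2 η) + η' ∧
    θ = KaehlerDifferential.map ℂ ℂ D.localRing D.FunctionField η

end PlaneCurve

/-! ### Two-dimensional positive geometries in the plane -/

/-- `ω` is a canonical form of `(ℙ², A)`: it has logarithmic poles precisely along the Zariski
closure of the topological boundary of `A`, and for each prime divisor `D` contained in it, the pair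
`(D, D(ℝ) ∩ A)` is a positive geometry with canonical form the residue of `ω` along `D`. -/
def IsCanonicalForm (A : Set RP2) (ω : Form2) : Prop :=
  HasLogPolesPrecisely ω (zariskiClosure (frontier A)) ∧
  ∀ D : PlaneCurve, zeroLocus D.F ⊆ zariskiClosure (frontier A) →
    D.IsPositiveGeometry (D.realPoints ∩ A) ∧
    ∃ θ, D.IsResidue ω θ ∧ D.IsCanonicalForm (D.realPoints ∩ A) θ

/-- `(ℙ², A)` is a two-dimensional positive geometry. A semialgebraic set `A` is full-dimensional
iff it has interior points, and canonical forms are unique up to the choice of an orientation, i.e.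
up to a global sign. -/
def IsPositiveGeometry (A : Set RP2) : Prop :=
  A.Nonempty ∧ IsClosed A ∧ IsSemialgebraicRP2 A ∧ (interior A).Nonempty ∧
  ∃ ω, IsCanonicalForm A ω ∧ ∀ ω', IsCanonicalForm A ω' → ω' = ω ∨ ω' = -ω

/-- The region of type II, in `ℝ² ⊂ ℙ²(ℝ)`. -/
def regionII : Set RP2 :=
  {p | ∃ x y : ℝ, 0 ≤ y - 3 / 2 * x + 1 / 2 ∧ y ^ 2 ≤ x ^ 3 ∧ y ≤ 1 ∧ p = affinePoint x y}

/-- The projective closure in `ℙ²(ℂ)` of the line `y - 3x/2 + 1/2 = 0`. -/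
def lineII : Set CP2 :=
  {p | p.rep 1 - 3 / 2 * p.rep 0 + 1 / 2 * p.rep 2 = 0}

/-- The projective closure in `ℙ²(ℂ)` of the cuspidal cubic `y² = x³`. -/
def cuspidalCubic : Set CP2 :=
  {p | p.rep 1 ^ 2 * p.rep 2 = p.rep 0 ^ 3}

/-- The `2`-form `(3/2) (y - x) / ((y - 3x/2 + 1/2) (y² - x³)) dx ∧ dy`. -/
def omegaII : Form2 :=
  (3 / 2 * ((yCoord - xCoord) /
    ((yCoord - 3 / 2 * xCoord + 1 / 2) * (yCoord ^ 2 - xCoord ^ 3)))) •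
    wedge (d xCoord) (d yCoord)

end PosGeom

end

noncomputable section

namespace PosGeom

/-! ### Homogeneous polynomials on the projective plane -/

/-! Write `L` for the line and `C` for the cuspidal cubic, parametrized by `(t, 3t/2 - 1/2)` and
`(t², t³)`. Restricted to `C`, the equation of `L` is `(t - 1)² (t + 1/2)`. Restricted to `L`, the
equation of `C` is `-(t - 1)² (t - 1/4)`. So the curves are tangent at `(1, 1)` and cross at `(1/4,
-1/8)`. When the linear and cubic inequalities are strict, so is `y ≤ 1`; hence the frontier lies on
`L ∪ C`. It contains an infinite arc of each of these irreducible curves, which gives the Zariski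
closure (`zariskiClosure_frontier_regionII`).

By the Nullstellensatz only `L` and `C` occur as prime divisors
(`associated_lineForm_or_cubicForm`). Their normalizations are projective lines, and the region cuts
out segments with end parameters `1, 1/4` and `1, -1/2`. A `1`-form on the projective line with at
most simple poles, all at `a` and `b`, is a multiple of `dτ / ((τ - a)(τ - b))`. A residue `±1` at
`a` fixes the multiple up to sign (`eq_smul_segmentForm_of_isCanonicalForm`), so both curves are
positive geometries.

The numerator `y - x` vanishes at the cusp and at the point of tangency, the two places where `L ∪
C` fails to have normal crossings. This lowers the pole orders on the exceptional curves enough for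
the form to be logarithmic after three blow-ups at the cusp and two at the tangency
(`isLogAt_omegaII`). A pole survives at every point, because the numerator has multiplicity one
where the denominator has multiplicity at least two (`not_isHolomorphicAt_omegaII`). Along a curve
`P = 0`, the residue of `N / (P B) dx ∧ dy` is `-N / (B ∂P/∂y) dx`, and on both curves this is plus
or minus the segment form (`isResidue_line`, `isResidue_cubic`).

For uniqueness, a form with at most simple poles along `L ∪ C` has a numerator of degree `4 - 3 = 1`
over the product of the equations (`exists_linear_numerator`). On the cubic `a + b x + c y` becomes
`a + b t² + c t³`, so the residue along `C` alone determines it, up to the sign of that residue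
(`eq_or_eq_neg_of_isCanonicalForm`). -/

theorem vanishesAt_mk_iff {n : ℕ} {G : MvPolynomial (Fin 3) ℂ} (hG : G.IsHomogeneous n)
    {v : Fin 3 → ℂ} (hv : v ≠ 0) :
    VanishesAt G (Projectivization.mk ℂ v hv) ↔ MvPolynomial.eval v G = 0 := by
  obtain ⟨a, ha⟩ := Projectivization.exists_smul_eq_mk_rep ℂ v hv
  rw [VanishesAt, ← ha, Units.smul_def, eval_smul_of_isHomogeneous hG]
  simp

theorem RP2.toComplex_mk {v : Fin 3 → ℝ} (hv : v ≠ 0) :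
    RP2.toComplex (Projectivization.mk ℝ v hv) =
      Projectivization.mk ℂ (fun i => (v i : ℂ)) (ofReal_ne_zero hv) := by
  obtain ⟨a, ha⟩ := Projectivization.exists_smul_eq_mk_rep ℝ v hv
  rw [RP2.toComplex, Projectivization.mk_eq_mk_iff']
  refine ⟨((a : ℝ) : ℂ), ?_⟩
  funext i
  rw [← ha]
  simp [Units.smul_def]

theorem affinePoint_toComplex (x y : ℝ) :
    (affinePoint x y).toComplex = Projectivization.mk ℂ ![(x : ℂ), y, 1]
      (fun h => one_ne_zero (congrFun h 2)) := by
  rw [affinePoint, RP2.toComplex_mk]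
  congr 1
  funext i
  fin_cases i <;> simp

theorem vanishesAt_affinePoint_iff {n : ℕ} {G : MvPolynomial (Fin 3) ℂ} (hG : G.IsHomogeneous n)
    (x y : ℝ) :
    VanishesAt G (affinePoint x y).toComplex ↔ MvPolynomial.eval ![(x : ℂ), y, 1] G = 0 := by
  rw [affinePoint_toComplex, vanishesAt_mk_iff hG]

theorem zeroLocus_mul (F G : MvPolynomial (Fin 3) ℂ) :
    zeroLocus (F * G) = zeroLocus F ∪ zeroLocus G := by
  ext p
  simp [zeroLocus, VanishesAt]

theorem zeroLocus_subset_of_dvd {F G : MvPolynomial (Fin 3) ℂ} (h : F ∣ G) :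
    zeroLocus F ⊆ zeroLocus G := by
  obtain ⟨H, rfl⟩ := h
  rw [zeroLocus_mul]
  exact Set.subset_union_left

/-- The projective Nullstellensatz for hypersurfaces. -/
theorem exists_dvd_pow_of_zeroLocus_subset {m n : ℕ} {F G : MvPolynomial (Fin 3) ℂ}
    (hF : F.IsHomogeneous m) (hG : G.IsHomogeneous n) (hn : n ≠ 0)
    (h : zeroLocus F ⊆ zeroLocus G) : ∃ k, F ∣ G ^ k := by
  have h1 : G ∈ (Ideal.span {F}).radical := by
    rw [← MvPolynomial.vanishingIdeal_zeroLocus_eq_radical (K := ℂ),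
      MvPolynomial.mem_vanishingIdeal_iff]
    intro v hv
    have hv' : MvPolynomial.eval v F = 0 := by
      have := hv F (Ideal.mem_span_singleton_self F)
      rwa [MvPolynomial.aeval_eq_eval] at this
    rw [MvPolynomial.aeval_eq_eval]
    -- The affine Nullstellensatz also tests the vertex of the cone, where `G` vanishes because its
    -- degree `n` is positive.
    by_cases h0 : v = 0
    · have := eval_smul_of_isHomogeneous hG 0 v
      rw [zero_smul, zero_pow hn, zero_mul] at this
      rw [h0, this]
    · exact (vanishesAt_mk_iff hG h0).mp (h ((vanishesAt_mk_iff hF h0).mpr hv'))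
  obtain ⟨k, hk⟩ := h1
  exact ⟨k, Ideal.mem_span_singleton.mp hk⟩

/-- The linear form whose zero set is the line `y - 3x/2 + 1/2 = 0`. -/
def lineForm : MvPolynomial (Fin 3) ℂ :=
  MvPolynomial.X 1 - MvPolynomial.C (3 / 2) * MvPolynomial.X 0 +
    MvPolynomial.C (1 / 2) * MvPolynomial.X 2

/-- The cubic form whose zero set is the cuspidal cubic `y² = x³`. -/
def cubicForm : MvPolynomial (Fin 3) ℂ :=
  MvPolynomial.X 1 ^ 2 * MvPolynomial.X 2 - MvPolynomial.X 0 ^ 3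

theorem isHomogeneous_lineForm : lineForm.IsHomogeneous 1 :=
  ((MvPolynomial.isHomogeneous_X _ _).sub (MvPolynomial.isHomogeneous_C_mul_X _ _)).add
    (MvPolynomial.isHomogeneous_C_mul_X _ _)

theorem isHomogeneous_cubicForm : cubicForm.IsHomogeneous 3 :=
  ((MvPolynomial.isHomogeneous_X_pow _ _).mul (MvPolynomial.isHomogeneous_X _ _)).sub
    (MvPolynomial.isHomogeneous_X_pow _ _)

theorem isHomogeneous_lineForm_mul_cubicForm : (lineForm * cubicForm).IsHomogeneous 4 :=
  isHomogeneous_lineForm.mul isHomogeneous_cubicForm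

theorem irreducible_lineForm : Irreducible lineForm := by
  have := MvPolynomial.irreducible_mul_X_add (1 : MvPolynomial (Fin 3) ℂ)
    (MvPolynomial.C (1 / 2) * MvPolynomial.X 2 - MvPolynomial.C (3 / 2) * MvPolynomial.X 0) 1
    one_ne_zero (by simp) ?_ isRelPrime_one_left
  · convert this using 1
    rw [lineForm]; ring
  · intro h
    have h1 := MvPolynomial.vars_sub_subset _ h
    rw [Finset.mem_union] at h1
    rcases h1 with h1 | h1 <;> have h2 := MvPolynomial.vars_mul _ _ h1 <;>
      simp [MvPolynomial.vars_X] at h2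

/-- The form has degree one in `X 2`, with coprime coefficients `X 1 ^ 2` and `-X 0 ^ 3`. -/
theorem irreducible_cubicForm : Irreducible cubicForm := by
  have hX : ∀ i : Fin 3, Prime (MvPolynomial.X i : MvPolynomial (Fin 3) ℂ) :=
    fun i => MvPolynomial.X_prime
  have := MvPolynomial.irreducible_mul_X_add (MvPolynomial.X 1 ^ 2 : MvPolynomial (Fin 3) ℂ)
    (-(MvPolynomial.X 0 ^ 3)) 2 (pow_ne_zero _ (MvPolynomial.X_ne_zero _)) ?_ ?_ ?_
  · convert this using 1
    rw [cubicForm]; ring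
  · intro h
    have h2 := MvPolynomial.vars_pow _ _ h
    simp [MvPolynomial.vars_X] at h2
  · intro h
    rw [MvPolynomial.vars_neg] at h
    have h2 := MvPolynomial.vars_pow _ _ h
    simp [MvPolynomial.vars_X] at h2
  · rw [IsRelPrime.neg_right_iff]
    apply IsRelPrime.pow
    rw [(hX 1).irreducible.isRelPrime_iff_not_dvd, MvPolynomial.X_dvd_X]
    simp

theorem zeroLocus_lineForm : zeroLocus lineForm = lineII := by
  ext p
  simp [zeroLocus, VanishesAt, lineForm, lineII]

theorem zeroLocus_cubicForm : zeroLocus cubicForm = cuspidalCubic := by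
  ext p
  simp [zeroLocus, VanishesAt, cubicForm, cuspidalCubic, sub_eq_zero]

theorem not_associated_lineForm_cubicForm : ¬ Associated lineForm cubicForm := by
  intro h
  -- The point `(0, -1/2)` lies on the line and not on the cubic.
  have h1 : MvPolynomial.eval ![0, -1 / 2, 1] cubicForm = 0 := by
    obtain ⟨u, hu⟩ := h
    rw [← hu, map_mul]
    simp [lineForm, Matrix.cons_val]
    norm_num
  simp [cubicForm, Matrix.cons_val] at h1

/-- An irreducible `F` dividing a power of the product is prime, hence divides one of the two
irreducible factors. This reduces the quantifier over prime divisors to two curves. -/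
theorem associated_lineForm_or_cubicForm {F : MvPolynomial (Fin 3) ℂ} {n : ℕ}
    (hF : F.IsHomogeneous n) (hi : Irreducible F) (h : zeroLocus F ⊆ lineII ∪ cuspidalCubic) :
    Associated F lineForm ∨ Associated F cubicForm := by
  rw [← zeroLocus_lineForm, ← zeroLocus_cubicForm, ← zeroLocus_mul] at h
  obtain ⟨k, hk⟩ := exists_dvd_pow_of_zeroLocus_subset hF isHomogeneous_lineForm_mul_cubicForm
    (by norm_num) h
  rcases hi.prime.dvd_or_dvd (hi.prime.dvd_of_dvd_pow hk) with h | h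
  · exact Or.inl (hi.associated_of_dvd irreducible_lineForm h)
  · exact Or.inr (hi.associated_of_dvd irreducible_cubicForm h)

theorem squarefree_lineForm_mul_cubicForm : Squarefree (lineForm * cubicForm) := by
  rw [squarefree_mul_iff]
  refine ⟨?_, irreducible_lineForm.squarefree, irreducible_cubicForm.squarefree⟩
  rw [irreducible_lineForm.isRelPrime_iff_not_dvd]
  exact fun h => not_associated_lineForm_cubicForm
    (irreducible_lineForm.associated_of_dvd irreducible_cubicForm h)

/-- Each polynomial divides a power of the other, and squarefreeness removes the powers. Thus the
equation chosen existentially in `HasLogPolesPrecisely` is unique up to a unit, which the uniqueness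
proof needs. -/
theorem associated_lineForm_mul_cubicForm {G : MvPolynomial (Fin 3) ℂ} {n : ℕ}
    (hG : G.IsHomogeneous n) (hs : Squarefree G) (h : zeroLocus G = lineII ∪ cuspidalCubic) :
    Associated G (lineForm * cubicForm) := by
  rw [← zeroLocus_lineForm, ← zeroLocus_cubicForm, ← zeroLocus_mul] at h
  -- A constant vanishes everywhere or nowhere, but `(0 : 0 : 1)` is on the union and `(0 : 1 : 1)`
  -- is not.
  have hn : n ≠ 0 := by
    rintro rfl
    rw [← MvPolynomial.totalDegree_zero_iff_isHomogeneous,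
      MvPolynomial.totalDegree_eq_zero_iff_eq_C] at hG
    have h1 : Projectivization.mk ℂ ![0, 0, 1] (fun h => one_ne_zero (congrFun h 2)) ∈
        zeroLocus G := by
      rw [h, zeroLocus_mul]
      right
      refine (vanishesAt_mk_iff isHomogeneous_cubicForm _).mpr ?_
      simp [cubicForm]
    have h2 : Projectivization.mk ℂ ![0, 1, 1] (fun h => one_ne_zero (congrFun h 2)) ∉
        zeroLocus G := by
      rw [h]
      intro h3
      have := (vanishesAt_mk_iff isHomogeneous_lineForm_mul_cubicForm _).mp h3
      simp [lineForm, cubicForm, Matrix.cons_val] at this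
      norm_num at this
    apply h2
    rw [hG] at h1 ⊢
    simpa [zeroLocus, VanishesAt] using h1
  obtain ⟨k, hk⟩ := exists_dvd_pow_of_zeroLocus_subset hG isHomogeneous_lineForm_mul_cubicForm
    (by norm_num) h.subset
  obtain ⟨l, hl⟩ := exists_dvd_pow_of_zeroLocus_subset isHomogeneous_lineForm_mul_cubicForm hG
    hn h.symm.subset
  -- The exponent is raised by one to make it nonzero, as the squarefree criterion requires.
  have hk' := hk.trans (pow_dvd_pow _ k.le_succ)
  have hl' := hl.trans (pow_dvd_pow _ l.le_succ)
  exact associated_of_dvd_dvd ((hs.dvd_pow_iff_dvd k.succ_ne_zero).mp hk')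
    ((squarefree_lineForm_mul_cubicForm.dvd_pow_iff_dvd l.succ_ne_zero).mp hl')

/-- The parametrization `t ↦ (t : 3t/2 - 1/2 : 1)` of the line. -/
def lineParam : Fin 3 → Polynomial ℂ :=
  ![Polynomial.X, Polynomial.C (3 / 2) * Polynomial.X - Polynomial.C (1 / 2), 1]

/-- The parametrization `t ↦ (t² : t³ : 1)` of the cuspidal cubic. -/
def cubicParam : Fin 3 → Polynomial ℂ := ![Polynomial.X ^ 2, Polynomial.X ^ 3, 1]

theorem aeval_lineParam_lineForm : MvPolynomial.aeval lineParam lineForm = 0 := by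
  simp only [lineForm, lineParam, map_add, map_sub, map_mul, MvPolynomial.aeval_X,
    MvPolynomial.aeval_C, Polynomial.algebraMap_eq]
  simp

theorem aeval_cubicParam_cubicForm : MvPolynomial.aeval cubicParam cubicForm = 0 := by
  simp only [cubicForm, cubicParam, map_sub, map_mul, MvPolynomial.aeval_X, map_pow]
  simp
  ring

end PosGeom

/-! ### Non-units of valuation subrings -/

section Nonunits

variable {K : Type} [Field K]

/-- This avoids the value group altogether. Zero needs its own case because `0⁻¹ = 0` does lie in
`V`. -/
theorem ValuationSubring.mem_nonunits_iff_inv_notMem (V : ValuationSubring K) {f : K} :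
    f ∈ V.nonunits ↔ f = 0 ∨ f⁻¹ ∉ V := by
  rw [ValuationSubring.mem_nonunits_iff]
  by_cases h : f = 0
  · simp [h]
  · rw [← V.valuation_le_one_iff, map_inv₀, not_le, one_lt_inv₀]
    · simp [h]
    · exact zero_lt_iff.mpr (by simpa using h)

theorem ValuationSubring.mem_of_mem_nonunits {V : ValuationSubring K} {f : K}
    (hf : f ∈ V.nonunits) : f ∈ V :=
  V.valuation_le_one_iff _ |>.mp hf.le

theorem ValuationSubring.mul_mem_nonunits {V : ValuationSubring K} {f g : K}
    (hf : f ∈ V) (hg : g ∈ V.nonunits) : f * g ∈ V.nonunits := by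
  rw [ValuationSubring.mem_nonunits_iff] at *
  rw [map_mul]
  exact mul_lt_one_of_nonneg_of_lt_one_right ((V.valuation_le_one_iff _).mpr hf) zero_le hg

theorem ValuationSubring.add_mem_nonunits {V : ValuationSubring K} {f g : K}
    (hf : f ∈ V.nonunits) (hg : g ∈ V.nonunits) : f + g ∈ V.nonunits := by
  rw [ValuationSubring.mem_nonunits_iff] at *
  exact Valuation.map_add_lt _ hf hg

theorem ValuationSubring.neg_mem_nonunits {V : ValuationSubring K} {f : K}
    (hf : f ∈ V.nonunits) : -f ∈ V.nonunits := by
  rw [ValuationSubring.mem_nonunits_iff] at *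
  rwa [Valuation.map_neg]

end Nonunits

namespace PosGeom

/-! ### Rational function fields in one variable and their places -/

section RationalFunctionField

open Polynomial

variable {K : Type} [Field K] [Algebra ℂ K]

/-- `K = ℂ(s)` with `s` transcendental. -/
structure IsRationalGenerator (s : K) : Prop where
  transcendental : Transcendental ℂ s
  adjoin_eq_top : IntermediateField.adjoin ℂ {s} = ⊤

/-- If `t` were algebraic, so would be every element of `ℂ(t)`, including `s`. This supplies the
coordinates `s⁻¹` and `s - c` at the other points of the projective line. -/
theorem isRationalGenerator_of_mem_adjoin {s t : K} (hs : IsRationalGenerator s)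
    (h : s ∈ IntermediateField.adjoin ℂ {t}) : IsRationalGenerator t := by
  have h1 : IntermediateField.adjoin ℂ {t} = ⊤ := by
    rw [eq_top_iff, ← hs.adjoin_eq_top]
    exact IntermediateField.adjoin_le_iff.mpr (by simpa using h)
  refine ⟨fun ht => hs.transcendental ?_, h1⟩
  have := (IntermediateField.isAlgebraic_adjoin_simple
    (isAlgebraic_iff_isIntegral.mp ht)).isAlgebraic ⟨s, h⟩
  exact (IntermediateField.isAlgebraic_iff (S := IntermediateField.adjoin ℂ {t})).mp this

namespace IsRationalGenerator

variable {s : K} (hs : IsRationalGenerator s)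
include hs

theorem inv : IsRationalGenerator s⁻¹ :=
  isRationalGenerator_of_mem_adjoin hs (by
    have := inv_mem (IntermediateField.mem_adjoin_simple_self ℂ s⁻¹)
    rwa [inv_inv] at this)

theorem sub_algebraMap (c : ℂ) : IsRationalGenerator (s - algebraMap ℂ K c) :=
  isRationalGenerator_of_mem_adjoin hs (by
    have := add_mem (IntermediateField.mem_adjoin_simple_self ℂ (s - algebraMap ℂ K c))
      (IntermediateField.algebraMap_mem _ c)
    rwa [sub_add_cancel] at this)

theorem aeval_injective : Function.Injective (aeval (R := ℂ) s) :=
  transcendental_iff_injective.mp hs.transcendental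

theorem aeval_ne_zero {P : ℂ[X]} (hP : P ≠ 0) : aeval s P ≠ 0 := fun h =>
  hP (hs.aeval_injective (by rw [h, map_zero]))

theorem ne_zero : s ≠ 0 := by simpa using hs.aeval_ne_zero (X_ne_zero (R := ℂ))

theorem exists_isCoprime (f : K) :
    ∃ P Q : ℂ[X], IsCoprime P Q ∧ Q ≠ 0 ∧ f = aeval s P / aeval s Q := by
  have h : f ∈ IntermediateField.adjoin ℂ {s} := hs.adjoin_eq_top ▸ trivial
  obtain ⟨P, Q, rfl⟩ := IntermediateField.mem_adjoin_simple_iff ℂ f |>.mp h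
  by_cases hQ : Q = 0
  · exact ⟨0, 1, isCoprime_zero_left.mpr isUnit_one, one_ne_zero, by simp [hQ]⟩
  · have hg : EuclideanDomain.gcd P Q ≠ 0 := fun h0 => hQ (EuclideanDomain.gcd_eq_zero_iff.mp h0).2
    have h1 := EuclideanDomain.mul_div_cancel' hg (EuclideanDomain.gcd_dvd_left P Q)
    have h2 := EuclideanDomain.mul_div_cancel' hg (EuclideanDomain.gcd_dvd_right P Q)
    refine ⟨P / EuclideanDomain.gcd P Q, Q / EuclideanDomain.gcd P Q,
      ⟨EuclideanDomain.gcdA P Q, EuclideanDomain.gcdB P Q, mul_left_cancel₀ hg ?_⟩, fun h0 => hQ (by rw [← h2, h0, mul_zero]), ?_⟩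
    · have h3 := EuclideanDomain.gcd_eq_gcd_ab P Q
      linear_combination EuclideanDomain.gcdA P Q * h1 + EuclideanDomain.gcdB P Q * h2 - h3
    conv_rhs => rw [← mul_div_mul_left _ _ (hs.aeval_ne_zero hg), ← map_mul, ← map_mul, h1, h2]

/-- Coprime polynomials have no common zero at the origin. This dichotomy is what makes the local
ring at `s = 0` a valuation ring. -/
theorem exists_coeff_zero_ne_zero (f : K) :
    ∃ P Q : ℂ[X], (P.coeff 0 ≠ 0 ∨ Q.coeff 0 ≠ 0) ∧ Q ≠ 0 ∧ f = aeval s P / aeval s Q := by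
  obtain ⟨P, Q, ⟨a, b, h⟩, hQ, hf⟩ := hs.exists_isCoprime f
  refine ⟨P, Q, ?_, hQ, hf⟩
  by_contra! h0
  have := congrArg (fun R => coeff R 0) h
  simp [mul_coeff_zero, h0.1, h0.2] at this

theorem aeval_ne_zero_of_coeff_zero {P : ℂ[X]} (hP : P.coeff 0 ≠ 0) : aeval s P ≠ 0 :=
  hs.aeval_ne_zero (fun h => hP (by rw [h, coeff_zero]))

/-- The place of `ℂ(s)` with `s = 0`. -/
def place : ValuationSubring K where
  carrier := {f | ∃ P Q : ℂ[X], Q.coeff 0 ≠ 0 ∧ f = aeval s P / aeval s Q}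
  mul_mem' := by
    rintro _ _ ⟨P, Q, hQ, rfl⟩ ⟨P', Q', hQ', rfl⟩
    exact ⟨P * P', Q * Q', by rw [mul_coeff_zero]; exact mul_ne_zero hQ hQ', by
      rw [map_mul, map_mul, div_mul_div_comm]⟩
  one_mem' := ⟨1, 1, by simp, by simp⟩
  add_mem' := by
    rintro _ _ ⟨P, Q, hQ, rfl⟩ ⟨P', Q', hQ', rfl⟩
    exact ⟨P * Q' + Q * P', Q * Q', by rw [mul_coeff_zero]; exact mul_ne_zero hQ hQ', by
      rw [map_add, map_mul, map_mul, map_mul, div_add_div _ _ (hs.aeval_ne_zero_of_coeff_zero hQ)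
        (hs.aeval_ne_zero_of_coeff_zero hQ')]⟩
  zero_mem' := ⟨0, 1, by simp, by simp⟩
  neg_mem' := by
    rintro _ ⟨P, Q, hQ, rfl⟩
    exact ⟨-P, Q, hQ, by rw [map_neg, neg_div]⟩
  mem_or_inv_mem' := by
    intro f
    obtain ⟨P, Q, h, -, rfl⟩ := hs.exists_coeff_zero_ne_zero f
    rcases h with h | h
    · exact Or.inr ⟨Q, P, h, inv_div _ _⟩
    · exact Or.inl ⟨P, Q, h, rfl⟩

theorem mem_place {f : K} :
    f ∈ hs.place ↔ ∃ P Q : ℂ[X], Q.coeff 0 ≠ 0 ∧ f = aeval s P / aeval s Q := Iff.rfl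

end IsRationalGenerator

theorem _root_.ValuationSubring.algebraMap_mem_nonunits_iff {V : ValuationSubring K}
    (hV : ∀ c : ℂ, algebraMap ℂ K c ∈ V) {c : ℂ} :
    algebraMap ℂ K c ∈ V.nonunits ↔ c = 0 := by
  rw [V.mem_nonunits_iff_inv_notMem, ← map_inv₀, map_eq_zero_iff _ (algebraMap ℂ K).injective]
  exact or_iff_left (not_not_intro (hV _))

theorem IsRationalGenerator.algebraMap_mem_place {s : K} (hs : IsRationalGenerator s) (c : ℂ) :
    algebraMap ℂ K c ∈ hs.place := ⟨C c, 1, by simp, by simp⟩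

/-- An expression `s⁻¹ = P(s) / Q(s)` would give `Q = P * X`, against `Q(0) ≠ 0`. -/
theorem IsRationalGenerator.mem_nonunits_place {s : K} (hs : IsRationalGenerator s) :
    s ∈ hs.place.nonunits := by
  rw [ValuationSubring.mem_nonunits_iff_inv_notMem]
  right
  rintro ⟨P, Q, hQ, h⟩
  have h0 := hs.ne_zero
  have h1 := hs.aeval_ne_zero_of_coeff_zero hQ
  rw [inv_eq_one_div, div_eq_div_iff h0 h1, one_mul] at h
  have h2 : Q = P * X := hs.aeval_injective (by rw [h, map_mul, aeval_X])
  exact hQ (by rw [h2, coeff_mul_X_zero])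

theorem IsRationalGenerator.place_ne_top {s : K} (hs : IsRationalGenerator s) :
    hs.place ≠ ⊤ := by
  intro h
  have h1 := hs.mem_nonunits_place
  rw [ValuationSubring.mem_nonunits_iff_inv_notMem, h] at h1
  rcases h1 with h1 | h1
  · exact hs.ne_zero h1
  · exact h1 trivial

section

variable {V : ValuationSubring K} (hV : ∀ c : ℂ, algebraMap ℂ K c ∈ V) {s : K}
include hV

theorem aeval_mem (hsV : s ∈ V) (P : ℂ[X]) : aeval s P ∈ V := by
  rw [aeval_eq_sum_range]
  refine sum_mem fun i _ => ?_
  rw [Algebra.smul_def]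
  exact mul_mem (hV _) (pow_mem hsV _)

theorem aeval_sub_mem_nonunits (hsV : s ∈ V.nonunits) (P : ℂ[X]) :
    aeval s P - algebraMap ℂ K (P.coeff 0) ∈ V.nonunits := by
  have h : aeval s P - algebraMap ℂ K (P.coeff 0) = aeval s P.divX * s := by
    conv_lhs => rw [← divX_mul_X_add P]
    simp
  rw [h]
  exact V.mul_mem_nonunits (aeval_mem hV (V.mem_of_mem_nonunits hsV) _) hsV

theorem aeval_inv_mem (hsV : s ∈ V.nonunits) {P : ℂ[X]} (hP : P.coeff 0 ≠ 0) :
    (aeval s P)⁻¹ ∈ V := by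
  by_contra h
  have h1 : aeval s P ∈ V.nonunits := V.mem_nonunits_iff_inv_notMem.mpr (Or.inr h)
  have h2 := V.add_mem_nonunits h1 (V.neg_mem_nonunits (aeval_sub_mem_nonunits hV hsV P))
  rw [neg_sub, add_sub_cancel, V.algebraMap_mem_nonunits_iff hV] at h2
  exact hP h2

/-- Modulo the maximal ideal `P(s)` is `P(0)`. If `P(s) / Q(s)` were in `V` with `Q(0) = 0` and
`P(0) ≠ 0`, then dividing by the unit `P(s)` would put the inverse of the nonunit `Q(s)` in `V`. -/
theorem eq_place (hs : IsRationalGenerator s) (hsV : s ∈ V.nonunits) : V = hs.place := by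
  ext f
  rw [hs.mem_place]
  constructor
  · intro hf
    obtain ⟨P, Q, h, hQ, rfl⟩ := hs.exists_coeff_zero_ne_zero f
    by_cases hQ0 : Q.coeff 0 = 0
    · exfalso
      have hP := h.resolve_right (not_not_intro hQ0)
      have h1 := aeval_sub_mem_nonunits hV hsV Q
      rw [hQ0, map_zero, sub_zero, V.mem_nonunits_iff_inv_notMem] at h1
      refine h1.elim (hs.aeval_ne_zero hQ) fun h2 => h2 ?_
      have h3 := mul_mem hf (aeval_inv_mem hV hsV hP)
      have h4 := hs.aeval_ne_zero_of_coeff_zero hP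
      rwa [div_mul_eq_mul_div, mul_inv_cancel₀ h4, one_div] at h3
    · exact ⟨P, Q, hQ0, rfl⟩
  · rintro ⟨P, Q, hQ, rfl⟩
    rw [div_eq_mul_inv]
    exact mul_mem (aeval_mem hV (V.mem_of_mem_nonunits hsV) _) (aeval_inv_mem hV hsV hQ)

end

/-- The places of `ℂ(s)` are the points of the projective line. -/
theorem exists_mem_nonunits {V : ValuationSubring K} (hV : ∀ c : ℂ, algebraMap ℂ K c ∈ V)
    (hVt : V ≠ ⊤) {s : K} (hs : IsRationalGenerator s) :
    (∃ c : ℂ, s - algebraMap ℂ K c ∈ V.nonunits) ∨ s⁻¹ ∈ V.nonunits := by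
  by_cases hsV : s ∈ V
  · left
    by_contra! h
    have h1 : ∀ c : ℂ, (s - algebraMap ℂ K c)⁻¹ ∈ V := by
      intro c
      by_contra h2
      exact h c (V.mem_nonunits_iff_inv_notMem.mpr (Or.inr h2))
    -- Over `ℂ` every polynomial splits, so inverting all `s - c` inverts every denominator and
    -- forces `V = ⊤`.
    have h2 : ∀ P : ℂ[X], (aeval s P)⁻¹ ∈ V := by
      intro P
      rw [(IsAlgClosed.splits P).eq_prod_roots, map_mul, aeval_C, mul_inv, ← map_inv₀]
      refine mul_mem (hV _) ?_
      induction P.roots using Multiset.induction_on with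
      | empty => simp
      | cons a m ih =>
        rw [Multiset.map_cons, Multiset.prod_cons, map_mul, mul_inv]
        refine mul_mem ?_ ih
        simpa using h1 a
    apply hVt
    rw [eq_top_iff]
    intro f _
    obtain ⟨P, Q, -, -, rfl⟩ := hs.exists_isCoprime f
    rw [div_eq_mul_inv]
    exact mul_mem (aeval_mem hV hsV _) (h2 _)
  · right
    rw [V.mem_nonunits_iff_inv_notMem, inv_inv]
    exact Or.inr hsV

/-! ### Differential forms on the projective line -/

namespace IsRationalGenerator

open KaehlerDifferential

variable {s : K} (hs : IsRationalGenerator s)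
include hs

theorem exists_eq_smul_D (θ : Ω[K⁄ℂ]) : ∃ g : K, θ = g • D ℂ K s := by
  have h : θ ∈ Submodule.span K {D ℂ K s} := by
    have hp : ∀ P : ℂ[X], D ℂ K (aeval s P) ∈ Submodule.span K {D ℂ K s} := by
      intro P
      rw [Derivation.map_aeval]
      exact Submodule.smul_mem _ _ (Submodule.mem_span_singleton_self _)
    have : (⊤ : Submodule K Ω[K⁄ℂ]) ≤ Submodule.span K {D ℂ K s} := by
      rw [← span_range_derivation, Submodule.span_le]
      rintro _ ⟨f, rfl⟩
      obtain ⟨P, Q, -, -, rfl⟩ := hs.exists_isCoprime f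
      rw [Derivation.leibniz_div]
      exact Submodule.smul_mem _ _ (Submodule.sub_mem _ (Submodule.smul_mem _ _ (hp _))
        (Submodule.smul_mem _ _ (hp _)))
    exact this trivial
  obtain ⟨g, hg⟩ := Submodule.mem_span_singleton.mp h
  exact ⟨g, hg.symm⟩

/-- Through `X ↦ s`, the field `K` is the fraction field of `ℂ[X]`. Kähler differentials commute
with localization, so the basis `dX` becomes the basis `ds`. -/
theorem D_ne_zero : D ℂ K s ≠ 0 := by
  let _ : Algebra ℂ[X] K := (aeval (R := ℂ) s).toAlgebra
  have hmap : ∀ P : ℂ[X], algebraMap ℂ[X] K P = aeval s P := fun _ => rfl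
  have : IsScalarTower ℂ ℂ[X] K := IsScalarTower.of_algebraMap_eq fun c => by
    rw [hmap, algebraMap_eq, aeval_C]
  have : FaithfulSMul ℂ[X] K :=
    (faithfulSMul_iff_algebraMap_injective _ _).mpr hs.aeval_injective
  have : IsFractionRing ℂ[X] K := by
    refine IsFractionRing.of_field _ _ fun f => ?_
    obtain ⟨P, Q, -, -, hf⟩ := hs.exists_isCoprime f
    exact ⟨P, Q, hf⟩
  let b : Module.Basis Unit ℂ[X] Ω[ℂ[X]⁄ℂ] :=
    (Module.Basis.singleton Unit ℂ[X]).map (polynomialEquiv ℂ).symm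
  let b' := b.ofIsLocalizedModule K (nonZeroDivisors ℂ[X]) (map ℂ ℂ ℂ[X] K)
  have h1 : b' () = D ℂ K s := by
    rw [Module.Basis.ofIsLocalizedModule_apply]
    simp [b, hmap]
  rw [← h1]
  exact b'.ne_zero _

theorem derivation_mem_place (δ : Derivation ℂ K K) (hδ : δ s = 1) {f : K} (hf : f ∈ hs.place) :
    δ f ∈ hs.place := by
  obtain ⟨P, Q, hQ, rfl⟩ := hf
  have hV := hs.algebraMap_mem_place
  have hsV := hs.mem_nonunits_place
  have hsV' := ValuationSubring.mem_of_mem_nonunits hsV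
  simp only [Derivation.leibniz_div, Derivation.map_aeval, hδ, smul_eq_mul, mul_one]
  exact mul_mem (pow_mem (aeval_inv_mem hV hsV hQ) 2)
    (sub_mem (mul_mem (aeval_mem hV hsV' _) (aeval_mem hV hsV' _))
      (mul_mem (aeval_mem hV hsV' _) (aeval_mem hV hsV' _)))

/-- Here `δ` plays the role of `d/ds`, obtained from a functional dual to `ds`; by the quotient rule
it preserves regularity at `s = 0`. -/
theorem exists_derivation : ∃ (ψ : Ω[K⁄ℂ] →ₗ[K] K) (δ : Derivation ℂ K K),
    ψ (D ℂ K s) = 1 ∧ (∀ f, ψ (D ℂ K f) = δ f) ∧ ∀ f ∈ hs.place, δ f ∈ hs.place := by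
  obtain ⟨ψ, hψ⟩ := Module.Projective.exists_dual_eq_one K hs.D_ne_zero
  exact ⟨ψ, ψ.compDer (D ℂ K), hψ, fun f => rfl,
    fun f hf => hs.derivation_mem_place (ψ.compDer (D ℂ K)) hψ hf⟩

theorem div_mem_place {f : K} (hf : f ∈ hs.place.nonunits) : f / s ∈ hs.place := by
  obtain ⟨P, Q, hQ, rfl⟩ := ValuationSubring.mem_of_mem_nonunits hf
  have hV := hs.algebraMap_mem_place
  have hsV := hs.mem_nonunits_place
  have h1 := hs.aeval_ne_zero_of_coeff_zero hQ
  have h2 := ValuationSubring.mul_mem_nonunits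
    (aeval_mem hV (ValuationSubring.mem_of_mem_nonunits hsV) Q) hf
  rw [mul_div_cancel₀ _ h1] at h2
  have h3 := ValuationSubring.add_mem_nonunits h2
    (ValuationSubring.neg_mem_nonunits (aeval_sub_mem_nonunits hV hsV P))
  rw [neg_sub, add_sub_cancel, ValuationSubring.algebraMap_mem_nonunits_iff hV] at h3
  refine ⟨P.divX, Q, hQ, ?_⟩
  have h4 : P = P.divX * X := by conv_lhs => rw [← divX_mul_X_add P, h3, C_0, add_zero]
  conv_lhs => rw [h4, map_mul, aeval_X, mul_div_right_comm, mul_div_cancel_right₀ _ hs.ne_zero]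

/-- The coefficient of a `1`-form with respect to the local coordinate `s`, compared with its
expression in another local coordinate. -/
theorem coefficient_mem_place {t g h : K} (ht : t ∈ hs.place) (hh : h ∈ hs.place)
    (heq : g • D ℂ K s = h • D ℂ K t) : g ∈ hs.place := by
  obtain ⟨ψ, δ, h1, h2, h3⟩ := hs.exists_derivation
  have := congrArg ψ heq
  rw [map_smul, map_smul, h1, h2, smul_eq_mul, smul_eq_mul, mul_one] at this
  rw [this]
  exact mul_mem hh (h3 _ ht)

/-- The residue does not depend on the uniformizer: with `t = s w` and `w` a unit, `dt / t = ds / s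
+ dw / w`, and the last term is regular. -/
theorem mul_sub_mem_nonunits_place {t g h : K} (ht0 : t ≠ 0) (ht : t ∈ hs.place.nonunits)
    (htu : ∀ a ∈ hs.place.nonunits, a / t ∈ hs.place) (hh : h ∈ hs.place)
    (heq : g • D ℂ K s = (h / t) • D ℂ K t) : g * s - h ∈ hs.place.nonunits := by
  obtain ⟨ψ, δ, h1, h2, h3⟩ := hs.exists_derivation
  have h4 := congrArg ψ heq
  rw [map_smul, map_smul, h1, h2, smul_eq_mul, smul_eq_mul, mul_one] at h4
  have h5 : δ t = t / s + s * δ (t / s) := by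
    have h6 : t = s * (t / s) := by rw [mul_div_cancel₀ _ hs.ne_zero]
    have h7 : δ s = 1 := by rw [← h2, h1]
    conv_lhs => rw [h6, Derivation.leibniz, h7, smul_eq_mul, smul_eq_mul, mul_one]
    ring
  have h8 : g * s - h = h * (s / t) * δ (t / s) * s := by
    rw [h4, h5]
    have := hs.ne_zero
    field_simp
    ring
  rw [h8]
  exact ValuationSubring.mul_mem_nonunits (mul_mem (mul_mem hh (htu _ hs.mem_nonunits_place))
    (h3 _ (hs.div_mem_place ht))) hs.mem_nonunits_place


/-- A rational function without poles outside `a` and `b` and with at most simple poles there. -/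
theorem eq_const_div_of_mem_places {g : K} {a b : ℂ} (hab : a ≠ b)
    (ha : g * (s - algebraMap ℂ K a) ∈ (hs.sub_algebraMap a).place)
    (hb : g * (s - algebraMap ℂ K b) ∈ (hs.sub_algebraMap b).place)
    (hc : ∀ c, c ≠ a → c ≠ b → g ∈ (hs.sub_algebraMap c).place)
    (hinf : g * s ^ 2 ∈ hs.inv.place) :
    ∃ k : ℂ, g = algebraMap ℂ K k / ((s - algebraMap ℂ K a) * (s - algebraMap ℂ K b)) := by
  have hmem : ∀ c d : ℂ, s - algebraMap ℂ K d ∈ (hs.sub_algebraMap c).place := by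
    intro c d
    have h1 := add_mem (ValuationSubring.mem_of_mem_nonunits
      (hs.sub_algebraMap c).mem_nonunits_place) ((hs.sub_algebraMap c).algebraMap_mem_place (c - d))
    rwa [map_sub, sub_add_sub_cancel] at h1
  have hne : ∀ c : ℂ, s - algebraMap ℂ K c ≠ 0 := fun c => (hs.sub_algebraMap c).ne_zero
  -- This function has no pole on the projective line and is therefore constant. The factor `s ^ 2`
  -- in `hinf` reflects the double pole of `ds` at infinity.
  set q := g * ((s - algebraMap ℂ K a) * (s - algebraMap ℂ K b)) with hq
  have hqc : ∀ c, q ∈ (hs.sub_algebraMap c).place := by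
    intro c
    by_cases h1 : c = a
    · subst h1
      rw [hq, ← mul_assoc]
      exact mul_mem ha (hmem _ _)
    by_cases h2 : c = b
    · subst h2
      rw [hq, mul_left_comm, mul_comm]
      exact mul_mem hb (hmem _ _)
    · exact mul_mem (hc c h1 h2) (mul_mem (hmem _ _) (hmem _ _))
  have hqinf : q ∈ hs.inv.place := by
    have h1 : ∀ d : ℂ, 1 - algebraMap ℂ K d * s⁻¹ ∈ hs.inv.place := fun d =>
      sub_mem (one_mem _) (mul_mem (hs.inv.algebraMap_mem_place d)
        (ValuationSubring.mem_of_mem_nonunits hs.inv.mem_nonunits_place))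
    have h2 : q = g * s ^ 2 * ((1 - algebraMap ℂ K a * s⁻¹) * (1 - algebraMap ℂ K b * s⁻¹)) := by
      have := hs.ne_zero
      rw [hq]
      field_simp
    rw [h2]
    exact mul_mem hinf (mul_mem (h1 _) (h1 _))
  obtain ⟨P, Q, ⟨u, v, huv⟩, hQ, hPQ⟩ := hs.exists_isCoprime q
  -- A root `c` of `Q` would be a pole of `q`, since `P` and `Q` are coprime.
  have hQ0 : Q.degree = 0 := by
    by_contra hd
    obtain ⟨c, hc'⟩ := IsAlgClosed.exists_root Q hd
    obtain ⟨A, B, hB, hAB⟩ := hqc c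
    have hB' := (hs.sub_algebraMap c).aeval_ne_zero_of_coeff_zero hB
    rw [hPQ, div_eq_div_iff (hs.aeval_ne_zero hQ) hB'] at hAB
    have hcomp : ∀ R : ℂ[X], aeval (s - algebraMap ℂ K c) R = aeval s (R.comp (X - C c)) := by
      intro R
      rw [aeval_comp]
      simp
    rw [hcomp, hcomp, ← map_mul, ← map_mul] at hAB
    have h1 := congrArg (eval c) (hs.aeval_injective hAB)
    rw [eval_mul, eval_mul, hc'.eq_zero, mul_zero, eval_comp] at h1
    simp only [eval_sub, eval_X, eval_C, sub_self, ← coeff_zero_eq_eval_zero, mul_eq_zero, hB,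
      or_false] at h1
    have h2 := congrArg (eval c) huv
    simp [h1, hc'.eq_zero] at h2
  obtain ⟨k, hk⟩ := (⟨_, eq_C_of_degree_eq_zero hQ0⟩ : ∃ k, Q = C k)
  have hk0 : k ≠ 0 := by
    rintro rfl
    exact hQ (by rw [hk, C_0])
  -- A nonconstant `P` would give a pole at infinity: `P(s)` is `s ^ deg P` times the reversed
  -- polynomial in `s⁻¹`, whose constant coefficient is the leading coefficient of `P`.
  have hP0 : P.natDegree = 0 := by
    by_contra hd
    obtain ⟨A, B, hB, hAB⟩ := hqinf
    have hB' := hs.inv.aeval_ne_zero_of_coeff_zero hB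
    rw [hPQ, hk, aeval_C] at hAB
    have h1 : aeval s P = aeval s⁻¹ P.reverse * s ^ P.natDegree := by
      rw [aeval_def, aeval_def]
      let _ := invertibleOfNonzero hs.ne_zero
      have := eval₂_reverse_mul_pow (algebraMap ℂ K) s P
      rw [invOf_eq_inv] at this
      exact this.symm
    have h2 : aeval s⁻¹ (P.reverse * B) = aeval s⁻¹ (A * C k * X ^ P.natDegree) := by
      have hk' : algebraMap ℂ K k ≠ 0 := by simpa using hk0
      rw [div_eq_div_iff hk' hB', h1] at hAB
      simp only [map_mul, map_pow, aeval_X, aeval_C, inv_pow]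
      rw [← hAB, mul_right_comm, mul_right_comm _ (s ^ _),
        inv_mul_cancel_right₀ (pow_ne_zero P.natDegree hs.ne_zero)]
    have h3 := congrArg (fun R => coeff R 0) (hs.inv.aeval_injective h2)
    simp only [mul_coeff_zero, coeff_zero_reverse, coeff_X_pow, Ne.symm hd, if_false, mul_zero,
      mul_eq_zero, hB, or_false, leadingCoeff_eq_zero] at h3
    exact hd (by rw [h3, natDegree_zero])
  obtain ⟨m, hm⟩ := (⟨_, eq_C_of_natDegree_eq_zero hP0⟩ : ∃ m, P = C m)
  refine ⟨m / k, ?_⟩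
  rw [eq_div_iff (mul_ne_zero (hne a) (hne b)), ← hq, hPQ, hm, hk, aeval_C, aeval_C, map_div₀]

end IsRationalGenerator

end RationalFunctionField

end PosGeom

namespace PosGeom

/-! ### Curves with a polynomial parametrization -/

theorem chart_ne_zero (p : CP2) : p.rep (chart p) ≠ 0 := by
  rw [chart]
  split_ifs with h2 h1
  · exact h2
  · exact h1
  · intro h0
    apply p.rep_nonzero
    funext i
    fin_cases i
    · exact h0
    · exact not_not.mp h1
    · exact not_not.mp h2

theorem xi_ne_zero (i : Fin 3) : xi i ≠ 0 := by
  simpa using aeval_xi_ne_zero (MvPolynomial.isHomogeneous_X ℂ i) (MvPolynomial.X_ne_zero i)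

theorem localCoord_chart (p : CP2) : localCoord p (chart p) = 0 := by
  rw [localCoord, div_self (xi_ne_zero _), div_self (chart_ne_zero p), map_one, sub_self]

theorem eq_chart_or (p : CP2) (j : Fin 3) : j = chart p ∨ j = chart p + 1 ∨ j = chart p + 2 := by
  generalize chart p = k
  revert j k
  decide

theorem hasValue_zero_localCoord (p : CP2) (j : Fin 3) :
    HasValue (uAt p) (vAt p) (localCoord p j) 0 := by
  rcases eq_chart_or p j with rfl | rfl | rfl
  · exact ⟨0, 1, by simp, by simp [localCoord_chart], by simp⟩
  · exact ⟨MvPolynomial.X 0, 1, by simp, by simp [uAt], by simp⟩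
  · exact ⟨MvPolynomial.X 1, 1, by simp, by simp [vAt], by simp⟩

namespace PlaneCurve

variable (D : PlaneCurve)

/-- The quotient of homogeneous coordinates `x_j / x_k` as a function on the curve. -/
def coordQuotient (j k : Fin 3) (hk : ¬ D.F ∣ MvPolynomial.X k) : D.localRing :=
  ⟨xi j / xi k, 1, MvPolynomial.X j, MvPolynomial.X k, MvPolynomial.isHomogeneous_X _ _,
    MvPolynomial.isHomogeneous_X _ _, hk, by simp⟩

/-- The affine coordinates as functions on the curve. -/
def affineCoord (h2 : ¬ D.F ∣ MvPolynomial.X 2) (j : Fin 3) : D.localRing :=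
  D.coordQuotient j 2 h2

theorem coe_affineCoord (h2 : ¬ D.F ∣ MvPolynomial.X 2) (j : Fin 3) :
    (D.affineCoord h2 j : K2) = xi j := by
  simp [affineCoord, coordQuotient, xi, Matrix.cons_val]

theorem coe_aeval_affineCoord (h2 : ¬ D.F ∣ MvPolynomial.X 2) (P : MvPolynomial (Fin 3) ℂ) :
    ((MvPolynomial.aeval (D.affineCoord h2) P : D.localRing) : K2) = MvPolynomial.aeval xi P := by
  have : (MvPolynomial.aeval (D.affineCoord h2) P : D.localRing) =
      (D.localRing.val (MvPolynomial.aeval (D.affineCoord h2) P) : K2) := rfl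
  rw [this, ← AlgHom.comp_apply, MvPolynomial.comp_aeval]
  congr 2
  funext j
  exact D.coe_affineCoord h2 j

theorem not_isUnit_of_dvd {f : D.localRing} {n : ℕ} {P Q : MvPolynomial (Fin 3) ℂ}
    (hP : P.IsHomogeneous n) (hQ : Q.IsHomogeneous n) (hdP : D.F ∣ P) (hdQ : ¬ D.F ∣ Q)
    (hf : (f : K2) = MvPolynomial.aeval xi P / MvPolynomial.aeval xi Q) : ¬ IsUnit f := by
  intro h
  obtain ⟨k, hk⟩ := h.exists_right_inv
  obtain ⟨l, R, S, hR, hS, hdS, h3⟩ := k.2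
  have e1 := D.aeval_ne_zero hQ hdQ
  have e3 := D.aeval_ne_zero hS hdS
  have hk' : (f : K2) * (k : K2) = 1 := congrArg Subtype.val hk
  rw [hf, h3, div_mul_div_comm, div_eq_one_iff_eq (mul_ne_zero e1 e3)] at hk'
  have h4 : P * R - Q * S = 0 := by
    by_contra h
    refine aeval_xi_ne_zero ((hP.mul hR).sub (hQ.mul hS)) h ?_
    simp only [map_sub, map_mul, hk', sub_self]
  exact D.not_dvd_mul hdQ hdS (sub_eq_zero.mp h4 ▸ hdP.mul_right R)

/-- In affine coordinates `P` is the degree-zero fraction `P / X 2 ^ n`, whose denominator is prime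
to `D.F`; it is a unit exactly when `D.F` does not divide `P`. This turns identities in the function
field into divisibility. -/
theorem residue_aeval_affineCoord_eq_zero_iff (h2 : ¬ D.F ∣ MvPolynomial.X 2) {n : ℕ}
    {P : MvPolynomial (Fin 3) ℂ} (hP : P.IsHomogeneous n) :
    IsLocalRing.residue D.localRing (MvPolynomial.aeval (D.affineCoord h2) P) = 0 ↔ D.F ∣ P := by
  rw [IsLocalRing.residue_eq_zero_iff, IsLocalRing.mem_maximalIdeal, mem_nonunits_iff]
  have hX : (MvPolynomial.X 2 ^ n : MvPolynomial (Fin 3) ℂ).IsHomogeneous n :=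
    MvPolynomial.isHomogeneous_X_pow _ _
  have hd : ¬ D.F ∣ MvPolynomial.X 2 ^ n := fun h => h2 (D.irreducible.prime.dvd_of_dvd_pow h)
  have he : ((MvPolynomial.aeval (D.affineCoord h2) P : D.localRing) : K2) =
      MvPolynomial.aeval xi P / MvPolynomial.aeval xi (MvPolynomial.X 2 ^ n : MvPolynomial (Fin 3) ℂ) := by
    rw [coe_aeval_affineCoord]
    simp [xi, Matrix.cons_val]
  constructor
  · intro h
    by_contra hdP
    exact h (D.isUnit_of_not_dvd hP hX hdP hd he)
  · exact fun h => D.not_isUnit_of_dvd hP hX h hd he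

/-- The parametrization `γ` of the curve `D` with parameter the rational function `τ`. -/
structure IsParametrization (γ : Fin 3 → Polynomial ℂ) (τ : D.FunctionField) : Prop where
  not_dvd_X : ∀ i, ¬ D.F ∣ MvPolynomial.X i
  apply_zero : ∃ m, m ≠ 0 ∧ γ 0 = Polynomial.X ^ m
  apply_two : γ 2 = 1
  residue_affineCoord : ∀ j, IsLocalRing.residue D.localRing (D.affineCoord (not_dvd_X 2) j) =
    Polynomial.aeval τ (γ j)
  generator : IsRationalGenerator τ

theorem residue_aeval {γ : Fin 3 → Polynomial ℂ} {τ : D.FunctionField}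
    {h2 : ¬ D.F ∣ MvPolynomial.X 2}
    (hr : ∀ j, IsLocalRing.residue D.localRing (D.affineCoord h2 j) = Polynomial.aeval τ (γ j))
    (P : MvPolynomial (Fin 3) ℂ) :
    IsLocalRing.residue D.localRing (MvPolynomial.aeval (D.affineCoord h2) P) =
      Polynomial.aeval τ (MvPolynomial.aeval γ P) := by
  have h1 : IsLocalRing.residue D.localRing (MvPolynomial.aeval (D.affineCoord h2) P) =
      (Algebra.ofId D.localRing D.FunctionField).restrictScalars ℂ
        (MvPolynomial.aeval (D.affineCoord h2) P) := rfl
  rw [h1, ← AlgHom.comp_apply, ← AlgHom.comp_apply, MvPolynomial.comp_aeval,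
    MvPolynomial.comp_aeval]
  congr 2
  funext j
  exact hr j

/-- An algebraic `τ` would be a constant `c`, and then `X 0 - c ^ m * X 2` would vanish on `D`,
although its pullback `X ^ m - c ^ m` is nonzero. Generation holds because every function is a
quotient of polynomials in the affine coordinates, which are polynomials in `τ`. -/
theorem isParametrization_of_residue {γ : Fin 3 → Polynomial ℂ} {τ : D.FunctionField}
    (hX : ∀ i, ¬ D.F ∣ MvPolynomial.X i)
    (hF : ∀ Q, D.F ∣ Q → MvPolynomial.aeval γ Q = 0) {m : ℕ} (hm : m ≠ 0)
    (h0 : γ 0 = Polynomial.X ^ m) (h2 : γ 2 = 1)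
    (hr : ∀ j, IsLocalRing.residue D.localRing (D.affineCoord (hX 2) j) =
      Polynomial.aeval τ (γ j)) : D.IsParametrization γ τ := by
  refine ⟨hX, ⟨m, hm, h0⟩, h2, hr, ?_, ?_⟩
  · intro halg
    have := IntermediateField.isAlgebraic_adjoin_simple (isAlgebraic_iff_isIntegral.mp halg)
    obtain ⟨c, hc⟩ := (IsAlgClosed.algebraMap_bijective_of_isIntegral
      (k := ℂ) (K := IntermediateField.adjoin ℂ {τ})).surjective ⟨τ, IntermediateField.mem_adjoin_simple_self ℂ τ⟩
    have hc' : algebraMap ℂ D.FunctionField c = τ := congrArg Subtype.val hc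
    have h3 := (D.residue_aeval_affineCoord_eq_zero_iff (hX 2)
      (P := MvPolynomial.X 0 - MvPolynomial.C (c ^ m) * MvPolynomial.X 2)
      ((MvPolynomial.isHomogeneous_X _ _).sub (MvPolynomial.isHomogeneous_C_mul_X _ _))).mp (by
        rw [D.residue_aeval hr]
        simp [h0, h2, ← hc'])
    have h4 := hF _ h3
    rw [map_sub, map_mul, MvPolynomial.aeval_X, MvPolynomial.aeval_X, MvPolynomial.aeval_C, h0,
      h2, mul_one, Polynomial.algebraMap_eq] at h4
    exact Polynomial.X_pow_sub_C_ne_zero (Nat.pos_of_ne_zero hm) _ h4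
  · rw [eq_top_iff]
    intro f _
    obtain ⟨f, rfl⟩ := IsLocalRing.residue_surjective f
    obtain ⟨n, P, Q, hP, hQ, hd, hf⟩ := f.2
    have h3 : f * MvPolynomial.aeval (D.affineCoord (hX 2)) Q =
        MvPolynomial.aeval (D.affineCoord (hX 2)) P := by
      apply Subtype.ext
      change (f : K2) * ((MvPolynomial.aeval (D.affineCoord (hX 2)) Q : D.localRing) : K2) = _
      rw [coe_aeval_affineCoord, coe_aeval_affineCoord, hf,
        div_mul_cancel₀ _ (D.aeval_ne_zero hQ hd)]
    have h4 := mt (D.residue_aeval_affineCoord_eq_zero_iff (hX 2) hQ).mp hd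
    have h5 := congrArg (IsLocalRing.residue D.localRing) h3
    rw [map_mul] at h5
    rw [eq_div_of_mul_eq h4 h5, D.residue_aeval hr, D.residue_aeval hr]
    exact IntermediateField.mem_adjoin_simple_iff ℂ _ |>.mpr ⟨_, _, rfl⟩

variable {D}

/-! ### Places of a parametrized curve and the points below them -/

namespace IsParametrization

variable {γ : Fin 3 → Polynomial ℂ} {τ : D.FunctionField} (h : D.IsParametrization γ τ)
include h

theorem eval_ne_zero (c : ℂ) : (fun j => (γ j).eval c) ≠ 0 := by
  intro h0
  simpa [h.apply_two] using congrFun h0 2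

/-- The point of the curve with parameter `c`. -/
def point (c : ℂ) : CP2 := Projectivization.mk ℂ (fun j => (γ j).eval c) (h.eval_ne_zero c)

theorem aeval_coord_ne_zero (k : Fin 3) : Polynomial.aeval τ (γ k) ≠ 0 := by
  rw [← h.residue_affineCoord k]
  have := mt (D.residue_aeval_affineCoord_eq_zero_iff (h.not_dvd_X 2)
    (MvPolynomial.isHomogeneous_X ℂ k)).mp (h.not_dvd_X k)
  rwa [MvPolynomial.aeval_X] at this

theorem residue_coordQuotient (j k : Fin 3) :
    IsLocalRing.residue D.localRing (D.coordQuotient j k (h.not_dvd_X k)) =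
      Polynomial.aeval τ (γ j) / Polynomial.aeval τ (γ k) := by
  rw [eq_div_iff (h.aeval_coord_ne_zero k), ← h.residue_affineCoord k, ← h.residue_affineCoord j,
    ← map_mul]
  congr 1
  apply Subtype.ext
  change (xi j / xi k) * (D.affineCoord (h.not_dvd_X 2) k : K2) = D.affineCoord (h.not_dvd_X 2) j
  rw [coe_affineCoord, coe_affineCoord, div_mul_cancel₀ _ (xi_ne_zero k)]

/-- The local coordinates at `p` as functions on the curve. -/
def localCoord (p : CP2) (j : Fin 3) : D.localRing :=
  D.coordQuotient j (chart p) (h.not_dvd_X _) -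
    algebraMap ℂ D.localRing (p.rep j / p.rep (chart p))

theorem coe_localCoord (p : CP2) (j : Fin 3) :
    (h.localCoord p j : K2) = PosGeom.localCoord p j := rfl

theorem residue_localCoord (p : CP2) (j : Fin 3) :
    IsLocalRing.residue D.localRing (h.localCoord p j) =
      Polynomial.aeval τ (γ j) / Polynomial.aeval τ (γ (chart p)) -
        algebraMap ℂ D.FunctionField (p.rep j / p.rep (chart p)) := by
  rw [localCoord, map_sub, h.residue_coordQuotient]
  rfl

omit h in
theorem mvAeval_sub_mem_nonunits {V : ValuationSubring D.FunctionField}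
    (hV : ∀ c : ℂ, algebraMap ℂ D.FunctionField c ∈ V) {w : Fin 2 → D.FunctionField}
    (hw : ∀ i, w i ∈ V.nonunits) (P : MvPolynomial (Fin 2) ℂ) :
    MvPolynomial.aeval w P - algebraMap ℂ D.FunctionField (MvPolynomial.constantCoeff P) ∈
      V.nonunits := by
  have h0 : (0 : D.FunctionField) ∈ V.nonunits := V.mem_nonunits_iff_inv_notMem.mpr (Or.inl rfl)
  induction P using MvPolynomial.induction_on with
  | C a => simp [h0]
  | add P Q hP hQ =>
    have := V.add_mem_nonunits hP hQ
    convert this using 1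
    simp only [map_add]
    ring
  | mul_X P i hP =>
    have h1 : MvPolynomial.aeval w P ∈ V := by
      have := add_mem (V.mem_of_mem_nonunits hP) (hV (MvPolynomial.constantCoeff P))
      rwa [sub_add_cancel] at this
    simpa using V.mul_mem_nonunits h1 (hw i)

/-- The local ring at `p` consists of fractions in the two local coordinates with denominators
nonzero at `p`. It is therefore enough to control the values at `V` of the coordinate functions
themselves. -/
theorem liesOver_iff {V : ValuationSubring D.FunctionField}
    (hV : ∀ c : ℂ, algebraMap ℂ D.FunctionField c ∈ V) (p : CP2) :
    D.LiesOver V p ↔ ∀ j, Polynomial.aeval τ (γ j) / Polynomial.aeval τ (γ (chart p)) -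
      algebraMap ℂ D.FunctionField (p.rep j / p.rep (chart p)) ∈ V.nonunits := by
  constructor
  · intro hl j
    have := hl (h.localCoord p j) 0 (h.coe_localCoord p j ▸ hasValue_zero_localCoord p j)
    rwa [map_zero, sub_zero, h.residue_localCoord] at this
  · rintro hl f c ⟨P, Q, hQ, hf, rfl⟩
    set w : Fin 2 → D.localRing := ![h.localCoord p (chart p + 1), h.localCoord p (chart p + 2)]
      with hwdef
    have hcoe : ∀ R : MvPolynomial (Fin 2) ℂ, ((MvPolynomial.aeval w R : D.localRing) : K2) =
        MvPolynomial.aeval ![uAt p, vAt p] R := by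
      intro R
      have : ((MvPolynomial.aeval w R : D.localRing) : K2) =
        D.localRing.val (MvPolynomial.aeval w R) := rfl
      rw [this, ← AlgHom.comp_apply, MvPolynomial.comp_aeval]
      congr 2
      funext i
      fin_cases i <;> rfl
    set w' : Fin 2 → D.FunctionField := fun i => IsLocalRing.residue D.localRing (w i) with hw'
    have hres : ∀ R : MvPolynomial (Fin 2) ℂ, IsLocalRing.residue D.localRing
        (MvPolynomial.aeval w R) = MvPolynomial.aeval w' R := by
      intro R
      have h1 : IsLocalRing.residue D.localRing (MvPolynomial.aeval w R) =
        (Algebra.ofId D.localRing D.FunctionField).restrictScalars ℂ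
          (MvPolynomial.aeval w R) := rfl
      rw [h1, ← AlgHom.comp_apply, MvPolynomial.comp_aeval]
      rfl
    have hw : ∀ i, w' i ∈ V.nonunits := by
      intro i
      fin_cases i
      · change IsLocalRing.residue D.localRing (h.localCoord p (chart p + 1)) ∈ _
        rw [h.residue_localCoord]
        exact hl _
      · change IsLocalRing.residue D.localRing (h.localCoord p (chart p + 2)) ∈ _
        rw [h.residue_localCoord]
        exact hl _
    have hP := mvAeval_sub_mem_nonunits hV hw P
    have hQ' := mvAeval_sub_mem_nonunits hV hw Q
    -- The denominator is congruent to its nonzero constant coefficient modulo the maximal ideal,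
    -- hence is a unit of `V`.
    have hQi : (MvPolynomial.aeval w' Q)⁻¹ ∈ V ∧ MvPolynomial.aeval w' Q ≠ 0 := by
      have h1 : MvPolynomial.aeval w' Q ∉ V.nonunits := by
        intro h1
        have h2 := V.add_mem_nonunits h1 (V.neg_mem_nonunits hQ')
        rw [neg_sub, add_sub_cancel, V.algebraMap_mem_nonunits_iff hV] at h2
        exact hQ h2
      rw [V.mem_nonunits_iff_inv_notMem, not_or, not_not] at h1
      exact h1.symm
    have hQ0 : MvPolynomial.aeval ![uAt p, vAt p] Q ≠ 0 := by
      intro h0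
      apply hQi.2
      rw [← hres, show MvPolynomial.aeval w Q = 0 from Subtype.ext (by rw [hcoe, h0]; rfl),
        map_zero]
    have hfQ : f * MvPolynomial.aeval w Q = MvPolynomial.aeval w P := by
      apply Subtype.ext
      change (f : K2) * ((MvPolynomial.aeval w Q : D.localRing) : K2) = _
      rw [hcoe, hcoe, hf, div_mul_cancel₀ _ hQ0]
    have h5 := congrArg (IsLocalRing.residue D.localRing) hfQ
    rw [map_mul, hres, hres] at h5
    have hc : algebraMap ℂ D.FunctionField (MvPolynomial.constantCoeff Q) ≠ 0 := by
      simpa using hQ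
    have h6 : IsLocalRing.residue D.localRing f - algebraMap ℂ D.FunctionField
        (MvPolynomial.constantCoeff P / MvPolynomial.constantCoeff Q) =
        (MvPolynomial.aeval w' Q)⁻¹ * ((MvPolynomial.aeval w' P -
          algebraMap ℂ D.FunctionField (MvPolynomial.constantCoeff P)) +
          -(algebraMap ℂ D.FunctionField (MvPolynomial.constantCoeff P /
            MvPolynomial.constantCoeff Q) * (MvPolynomial.aeval w' Q -
              algebraMap ℂ D.FunctionField (MvPolynomial.constantCoeff Q)))) := by
      rw [eq_div_of_mul_eq hQi.2 h5, map_div₀]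
      have := hQi.2
      field_simp
      ring
    rw [h6]
    exact V.mul_mem_nonunits hQi.1 (V.add_mem_nonunits hP
      (V.neg_mem_nonunits (V.mul_mem_nonunits (hV _) hQ')))

omit h in
theorem aeval_sub_eval_mem_nonunits {V : ValuationSubring D.FunctionField}
    (hV : ∀ c : ℂ, algebraMap ℂ D.FunctionField c ∈ V) {c : ℂ}
    (hc : τ - algebraMap ℂ D.FunctionField c ∈ V.nonunits) (P : Polynomial ℂ) :
    Polynomial.aeval τ P - algebraMap ℂ D.FunctionField (P.eval c) ∈ V.nonunits := by
  have h1 := aeval_sub_mem_nonunits hV hc (P.comp (Polynomial.X + Polynomial.C c))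
  rw [Polynomial.aeval_comp, Polynomial.coeff_zero_eq_eval_zero] at h1
  simpa using h1

/-- Reducing the coordinate ratios modulo the maximal ideal of `V` in two ways, by `τ ↦ c` and by
the values at `p`, shows that the two coordinate vectors are proportional. -/
theorem eq_point_of_liesOver {V : ValuationSubring D.FunctionField}
    (hV : ∀ c : ℂ, algebraMap ℂ D.FunctionField c ∈ V) {c : ℂ}
    (hc : τ - algebraMap ℂ D.FunctionField c ∈ V.nonunits) {p : CP2} (hl : D.LiesOver V p) :
    p = h.point c := by
  rw [h.liesOver_iff hV] at hl
  have hp := chart_ne_zero p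
  have key : ∀ j, (γ j).eval c = (γ (chart p)).eval c / p.rep (chart p) * p.rep j := by
    intro j
    have hk := h.aeval_coord_ne_zero (chart p)
    have h1 := V.mul_mem_nonunits (aeval_mem hV (s := τ) (by
      have := add_mem (V.mem_of_mem_nonunits hc) (hV c)
      rwa [sub_add_cancel] at this) (γ (chart p))) (hl j)
    rw [mul_sub, mul_div_cancel₀ _ hk] at h1
    have h2 := aeval_sub_eval_mem_nonunits hV hc (γ j)
    have h3 := V.mul_mem_nonunits (hV (p.rep j / p.rep (chart p)))
      (aeval_sub_eval_mem_nonunits hV hc (γ (chart p)))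
    have h4 := V.add_mem_nonunits (V.add_mem_nonunits h1 (V.neg_mem_nonunits h2)) h3
    have h5 : algebraMap ℂ D.FunctionField ((γ j).eval c -
        p.rep j / p.rep (chart p) * (γ (chart p)).eval c) ∈ V.nonunits := by
      convert h4 using 1
      simp only [map_sub, map_mul]
      ring
    rw [V.algebraMap_mem_nonunits_iff hV, sub_eq_zero] at h5
    rw [h5]
    ring
  conv_lhs => rw [← p.mk_rep]
  rw [point, Projectivization.mk_eq_mk_iff']
  have hne : (γ (chart p)).eval c ≠ 0 := by
    intro h0
    apply h.eval_ne_zero c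
    funext j
    rw [key j, h0]
    simp
  refine ⟨((γ (chart p)).eval c / p.rep (chart p))⁻¹, ?_⟩
  funext j
  rw [Pi.smul_apply, smul_eq_mul, key j, inv_mul_cancel_left₀ (div_ne_zero hne hp)]

theorem liesOver_point {V : ValuationSubring D.FunctionField}
    (hV : ∀ c : ℂ, algebraMap ℂ D.FunctionField c ∈ V) {c : ℂ}
    (hc : τ - algebraMap ℂ D.FunctionField c ∈ V.nonunits) : D.LiesOver V (h.point c) := by
  rw [h.liesOver_iff hV]
  intro j
  set k := chart (h.point c) with hk
  obtain ⟨a, ha⟩ := Projectivization.exists_smul_eq_mk_rep ℂ (fun j => (γ j).eval c)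
    (h.eval_ne_zero c)
  have hrep : ∀ i, (h.point c).rep i = a * (γ i).eval c := fun i => (congrFun ha i).symm
  have hk0 : (γ k).eval c ≠ 0 := by
    intro h0
    apply chart_ne_zero (h.point c)
    rw [← hk, hrep, h0, mul_zero]
  have hkK : algebraMap ℂ D.FunctionField ((γ k).eval c) ≠ 0 := by simpa using hk0
  have hτ := h.aeval_coord_ne_zero k
  have hinv : (Polynomial.aeval τ (γ k))⁻¹ ∈ V := by
    by_contra h1
    have h2 := V.mem_nonunits_iff_inv_notMem.mpr (Or.inr h1)
    have h3 := V.add_mem_nonunits h2 (V.neg_mem_nonunits (aeval_sub_eval_mem_nonunits hV hc (γ k)))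
    rw [neg_sub, add_sub_cancel, V.algebraMap_mem_nonunits_iff hV] at h3
    exact hk0 h3
  rw [hrep, hrep, mul_div_mul_left _ _ a.ne_zero]
  have h1 : Polynomial.aeval τ (γ j) / Polynomial.aeval τ (γ k) -
      algebraMap ℂ D.FunctionField ((γ j).eval c / (γ k).eval c) =
      (Polynomial.aeval τ (γ k))⁻¹ * ((Polynomial.aeval τ (γ j) -
        algebraMap ℂ D.FunctionField ((γ j).eval c)) +
        -(algebraMap ℂ D.FunctionField ((γ j).eval c / (γ k).eval c) * (Polynomial.aeval τ (γ k) -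
          algebraMap ℂ D.FunctionField ((γ k).eval c)))) := by
    rw [map_div₀]
    field_simp
    ring
  rw [h1]
  exact V.mul_mem_nonunits hinv (V.add_mem_nonunits (aeval_sub_eval_mem_nonunits hV hc _)
    (V.neg_mem_nonunits (V.mul_mem_nonunits (hV _) (aeval_sub_eval_mem_nonunits hV hc _))))

theorem chart_point (c : ℂ) : chart (h.point c) = 2 := by
  obtain ⟨a, ha⟩ := Projectivization.exists_smul_eq_mk_rep ℂ (fun j => (γ j).eval c)
    (h.eval_ne_zero c)
  have hrep : (h.point c).rep 2 = a * (γ 2).eval c := (congrFun ha 2).symm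
  rw [chart, if_pos]
  rw [hrep, h.apply_two]
  simp

/-- Over an affine point the coordinate `x = τ ^ m` is regular, which forces `τ ∈ V`. -/
theorem not_liesOver_point_of_inv_mem {V : ValuationSubring D.FunctionField}
    (hV : ∀ c : ℂ, algebraMap ℂ D.FunctionField c ∈ V) (hτ : τ⁻¹ ∈ V.nonunits) (c : ℂ) :
    ¬ D.LiesOver V (h.point c) := by
  intro hl
  rw [h.liesOver_iff hV, h.chart_point] at hl
  have h1 := add_mem (V.mem_of_mem_nonunits (hl 0)) (hV ((h.point c).rep 0 / (h.point c).rep 2))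
  obtain ⟨m, hm, h0⟩ := h.apply_zero
  rw [sub_add_cancel, h0, h.apply_two, map_one, div_one, map_pow, Polynomial.aeval_X] at h1
  rw [V.mem_nonunits_iff_inv_notMem, inv_inv] at hτ
  rcases hτ with hτ | hτ
  · exact h.generator.ne_zero (inv_eq_zero.mp hτ)
  · apply hτ
    rw [← V.valuation_le_one_iff] at h1 ⊢
    rwa [map_pow, pow_le_one_iff hm] at h1

/-- The place of the curve with parameter `c`. -/
abbrev placeAt (c : ℂ) : ValuationSubring D.FunctionField := (h.generator.sub_algebraMap c).place

theorem placeAt_mem_placesOver (c : ℂ) : h.placeAt c ∈ D.placesOver (h.point c) :=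
  ⟨⟨(h.generator.sub_algebraMap c).place_ne_top,
    (h.generator.sub_algebraMap c).algebraMap_mem_place⟩,
    h.liesOver_point (h.generator.sub_algebraMap c).algebraMap_mem_place
      (h.generator.sub_algebraMap c).mem_nonunits_place⟩

theorem placesOver_cases {V : ValuationSubring D.FunctionField} {p : CP2}
    (hVp : V ∈ D.placesOver p) : (∃ c, V = h.placeAt c ∧ p = h.point c) ∨
      (V = h.generator.inv.place ∧ ∀ c, p ≠ h.point c) := by
  obtain ⟨⟨hVt, hV⟩, hl⟩ := hVp
  rcases exists_mem_nonunits hV hVt h.generator with ⟨c, hc⟩ | hτ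
  · exact Or.inl ⟨c, eq_place hV (h.generator.sub_algebraMap c) hc,
      h.eq_point_of_liesOver hV hc hl⟩
  · exact Or.inr ⟨eq_place hV h.generator.inv hτ,
      fun c hp => h.not_liesOver_point_of_inv_mem hV hτ c (hp ▸ hl)⟩

theorem placesOver_point {a : ℂ} (ha : ∀ c, h.point c = h.point a → c = a) :
    D.placesOver (h.point a) = {h.placeAt a} := by
  ext V
  constructor
  · intro hVp
    rcases h.placesOver_cases hVp with ⟨c, hc, hp⟩ | ⟨-, hp⟩
    · rw [hc, ha c hp.symm]
      rfl
    · exact absurd rfl (hp a)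
  · rintro rfl
    exact h.placeAt_mem_placesOver a

theorem mem_placeAt (c d : ℂ) : τ - algebraMap ℂ D.FunctionField d ∈ h.placeAt c := by
  have h1 := add_mem (ValuationSubring.mem_of_mem_nonunits
    (h.generator.sub_algebraMap c).mem_nonunits_place)
    ((h.generator.sub_algebraMap c).algebraMap_mem_place (c - d))
  rwa [map_sub, sub_add_sub_cancel] at h1

theorem inv_mem_placeAt {c d : ℂ} (hcd : c ≠ d) :
    (τ - algebraMap ℂ D.FunctionField d)⁻¹ ∈ h.placeAt c := by
  by_contra h0
  have h1 := ValuationSubring.mem_nonunits_iff_inv_notMem _ |>.mpr (Or.inr h0)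
  have h2 := ValuationSubring.add_mem_nonunits h1
    (ValuationSubring.neg_mem_nonunits (h.generator.sub_algebraMap c).mem_nonunits_place)
  rw [neg_sub, add_comm, sub_add_sub_cancel, ← map_sub,
    ValuationSubring.algebraMap_mem_nonunits_iff
      (h.generator.sub_algebraMap c).algebraMap_mem_place, sub_eq_zero] at h2
  exact hcd h2

theorem isUniformizer_sub (c : ℂ) :
    D.IsUniformizer (h.placeAt c) (τ - algebraMap ℂ D.FunctionField c) :=
  ⟨(h.generator.sub_algebraMap c).ne_zero, (h.generator.sub_algebraMap c).mem_nonunits_place,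
    fun _ ha => (h.generator.sub_algebraMap c).div_mem_place ha⟩

theorem isUniformizer_inv : D.IsUniformizer h.generator.inv.place τ⁻¹ :=
  ⟨h.generator.inv.ne_zero, h.generator.inv.mem_nonunits_place,
    fun _ ha => h.generator.inv.div_mem_place ha⟩

omit h in
theorem D_sub_algebraMap (τ : D.FunctionField) (c : ℂ) :
    KaehlerDifferential.D ℂ D.FunctionField (τ - algebraMap ℂ D.FunctionField c) =
      KaehlerDifferential.D ℂ D.FunctionField τ := by
  rw [map_sub, Derivation.map_algebraMap, sub_zero]

theorem D_eq_smul_D_inv : KaehlerDifferential.D ℂ D.FunctionField τ =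
    (-τ ^ 2) • KaehlerDifferential.D ℂ D.FunctionField τ⁻¹ := by
  have := h.generator.ne_zero
  rw [Derivation.leibniz_inv, smul_smul]
  field_simp
  simp

theorem mul_sub_mem_nonunits_of_hasResidue {g : D.FunctionField} {c r : ℂ}
    (hr : D.HasResidue (h.placeAt c) (g • KaehlerDifferential.D ℂ D.FunctionField τ) r) :
    g * (τ - algebraMap ℂ D.FunctionField c) - algebraMap ℂ D.FunctionField r ∈
      (h.placeAt c).nonunits := by
  obtain ⟨t, k, ⟨ht0, ht, htu⟩, hk, hkr, heq⟩ := hr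
  rw [← D_sub_algebraMap τ c] at heq
  have h1 := (h.generator.sub_algebraMap c).mul_sub_mem_nonunits_place ht0 ht htu hk heq
  have h2 := ValuationSubring.add_mem_nonunits h1 hkr
  rwa [sub_add_sub_cancel] at h2

theorem mem_placeAt_of_isHolomorphic {g : D.FunctionField} {c : ℂ}
    (hg : D.IsHolomorphic (h.placeAt c) (g • KaehlerDifferential.D ℂ D.FunctionField τ)) :
    g ∈ h.placeAt c := by
  obtain ⟨t, k, ⟨ht0, ht, htu⟩, hk, heq⟩ := hg
  rw [← D_sub_algebraMap τ c] at heq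
  exact (h.generator.sub_algebraMap c).coefficient_mem_place
    (ValuationSubring.mem_of_mem_nonunits ht) hk heq

theorem mem_place_inv_of_isHolomorphic {g : D.FunctionField}
    (hg : D.IsHolomorphic h.generator.inv.place
      (g • KaehlerDifferential.D ℂ D.FunctionField τ)) :
    g * τ ^ 2 ∈ h.generator.inv.place := by
  obtain ⟨t, k, ⟨ht0, ht, htu⟩, hk, heq⟩ := hg
  rw [h.D_eq_smul_D_inv, smul_smul] at heq
  have h1 := h.generator.inv.coefficient_mem_place (ValuationSubring.mem_of_mem_nonunits ht) hk heq
  rw [mul_neg] at h1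
  simpa using neg_mem h1

/-- The canonical form of a segment of the curve, up to sign. -/
def segmentForm (_ : D.IsParametrization γ τ) (a b : ℂ) : D.Form1 :=
  (algebraMap ℂ D.FunctionField (a - b) / ((τ - algebraMap ℂ D.FunctionField a) *
    (τ - algebraMap ℂ D.FunctionField b))) • KaehlerDifferential.D ℂ D.FunctionField τ

/-! ### Canonical forms of a segment of a rational curve -/

section Segment

variable {a b : ℂ} (hab : a ≠ b) (ha : ∀ c, h.point c = h.point a → c = a)
  (hb : ∀ c, h.point c = h.point b → c = b)
include hab

/-- In the coordinate `τ - a` the coefficient of `d(τ - a) / (τ - a)` is `ε (a - b) / (τ - b)`,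
which takes the value `ε` at `τ = a`. -/
theorem hasResidue_smul_segmentForm (ε : ℂ) :
    D.HasResidue (h.placeAt a) (ε • h.segmentForm a b) ε := by
  have hV := (h.generator.sub_algebraMap a).algebraMap_mem_place
  have hb0 := (h.generator.sub_algebraMap b).ne_zero
  have ha0 := (h.generator.sub_algebraMap a).ne_zero
  refine ⟨τ - algebraMap ℂ D.FunctionField a, algebraMap ℂ D.FunctionField (ε * (a - b)) *
    (τ - algebraMap ℂ D.FunctionField b)⁻¹, h.isUniformizer_sub a,
    mul_mem (hV _) (h.inv_mem_placeAt hab), ?_, ?_⟩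
  · have h1 : algebraMap ℂ D.FunctionField (ε * (a - b)) *
        (τ - algebraMap ℂ D.FunctionField b)⁻¹ - algebraMap ℂ D.FunctionField ε =
        (-algebraMap ℂ D.FunctionField ε) * (τ - algebraMap ℂ D.FunctionField b)⁻¹ *
          (τ - algebraMap ℂ D.FunctionField a) := by
      simp only [map_mul, map_sub]
      field_simp
      ring
    rw [h1]
    exact ValuationSubring.mul_mem_nonunits (mul_mem (neg_mem (hV _)) (h.inv_mem_placeAt hab))
      (h.generator.sub_algebraMap a).mem_nonunits_place
  · rw [D_sub_algebraMap, segmentForm, ← algebraMap_smul D.FunctionField ε, smul_smul]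
    congr 1
    simp only [map_mul, map_sub]
    field_simp

omit hab in
theorem segmentForm_swap : h.segmentForm b a = -h.segmentForm a b := by
  rw [segmentForm, segmentForm, ← neg_smul, ← neg_div, ← map_neg, neg_sub,
    mul_comm (τ - algebraMap ℂ D.FunctionField b)]

theorem hasResidue_smul_segmentForm_right (ε : ℂ) :
    D.HasResidue (h.placeAt b) (ε • h.segmentForm a b) (-ε) := by
  have := h.hasResidue_smul_segmentForm hab.symm (-ε)
  rwa [h.segmentForm_swap, neg_smul_neg] at this

omit hab in
theorem not_isHolomorphic_of_hasResidue {c r : ℂ} (hr0 : r ≠ 0) {θ : D.Form1}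
    (hr : D.HasResidue (h.placeAt c) θ r) : ¬ D.IsHolomorphic (h.placeAt c) θ := by
  intro hh
  obtain ⟨g, rfl⟩ := h.generator.exists_eq_smul_D θ
  have h1 := h.mul_sub_mem_nonunits_of_hasResidue hr
  have h2 := ValuationSubring.mul_mem_nonunits (h.mem_placeAt_of_isHolomorphic hh)
    (h.generator.sub_algebraMap c).mem_nonunits_place
  have h3 := ValuationSubring.add_mem_nonunits h2 (ValuationSubring.neg_mem_nonunits h1)
  rw [neg_sub, add_sub_cancel, ValuationSubring.algebraMap_mem_nonunits_iff
    (h.generator.sub_algebraMap c).algebraMap_mem_place] at h3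
  exact hr0 h3

variable {A : Set RP2} (hA : zariskiClosure (D.boundary A) = {h.point a, h.point b})
include ha hb hA

/-- The only poles are at the parameters `a` and `b`, with residues `ε` and `-ε`. By `ha` and `hb` a
single place lies over each end point, so the residue on the possibly singular curve is a sum with
one term. -/
theorem isCanonicalForm_smul_segmentForm {ε : ℂ} (hε : IsCanonicalPointForm ε) :
    D.IsCanonicalForm A (ε • h.segmentForm a b) := by
  have hε0 : ε ≠ 0 := by rcases hε with rfl | rfl <;> norm_num
  have hra := h.hasResidue_smul_segmentForm hab ε
  have hrb := h.hasResidue_smul_segmentForm_right hab ε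
  have hoff : ∀ p : CP2, ∀ V ∈ D.placesOver p, p ∉ ({h.point a, h.point b} : Set CP2) →
      D.IsHolomorphic V (ε • h.segmentForm a b) := by
    intro p V hVp hp
    simp only [Set.mem_insert_iff, Set.mem_singleton_iff, not_or] at hp
    have ha0 := (h.generator.sub_algebraMap a).ne_zero
    have hb0 := (h.generator.sub_algebraMap b).ne_zero
    rcases h.placesOver_cases hVp with ⟨c, rfl, rfl⟩ | ⟨rfl, -⟩
    · refine ⟨τ - algebraMap ℂ D.FunctionField c, algebraMap ℂ D.FunctionField (ε * (a - b)) *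
        ((τ - algebraMap ℂ D.FunctionField a)⁻¹ * (τ - algebraMap ℂ D.FunctionField b)⁻¹),
        h.isUniformizer_sub c, mul_mem ((h.generator.sub_algebraMap c).algebraMap_mem_place _)
          (mul_mem (h.inv_mem_placeAt ?_) (h.inv_mem_placeAt ?_)), ?_⟩
      · rintro rfl
        exact hp.1 rfl
      · rintro rfl
        exact hp.2 rfl
      · rw [D_sub_algebraMap, segmentForm, ← algebraMap_smul D.FunctionField ε, smul_smul]
        congr 1
        simp only [map_mul, map_sub]
        field_simp
    · have hV := h.generator.inv.algebraMap_mem_place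
      have hu : ∀ d : ℂ, (1 - algebraMap ℂ D.FunctionField d * τ⁻¹)⁻¹ ∈ h.generator.inv.place := by
        intro d
        have := aeval_inv_mem hV h.generator.inv.mem_nonunits_place
          (P := 1 - Polynomial.C d * Polynomial.X) (by simp)
        simpa using this
      -- With `s = τ⁻¹` the form is `-ε (a - b) ds / ((1 - a s)(1 - b s))`, which is regular at `s =
      -- 0`.
      refine ⟨τ⁻¹, -algebraMap ℂ D.FunctionField (ε * (a - b)) *
        ((1 - algebraMap ℂ D.FunctionField a * τ⁻¹)⁻¹ *
          (1 - algebraMap ℂ D.FunctionField b * τ⁻¹)⁻¹), h.isUniformizer_inv,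
        mul_mem (neg_mem (hV _)) (mul_mem (hu _) (hu _)), ?_⟩
      rw [segmentForm, ← algebraMap_smul D.FunctionField ε, smul_smul, h.D_eq_smul_D_inv, smul_smul]
      congr 1
      have h0 := h.generator.ne_zero
      have hd : ∀ d : ℂ, (1 - algebraMap ℂ D.FunctionField d * τ⁻¹)⁻¹ =
          τ * (τ - algebraMap ℂ D.FunctionField d)⁻¹ := by
        intro d
        rw [← mul_inv_cancel₀ h0, ← sub_mul, mul_inv, inv_inv, mul_comm]
      rw [hd, hd]
      simp only [map_mul, map_sub]
      field_simp
  refine ⟨?_, ?_⟩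
  · rw [hA]
    refine ⟨fun p V hVp => ⟨?_, hoff p V hVp⟩, ?_⟩
    · rintro (rfl | rfl)
      · rw [h.placesOver_point ha] at hVp
        exact ⟨ε, (show V = _ from hVp) ▸ hra⟩
      · rw [h.placesOver_point hb] at hVp
        exact ⟨-ε, (show V = _ from hVp) ▸ hrb⟩
    · rintro p (rfl | rfl)
      · exact ⟨_, h.placeAt_mem_placesOver a, h.not_isHolomorphic_of_hasResidue hε0 hra⟩
      · exact ⟨_, h.placeAt_mem_placesOver b,
          h.not_isHolomorphic_of_hasResidue (neg_ne_zero.mpr hε0) hrb⟩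
  · rw [hA]
    rintro p (rfl | rfl)
    · refine ⟨ε, ⟨fun _ => ε, ?_, ?_⟩, hε⟩
      · rw [h.placesOver_point ha]
        rintro V rfl
        exact hra
      · rw [h.placesOver_point ha, finsum_mem_singleton]
    · refine ⟨-ε, ⟨fun _ => -ε, ?_, ?_⟩, ?_⟩
      · rw [h.placesOver_point hb]
        rintro V rfl
        exact hrb
      · rw [h.placesOver_point hb, finsum_mem_singleton]
      · rcases hε with rfl | rfl
        · exact Or.inr rfl
        · exact Or.inl (neg_neg _)

/-- Poles that are at most simple and only at `a` and `b` leave one constant, which the residue at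
`a` determines. The residue condition at `b` serves only to bound the pole order there. The
hypothesis `hinf` is needed because holomorphy is prescribed only at places lying over some point of
the plane. -/
theorem eq_smul_segmentForm_of_isCanonicalForm (hinf : ∃ p, D.LiesOver h.generator.inv.place p)
    {θ : D.Form1} (hθ : D.IsCanonicalForm A θ) :
    ∃ ε, IsCanonicalPointForm ε ∧ θ = ε • h.segmentForm a b := by
  obtain ⟨⟨hlog, -⟩, hres⟩ := hθ
  rw [hA] at hlog hres
  obtain ⟨g, rfl⟩ := h.generator.exists_eq_smul_D θ
  have hex : ∀ c, (∀ d, h.point d = h.point c → d = c) →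
      h.point c ∈ ({h.point a, h.point b} : Set CP2) → ∃ r, IsCanonicalPointForm r ∧
      g * (τ - algebraMap ℂ D.FunctionField c) - algebraMap ℂ D.FunctionField r ∈
        (h.placeAt c).nonunits := by
    intro c hc hmem
    obtain ⟨r, ⟨ρ, hρ, hsum⟩, hr⟩ := hres _ hmem
    rw [h.placesOver_point hc] at hρ hsum
    rw [finsum_mem_singleton] at hsum
    have h1 := h.mul_sub_mem_nonunits_of_hasResidue (hρ _ rfl)
    rw [hsum] at h1
    exact ⟨r, hr, h1⟩
  obtain ⟨ε, hε, hga⟩ := hex a ha (Or.inl rfl)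
  obtain ⟨ε', -, hgb⟩ := hex b hb (Or.inr rfl)
  have hmem : ∀ {c r : ℂ}, g * (τ - algebraMap ℂ D.FunctionField c) -
      algebraMap ℂ D.FunctionField r ∈ (h.placeAt c).nonunits →
      g * (τ - algebraMap ℂ D.FunctionField c) ∈ h.placeAt c := by
    intro c r hc
    have := add_mem (ValuationSubring.mem_of_mem_nonunits hc)
      ((h.generator.sub_algebraMap c).algebraMap_mem_place r)
    rwa [sub_add_cancel] at this
  obtain ⟨p, hp⟩ := hinf
  have hpV : h.generator.inv.place ∈ D.placesOver p :=
    ⟨⟨h.generator.inv.place_ne_top, h.generator.inv.algebraMap_mem_place⟩, hp⟩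
  have hpne : ∀ c, p ≠ h.point c := fun c hpc => h.not_liesOver_point_of_inv_mem
    h.generator.inv.algebraMap_mem_place h.generator.inv.mem_nonunits_place c (hpc ▸ hp)
  obtain ⟨k, hk⟩ := h.generator.eq_const_div_of_mem_places hab (hmem hga) (hmem hgb)
    (fun c hca hcb => h.mem_placeAt_of_isHolomorphic
      ((hlog _ _ (h.placeAt_mem_placesOver c)).2 (by
        rintro (hc | hc)
        · exact hca (ha c hc)
        · exact hcb (hb c hc))))
    (h.mem_place_inv_of_isHolomorphic ((hlog p _ hpV).2 (by
      rintro (hc | hc)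
      · exact hpne a hc
      · exact hpne b hc)))
  refine ⟨ε, hε, ?_⟩
  have ha0 := (h.generator.sub_algebraMap a).ne_zero
  have hb0 := (h.generator.sub_algebraMap b).ne_zero
  have hV := (h.generator.sub_algebraMap a).algebraMap_mem_place
  -- This constant equals `(τ - b)(g (τ - a) - ε) + ε (τ - a)`, which lies in the maximal ideal of
  -- the place at `a`.
  have hkε : k - ε * (a - b) = 0 := by
    rw [← ValuationSubring.algebraMap_mem_nonunits_iff hV]
    have h1 := ValuationSubring.mul_mem_nonunits (h.mem_placeAt a b) hga
    have h2 := ValuationSubring.mul_mem_nonunits (hV ε)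
      (h.generator.sub_algebraMap a).mem_nonunits_place
    have h3 := ValuationSubring.add_mem_nonunits h1 h2
    convert h3 using 1
    rw [hk]
    simp only [map_mul, map_sub]
    field_simp
    ring
  rw [segmentForm, ← algebraMap_smul D.FunctionField ε, smul_smul, hk, sub_eq_zero.mp hkε, map_mul,
    mul_div_assoc]

end Segment

end IsParametrization

end PlaneCurve
end PosGeom

namespace PosGeom

/-! ### The line and the cuspidal cubic as parametrized curves -/

theorem vanishesAt_iff_of_associated {F G : MvPolynomial (Fin 3) ℂ} (h : Associated F G)
    (p : CP2) : VanishesAt F p ↔ VanishesAt G p :=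
  ⟨fun hp => zeroLocus_subset_of_dvd h.dvd hp, fun hp => zeroLocus_subset_of_dvd h.symm.dvd hp⟩

theorem exists_rep_mk {v : Fin 3 → ℂ} (hv : v ≠ 0) :
    ∃ a : ℂ, a ≠ 0 ∧ ∀ i, (Projectivization.mk ℂ v hv).rep i = a * v i := by
  obtain ⟨a, ha⟩ := Projectivization.exists_smul_eq_mk_rep ℂ v hv
  exact ⟨a, a.ne_zero, fun i => (congrFun ha i).symm⟩

namespace PlaneCurve

variable {D : PlaneCurve}

namespace IsParametrization

variable {γ : Fin 3 → Polynomial ℂ} {τ : D.FunctionField} (h : D.IsParametrization γ τ)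
include h

theorem eval_eq_of_point_eq {c a : ℂ} (hca : h.point c = h.point a) (j : Fin 3) :
    (γ j).eval c = (γ j).eval a := by
  rw [point, point, Projectivization.mk_eq_mk_iff'] at hca
  obtain ⟨u, hu⟩ := hca
  have hu1 : u = 1 := by simpa [h.apply_two] using congrFun hu 2
  simpa [hu1] using (congrFun hu j).symm

theorem point_eq_mk {c : ℂ} {v : Fin 3 → ℂ} (hv : v ≠ 0) (hcv : ∀ j, (γ j).eval c = v j) :
    h.point c = Projectivization.mk ℂ v hv := by
  rw [point]
  congr 1
  exact funext hcv

end IsParametrization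

/-! ### The line -/

section Line

variable (hD : Associated D.F lineForm)
include hD

theorem aeval_lineParam_of_dvd {Q : MvPolynomial (Fin 3) ℂ} (h : D.F ∣ Q) :
    MvPolynomial.aeval lineParam Q = 0 := by
  obtain ⟨R, rfl⟩ := hD.symm.dvd.trans h
  rw [map_mul, aeval_lineParam_lineForm, zero_mul]

theorem line_not_dvd_X (i : Fin 3) : ¬ D.F ∣ MvPolynomial.X i := by
  intro h
  -- The parameter `1` gives the point `(1 : 1 : 1)`, where no coordinate vanishes.
  have h1 := congrArg (Polynomial.eval 1) (aeval_lineParam_of_dvd hD h)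
  rw [MvPolynomial.aeval_X] at h1
  fin_cases i <;> norm_num [lineParam] at h1

/-- The parameter `x` on the line. -/
def lineParameter (hD : Associated D.F lineForm) : D.FunctionField :=
  IsLocalRing.residue D.localRing (D.affineCoord (line_not_dvd_X hD 2) 0)

theorem isParametrization_line : D.IsParametrization lineParam (lineParameter hD) := by
  refine D.isParametrization_of_residue (m := 1) (line_not_dvd_X hD)
    (fun Q hQ => aeval_lineParam_of_dvd hD hQ) one_ne_zero (by simp [lineParam])
    (by simp [lineParam, Matrix.cons_val]) ?_
  have h2 : D.affineCoord (line_not_dvd_X hD 2) 2 = 1 := Subtype.ext (by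
    rw [coe_affineCoord]; simp [xi, Matrix.cons_val])
  intro j
  fin_cases j
  · simp [lineParam, lineParameter]
  · have h1 := (D.residue_aeval_affineCoord_eq_zero_iff (line_not_dvd_X hD 2)
      isHomogeneous_lineForm).mpr hD.dvd
    simp only [lineForm, map_add, map_sub, map_mul, MvPolynomial.aeval_X, MvPolynomial.aeval_C,
      h2, mul_one] at h1
    simp only [lineParam, Fin.mk_one, Matrix.cons_val_one, Matrix.cons_val_zero, map_sub, map_mul,
      Polynomial.aeval_C, Polynomial.aeval_X, lineParameter]
    have h3 : ∀ c : ℂ, IsLocalRing.residue D.localRing (algebraMap ℂ D.localRing c) =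
        algebraMap ℂ D.FunctionField c := fun _ => rfl
    rw [h3, h3] at h1
    linear_combination h1
  · change IsLocalRing.residue D.localRing (D.affineCoord (line_not_dvd_X hD 2) 2) = _
    rw [h2]
    simp [lineParam, Matrix.cons_val]

/-- A line of slope `3/2` meets infinity at `(2 : 3 : 0)`. In the chart where `y` is invertible,
`x/y - 2/3 = (1/3)/y`, and `1/y` vanishes at this place. -/
theorem line_liesOver_infinity :
    ∃ p, D.LiesOver (isParametrization_line hD).generator.inv.place p := by
  set h := isParametrization_line hD
  have hv : (![2, 3, 0] : Fin 3 → ℂ) ≠ 0 := fun h0 => by simpa using congrFun h0 0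
  obtain ⟨a, ha, hrep⟩ := exists_rep_mk hv
  refine ⟨Projectivization.mk ℂ _ hv, ?_⟩
  have hchart : chart (Projectivization.mk ℂ _ hv) = 1 := by
    rw [chart, if_neg, if_pos]
    · rw [hrep]; simpa using ha
    · rw [hrep]; simp [Matrix.cons_val]
  have hV := h.generator.inv.algebraMap_mem_place
  rw [h.liesOver_iff hV, hchart]
  have h0 := h.generator.ne_zero
  have hden := h.aeval_coord_ne_zero 1
  have hy : Polynomial.aeval (lineParameter hD) (lineParam 1) =
      algebraMap ℂ D.FunctionField (3 / 2) * lineParameter hD -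
        algebraMap ℂ D.FunctionField (1 / 2) := by
    simp [lineParam]
  have hinv : (Polynomial.aeval (lineParameter hD) (lineParam 1))⁻¹ ∈
      h.generator.inv.place.nonunits := by
    have h1 := aeval_inv_mem hV h.generator.inv.mem_nonunits_place
      (P := Polynomial.C (3 / 2) - Polynomial.C (1 / 2) * Polynomial.X) (by simp)
    have h2 := ValuationSubring.mul_mem_nonunits h1 h.generator.inv.mem_nonunits_place
    convert h2 using 1
    rw [← mul_inv, hy]
    congr 1
    simp only [map_sub, map_mul, Polynomial.aeval_C, Polynomial.aeval_X]
    rw [sub_mul, inv_mul_cancel_right₀ h0]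
  have hc : ∀ (d : ℂ), algebraMap ℂ D.FunctionField d *
      (Polynomial.aeval (lineParameter hD) (lineParam 1))⁻¹ ∈ h.generator.inv.place.nonunits :=
    fun d => ValuationSubring.mul_mem_nonunits (hV d) hinv
  intro j
  rw [hrep, hrep, mul_div_mul_left _ _ ha]
  fin_cases j
  · convert hc (1 / 3) using 1
    change Polynomial.aeval (lineParameter hD) (lineParam 0) / _ - _ = _
    rw [sub_eq_iff_eq_add, div_eq_iff hden, add_mul, inv_mul_cancel_right₀ hden, hy]
    simp only [lineParam, Matrix.cons_val_zero, Polynomial.aeval_X, Matrix.cons_val_one]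
    rw [mul_sub, ← mul_assoc, ← map_mul, ← map_mul]
    norm_num
  · convert hc 0 using 1
    simp [lineParam] at hden ⊢
    simp [hden]
  · convert hc 1 using 1
    simp [lineParam, Matrix.cons_val]

end Line

/-! ### The cuspidal cubic -/

section Cubic

variable (hD : Associated D.F cubicForm)
include hD

theorem aeval_cubicParam_of_dvd {Q : MvPolynomial (Fin 3) ℂ} (h : D.F ∣ Q) :
    MvPolynomial.aeval cubicParam Q = 0 := by
  obtain ⟨R, rfl⟩ := hD.symm.dvd.trans h
  rw [map_mul, aeval_cubicParam_cubicForm, zero_mul]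

theorem cubic_not_dvd_X (i : Fin 3) : ¬ D.F ∣ MvPolynomial.X i := by
  intro h
  have h1 := congrArg (Polynomial.eval 1) (aeval_cubicParam_of_dvd hD h)
  rw [MvPolynomial.aeval_X] at h1
  fin_cases i <;> norm_num [cubicParam] at h1

/-- The parameter `y / x` on the cuspidal cubic. -/
def cubicParameter (hD : Associated D.F cubicForm) : D.FunctionField :=
  IsLocalRing.residue D.localRing (D.affineCoord (cubic_not_dvd_X hD 2) 1) /
    IsLocalRing.residue D.localRing (D.affineCoord (cubic_not_dvd_X hD 2) 0)

theorem isParametrization_cubic : D.IsParametrization cubicParam (cubicParameter hD) := by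
  refine D.isParametrization_of_residue (m := 2) (cubic_not_dvd_X hD)
    (fun Q hQ => aeval_cubicParam_of_dvd hD hQ) two_ne_zero (by simp [cubicParam])
    (by simp [cubicParam, Matrix.cons_val]) ?_
  have h2 : D.affineCoord (cubic_not_dvd_X hD 2) 2 = 1 := Subtype.ext (by
    rw [coe_affineCoord]; simp [xi, Matrix.cons_val])
  have h1 := (D.residue_aeval_affineCoord_eq_zero_iff (cubic_not_dvd_X hD 2)
    isHomogeneous_cubicForm).mpr hD.dvd
  simp only [cubicForm, map_sub, map_mul, map_pow, MvPolynomial.aeval_X, h2, mul_one]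
    at h1
  have hx := mt (D.residue_aeval_affineCoord_eq_zero_iff (cubic_not_dvd_X hD 2)
    (MvPolynomial.isHomogeneous_X ℂ 0)).mp (cubic_not_dvd_X hD 0)
  rw [MvPolynomial.aeval_X] at hx
  intro j
  fin_cases j
  · simp only [Fin.zero_eta, cubicParam, Matrix.cons_val_zero, map_pow, Polynomial.aeval_X,
      cubicParameter]
    field_simp
    linear_combination -h1
  · simp only [Fin.mk_one, cubicParam, Matrix.cons_val_one, Matrix.cons_val_zero, map_pow,
      Polynomial.aeval_X, cubicParameter]
    field_simp
    linear_combination -IsLocalRing.residue D.localRing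
      (D.affineCoord (cubic_not_dvd_X hD 2) 1) * h1
  · change IsLocalRing.residue D.localRing (D.affineCoord (cubic_not_dvd_X hD 2) 2) = _
    rw [h2]
    simp [cubicParam, Matrix.cons_val]

/-- The point at infinity is `(0 : 1 : 0)`, near which `x/y = τ⁻¹` and `1/y = τ⁻¹ ^ 3`. -/
theorem cubic_liesOver_infinity :
    ∃ p, D.LiesOver (isParametrization_cubic hD).generator.inv.place p := by
  set h := isParametrization_cubic hD
  have hv : (![0, 1, 0] : Fin 3 → ℂ) ≠ 0 := fun h0 => by simpa using congrFun h0 1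
  obtain ⟨a, ha, hrep⟩ := exists_rep_mk hv
  refine ⟨Projectivization.mk ℂ _ hv, ?_⟩
  have hchart : chart (Projectivization.mk ℂ _ hv) = 1 := by
    rw [chart, if_neg, if_pos]
    · rw [hrep]; simpa using ha
    · rw [hrep]; simp [Matrix.cons_val]
  have hV := h.generator.inv.algebraMap_mem_place
  rw [h.liesOver_iff hV, hchart]
  have h0 := h.generator.ne_zero
  have hpow : ∀ n : ℕ, (cubicParameter hD)⁻¹ ^ n * (cubicParameter hD)⁻¹ ∈
      h.generator.inv.place.nonunits := fun n => ValuationSubring.mul_mem_nonunits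
    (pow_mem (ValuationSubring.mem_of_mem_nonunits h.generator.inv.mem_nonunits_place) n)
    h.generator.inv.mem_nonunits_place
  intro j
  rw [hrep, hrep, mul_div_mul_left _ _ ha]
  fin_cases j
  · convert hpow 0 using 1
    simp [cubicParam]
    field_simp
  · convert ValuationSubring.mem_nonunits_iff_inv_notMem _ |>.mpr (Or.inl rfl) using 1
    simp [cubicParam]
    field_simp
    simp
  · convert hpow 2 using 1
    simp [cubicParam, Matrix.cons_val]
    field_simp

end Cubic

end PlaneCurve

/-- The common boundary point `(1, 1)`. -/
def tangencyPoint : CP2 := (affinePoint 1 1).toComplex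

/-- The common boundary point `(1/4, -1/8)`. -/
def crossingPoint : CP2 := (affinePoint (1 / 4) (-1 / 8)).toComplex

namespace PlaneCurve

variable {D : PlaneCurve}

theorem line_point_one (hD : Associated D.F lineForm) :
    (isParametrization_line hD).point 1 = tangencyPoint := by
  rw [tangencyPoint, affinePoint_toComplex]
  apply IsParametrization.point_eq_mk
  intro j
  fin_cases j <;> norm_num [lineParam]

theorem line_point_quarter (hD : Associated D.F lineForm) :
    (isParametrization_line hD).point (1 / 4) = crossingPoint := by
  rw [crossingPoint, affinePoint_toComplex]
  apply IsParametrization.point_eq_mk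
  intro j
  fin_cases j <;> norm_num [lineParam]

theorem cubic_point_one (hD : Associated D.F cubicForm) :
    (isParametrization_cubic hD).point 1 = tangencyPoint := by
  rw [tangencyPoint, affinePoint_toComplex]
  apply IsParametrization.point_eq_mk
  intro j
  fin_cases j <;> norm_num [cubicParam]

theorem cubic_point_neg_half (hD : Associated D.F cubicForm) :
    (isParametrization_cubic hD).point (-1 / 2) = crossingPoint := by
  rw [crossingPoint, affinePoint_toComplex]
  apply IsParametrization.point_eq_mk
  intro j
  fin_cases j <;> norm_num [cubicParam]

theorem line_point_injective (hD : Associated D.F lineForm) (a c : ℂ)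
    (h : (isParametrization_line hD).point c = (isParametrization_line hD).point a) : c = a := by
  simpa [lineParam] using (isParametrization_line hD).eval_eq_of_point_eq h 0

theorem cubic_point_injective (hD : Associated D.F cubicForm) {a : ℂ} (ha : a ≠ 0) (c : ℂ)
    (h : (isParametrization_cubic hD).point c = (isParametrization_cubic hD).point a) : c = a := by
  have h0 : c ^ 2 = a ^ 2 := by
    simpa [cubicParam] using (isParametrization_cubic hD).eval_eq_of_point_eq h 0
  have h1 : c ^ 3 = a ^ 3 := by
    simpa [cubicParam] using (isParametrization_cubic hD).eval_eq_of_point_eq h 1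
  have h2 : a ^ 2 * (c - a) = 0 := by linear_combination h1 - c * h0
  exact sub_eq_zero.mp ((mul_eq_zero.mp h2).resolve_left (pow_ne_zero 2 ha))

/-! ### Canonical forms on the two boundary curves -/

section CanonicalForms

variable {A : Set RP2} (hA : zariskiClosure (D.boundary A) = {tangencyPoint, crossingPoint})
include hA

theorem isCanonicalForm_line_iff (hD : Associated D.F lineForm) (θ : D.Form1) :
    D.IsCanonicalForm A θ ↔ ∃ ε, IsCanonicalPointForm ε ∧
      θ = ε • (isParametrization_line hD).segmentForm 1 (1 / 4) := by
  rw [← line_point_one hD, ← line_point_quarter hD] at hA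
  constructor
  · exact fun h => (isParametrization_line hD).eq_smul_segmentForm_of_isCanonicalForm
      (by norm_num) (line_point_injective hD 1) (line_point_injective hD _) hA
      (line_liesOver_infinity hD) h
  · rintro ⟨ε, hε, rfl⟩
    exact (isParametrization_line hD).isCanonicalForm_smul_segmentForm
      (by norm_num) (line_point_injective hD 1) (line_point_injective hD _) hA hε

theorem isCanonicalForm_cubic_iff (hD : Associated D.F cubicForm) (θ : D.Form1) :
    D.IsCanonicalForm A θ ↔ ∃ ε, IsCanonicalPointForm ε ∧
      θ = ε • (isParametrization_cubic hD).segmentForm 1 (-1 / 2) := by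
  rw [← cubic_point_one hD, ← cubic_point_neg_half hD] at hA
  constructor
  · exact fun h => (isParametrization_cubic hD).eq_smul_segmentForm_of_isCanonicalForm
      (by norm_num) (cubic_point_injective hD (by norm_num))
      (cubic_point_injective hD (by norm_num)) hA (cubic_liesOver_infinity hD) h
  · rintro ⟨ε, hε, rfl⟩
    exact (isParametrization_cubic hD).isCanonicalForm_smul_segmentForm
      (by norm_num) (cubic_point_injective hD (by norm_num))
      (cubic_point_injective hD (by norm_num)) hA hε

end CanonicalForms

end PlaneCurve
end PosGeom

namespace PosGeom

/-! ### The topology of the real projective plane -/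

theorem isOpen_of_mk_mem_iff {S : Set RP2} {T : Set (Fin 3 → ℝ)} (hT : IsOpen T)
    (h : ∀ v hv, Projectivization.mk ℝ v hv ∈ S ↔ v ∈ T) : IsOpen S := by
  rw [isOpen_coinduced]
  convert hT.preimage continuous_subtype_val using 1
  ext v
  exact h v.1 v.2

theorem isClosed_of_mk_mem_iff {S : Set RP2} {T : Set (Fin 3 → ℝ)} (hT : IsClosed T)
    (h : ∀ v hv, Projectivization.mk ℝ v hv ∈ S ↔ v ∈ T) : IsClosed S :=
  ⟨isOpen_of_mk_mem_iff hT.isOpen_compl fun v hv => not_congr (h v hv)⟩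

theorem continuous_affinePoint {X : Type} [TopologicalSpace X] {f g : X → ℝ}
    (hf : Continuous f) (hg : Continuous g) : Continuous fun t => affinePoint (f t) (g t) := by
  have h : Continuous fun t => (⟨![f t, g t, 1], fun h => one_ne_zero (congrFun h 2)⟩ :
      {v : Fin 3 → ℝ // v ≠ 0}) := by
    refine Continuous.subtype_mk (continuous_pi fun i => ?_) _
    fin_cases i
    · exact hf
    · exact hg
    · exact continuous_const
  exact continuous_coinduced_rng.comp h

theorem mk_eq_affinePoint_iff {v : Fin 3 → ℝ} (hv : v ≠ 0) {x y : ℝ} :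
    Projectivization.mk ℝ v hv = affinePoint x y ↔ v 2 ≠ 0 ∧ x = v 0 / v 2 ∧ y = v 1 / v 2 := by
  rw [affinePoint, Projectivization.mk_eq_mk_iff']
  constructor
  · rintro ⟨a, rfl⟩
    have ha : a ≠ 0 := by
      rintro rfl
      exact hv (zero_smul _ _)
    refine ⟨by simpa [Matrix.cons_val] using ha, ?_, ?_⟩ <;> simp [Matrix.cons_val] <;> field_simp
  · rintro ⟨h2, rfl, rfl⟩
    refine ⟨v 2, ?_⟩
    funext i
    fin_cases i <;> simp [Matrix.cons_val] <;> field_simp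

theorem affinePoint_eq_iff {x y x' y' : ℝ} :
    affinePoint x y = affinePoint x' y' ↔ x = x' ∧ y = y' := by
  rw [affinePoint, mk_eq_affinePoint_iff]
  simp [Matrix.cons_val, eq_comm]

/-- The subset of the chart `ℝ²` given by a set of pairs. -/
def chartSet (S : Set (ℝ × ℝ)) : Set RP2 := {p | ∃ x y, (x, y) ∈ S ∧ p = affinePoint x y}

theorem mk_mem_chartSet {S : Set (ℝ × ℝ)} {v : Fin 3 → ℝ} (hv : v ≠ 0) :
    Projectivization.mk ℝ v hv ∈ chartSet S ↔ v 2 ≠ 0 ∧ (v 0 / v 2, v 1 / v 2) ∈ S := by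
  constructor
  · rintro ⟨x, y, h, h'⟩
    obtain ⟨h2, rfl, rfl⟩ := (mk_eq_affinePoint_iff hv).mp h'
    exact ⟨h2, h⟩
  · rintro ⟨h2, h⟩
    exact ⟨_, _, h, (mk_eq_affinePoint_iff hv).mpr ⟨h2, rfl, rfl⟩⟩

theorem isOpen_chartSet {S : Set (ℝ × ℝ)} (hS : IsOpen S) : IsOpen (chartSet S) := by
  have h2 : IsOpen {v : Fin 3 → ℝ | v 2 ≠ 0} := isOpen_ne_fun (continuous_apply 2) continuous_const
  have hc : ContinuousOn (fun v : Fin 3 → ℝ => (v 0 / v 2, v 1 / v 2)) {v | v 2 ≠ 0} :=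
    ((continuous_apply 0).continuousOn.div (continuous_apply 2).continuousOn fun _ h => h).prodMk
      ((continuous_apply 1).continuousOn.div (continuous_apply 2).continuousOn fun _ h => h)
  exact isOpen_of_mk_mem_iff (hc.isOpen_inter_preimage h2 hS) fun v hv => mk_mem_chartSet hv

/-- Boundary points are detected below by paths that leave the set for positive parameters. -/
theorem mem_closure_of_forall_pos {f : ℝ → RP2} (hf : Continuous f) {S : Set RP2}
    (h : ∀ t > 0, f t ∈ S) : f 0 ∈ closure S := by
  have h0 : (0 : ℝ) ∈ closure (Set.Ioi 0) := by simp
  exact closure_mono (Set.image_subset_iff.mpr h)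
    (image_closure_subset_closure_image hf (Set.mem_image_of_mem f h0))

theorem notMem_interior_of_forall_pos {f : ℝ → RP2} (hf : Continuous f) {S : Set RP2}
    (h : ∀ t > 0, f t ∉ S) : f 0 ∉ interior S := by
  have := mem_closure_of_forall_pos hf (S := Sᶜ) h
  rwa [closure_compl] at this

/-! ### Zariski closures -/

/-- The forms `p_j X_i - p_i X_j` vanish at `p`. If all of them vanish at `q`, the coordinate
vectors are proportional. -/
theorem exists_linear_form_separating {p q : CP2} (hpq : p ≠ q) :
    ∃ l : MvPolynomial (Fin 3) ℂ, l.IsHomogeneous 1 ∧ VanishesAt l p ∧ ¬ VanishesAt l q := by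
  by_contra! h
  have key : ∀ i j, p.rep j * q.rep i = p.rep i * q.rep j := by
    intro i j
    have := h (MvPolynomial.C (p.rep j) * MvPolynomial.X i -
      MvPolynomial.C (p.rep i) * MvPolynomial.X j)
      ((MvPolynomial.isHomogeneous_C_mul_X _ _).sub (MvPolynomial.isHomogeneous_C_mul_X _ _))
      (by simp [VanishesAt, mul_comm])
    simpa [VanishesAt, sub_eq_zero] using this
  apply hpq
  rw [← p.mk_rep, ← q.mk_rep, Projectivization.mk_eq_mk_iff']
  have hq := chart_ne_zero q
  refine ⟨p.rep (chart q) / q.rep (chart q), ?_⟩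
  funext i
  rw [Pi.smul_apply, smul_eq_mul, div_mul_eq_mul_div, div_eq_iff hq, key]

/-- For a third point, the product of a linear form through `p` and one through `q`, both missing
that point, separates it from the pair. -/
theorem zariskiClosure_pair (p q : RP2) :
    zariskiClosure {p, q} = {p.toComplex, q.toComplex} := by
  ext r
  constructor
  · intro hr
    by_contra hne
    simp only [Set.mem_insert_iff, Set.mem_singleton_iff, not_or] at hne
    obtain ⟨l, hl, hlp, hlr⟩ := exists_linear_form_separating (Ne.symm hne.1)
    obtain ⟨m, hm, hmq, hmr⟩ := exists_linear_form_separating (Ne.symm hne.2)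
    have h := hr 2 (l * m) (hl.mul hm) (by
      rintro s (rfl | rfl)
      · exact zeroLocus_subset_of_dvd (dvd_mul_right l m) hlp
      · exact zeroLocus_subset_of_dvd (dvd_mul_left m l) hmq)
    have h' : r ∈ zeroLocus (l * m) := h
    rw [zeroLocus_mul] at h'
    exact h'.elim hlr hmr
  · rintro (rfl | rfl) n G hG h
    · exact h p (Or.inl rfl)
    · exact h q (Or.inr rfl)

/-! ### Curves defined over the reals -/

theorem eval_ofReal_map (P : MvPolynomial (Fin 3) ℝ) (v : Fin 3 → ℝ) :
    MvPolynomial.eval (fun i => (v i : ℂ)) (MvPolynomial.map (algebraMap ℝ ℂ) P) =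
      (MvPolynomial.eval v P : ℝ) := by
  rw [MvPolynomial.eval_map]
  exact (MvPolynomial.eval₂_comp_left Complex.ofRealHom (RingHom.id ℝ) v P).symm

namespace PlaneCurve

variable {D : PlaneCurve} {P : MvPolynomial (Fin 3) ℝ} {n : ℕ}

theorem mk_mem_realPoints_iff (hP : (MvPolynomial.map (algebraMap ℝ ℂ) P).IsHomogeneous n)
    (hD : Associated D.F (MvPolynomial.map (algebraMap ℝ ℂ) P)) {v : Fin 3 → ℝ} (hv : v ≠ 0) :
    Projectivization.mk ℝ v hv ∈ D.realPoints ↔ MvPolynomial.eval v P = 0 := by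
  change VanishesAt D.F _ ↔ _
  rw [vanishesAt_iff_of_associated hD, RP2.toComplex_mk, vanishesAt_mk_iff hP, eval_ofReal_map,
    Complex.ofReal_eq_zero]

theorem isClosed_realPoints (hP : (MvPolynomial.map (algebraMap ℝ ℂ) P).IsHomogeneous n)
    (hD : Associated D.F (MvPolynomial.map (algebraMap ℝ ℂ) P)) : IsClosed D.realPoints :=
  isClosed_of_mk_mem_iff (isClosed_eq (MvPolynomial.continuous_eval P) continuous_const)
    fun _ hv => mk_mem_realPoints_iff hP hD hv

theorem isSemialgebraicRP2_realPoints_inter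
    (hP : (MvPolynomial.map (algebraMap ℝ ℂ) P).IsHomogeneous n)
    (hD : Associated D.F (MvPolynomial.map (algebraMap ℝ ℂ) P)) {A : Set RP2}
    (hA : IsSemialgebraicRP2 A) : IsSemialgebraicRP2 (D.realPoints ∩ A) := by
  -- The equation `P = 0` is expressed as the failure of both `P > 0` and `-P > 0`.
  have h := (IsSemialgebraic.pos P).compl.inter ((IsSemialgebraic.pos (-P)).compl.inter hA)
  rw [IsSemialgebraicRP2]
  convert h using 1
  ext v
  simp only [Set.mem_ofPred_eq, Set.mem_inter_iff, Set.mem_compl_iff, map_neg]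
  constructor
  · rintro ⟨hv, h1, h2⟩
    have := (mk_mem_realPoints_iff hP hD hv).mp h1
    exact ⟨by simp [this], by simp [this], hv, h2⟩
  · rintro ⟨h1, h2, hv, h3⟩
    exact ⟨hv, (mk_mem_realPoints_iff hP hD hv).mpr (by linarith), h3⟩

end PlaneCurve

/-- The real linear form defining the line. -/
def realLineForm : MvPolynomial (Fin 3) ℝ :=
  MvPolynomial.X 1 - MvPolynomial.C (3 / 2) * MvPolynomial.X 0 +
    MvPolynomial.C (1 / 2) * MvPolynomial.X 2

/-- The real cubic form defining the cuspidal cubic. -/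
def realCubicForm : MvPolynomial (Fin 3) ℝ :=
  MvPolynomial.X 1 ^ 2 * MvPolynomial.X 2 - MvPolynomial.X 0 ^ 3

theorem map_realLineForm : MvPolynomial.map (algebraMap ℝ ℂ) realLineForm = lineForm := by
  simp [realLineForm, lineForm]

theorem map_realCubicForm : MvPolynomial.map (algebraMap ℝ ℂ) realCubicForm = cubicForm := by
  simp [realCubicForm, cubicForm]

/-! ### The region -/

theorem affinePoint_mem_regionII_iff {x y : ℝ} : affinePoint x y ∈ regionII ↔
    0 ≤ y - 3 / 2 * x + 1 / 2 ∧ y ^ 2 ≤ x ^ 3 ∧ y ≤ 1 := by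
  constructor
  · rintro ⟨x', y', h1, h2, h3, h⟩
    rw [affinePoint_eq_iff] at h
    rw [h.1, h.2]
    exact ⟨h1, h2, h3⟩
  · exact fun ⟨h1, h2, h3⟩ => ⟨x, y, h1, h2, h3, rfl⟩

/-- Each affine inequality is multiplied by an even power of `v 2`, so that the condition on the
cone does not depend on the sign of the representative. -/
theorem mk_mem_regionII_iff {v : Fin 3 → ℝ} (hv : v ≠ 0) :
    Projectivization.mk ℝ v hv ∈ regionII ↔ 0 < v 2 ^ 2 ∧
      0 ≤ v 2 * (v 1 - 3 / 2 * v 0 + 1 / 2 * v 2) ∧ v 1 ^ 2 * v 2 ^ 2 ≤ v 0 ^ 3 * v 2 ∧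
      v 1 * v 2 ≤ v 2 ^ 2 := by
  by_cases h2 : v 2 = 0
  · constructor
    · rintro ⟨x, y, -, -, -, h⟩
      exact absurd h2 ((mk_eq_affinePoint_iff hv).mp h).1
    · rintro ⟨h, -⟩
      simp [h2] at h
  · have hsq : 0 < v 2 ^ 2 := by positivity
    rw [(mk_eq_affinePoint_iff hv).mpr ⟨h2, rfl, rfl⟩, affinePoint_mem_regionII_iff]
    have e1 : v 2 * (v 1 - 3 / 2 * v 0 + 1 / 2 * v 2) =
        (v 1 / v 2 - 3 / 2 * (v 0 / v 2) + 1 / 2) * v 2 ^ 2 := by field_simp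
    have e2 : v 1 ^ 2 * v 2 ^ 2 = (v 1 / v 2) ^ 2 * (v 2 ^ 2) ^ 2 := by field_simp
    have e3 : v 0 ^ 3 * v 2 = (v 0 / v 2) ^ 3 * (v 2 ^ 2) ^ 2 := by field_simp
    have e4 : v 1 * v 2 = (v 1 / v 2) * v 2 ^ 2 := by field_simp
    rw [e1, e2, e3, e4, mul_nonneg_iff_of_pos_right hsq, mul_le_mul_iff_left₀ (pow_pos hsq 2),
      mul_le_iff_le_one_left hsq]
    exact (and_iff_right hsq).symm

theorem regionII_bounds {x y : ℝ} (h1 : 0 ≤ y - 3 / 2 * x + 1 / 2) (h2 : y ^ 2 ≤ x ^ 3)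
    (h3 : y ≤ 1) : 0 ≤ x ∧ x ≤ 1 ∧ y ^ 2 ≤ 1 := by
  have hx : 0 ≤ x := by
    by_contra! hx
    have : x ^ 3 < 0 := Odd.pow_neg (by decide) hx
    nlinarith [sq_nonneg y]
  have hx1 : x ≤ 1 := by linarith
  exact ⟨hx, hx1, h2.trans (pow_le_one₀ hx hx1)⟩

/-- The condition `v 2 ≠ 0` is not closed. On the region `x² ≤ 1` and `y² ≤ 1`, so it may be
replaced by the closed conditions `v 0 ^ 2 ≤ v 2 ^ 2` and `v 1 ^ 2 ≤ v 2 ^ 2`, which exclude `v 2 =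
0` for nonzero `v`. -/
theorem isClosed_regionII : IsClosed regionII := by
  have hc : ∀ i : Fin 3, Continuous fun v : Fin 3 → ℝ => v i := fun i => continuous_apply i
  have hcl : IsClosed {v : Fin 3 → ℝ | (v 0 ^ 2 ≤ v 2 ^ 2 ∧ v 1 ^ 2 ≤ v 2 ^ 2) ∧
      0 ≤ v 2 * (v 1 - 3 / 2 * v 0 + 1 / 2 * v 2) ∧ v 1 ^ 2 * v 2 ^ 2 ≤ v 0 ^ 3 * v 2 ∧
      v 1 * v 2 ≤ v 2 ^ 2} := by
    refine IsClosed.and (IsClosed.and (isClosed_le ?_ ?_) (isClosed_le ?_ ?_)) (IsClosed.and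
      (isClosed_le ?_ ?_) (IsClosed.and (isClosed_le ?_ ?_) (isClosed_le ?_ ?_))) <;> fun_prop
  refine isClosed_of_mk_mem_iff hcl fun v hv => ?_
  constructor
  · intro h
    refine ⟨?_, ((mk_mem_regionII_iff hv).mp h).2⟩
    obtain ⟨x, y, h1, h2, h3, h4⟩ := h
    obtain ⟨hx, hx1, hy⟩ := regionII_bounds h1 h2 h3
    obtain ⟨h0, rfl, rfl⟩ := (mk_eq_affinePoint_iff hv).mp h4
    have hsq : 0 < v 2 ^ 2 := by positivity
    rw [div_pow, div_le_one hsq] at hy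
    refine ⟨?_, hy⟩
    have := pow_le_one₀ (n := 2) hx hx1
    rwa [div_pow, div_le_one hsq] at this
  · rintro ⟨⟨h0, h1⟩, h⟩
    refine (mk_mem_regionII_iff hv).mpr ⟨?_, h⟩
    by_contra h2
    have h2' : v 2 ^ 2 = 0 := le_antisymm (not_lt.mp h2) (sq_nonneg _)
    rw [h2'] at h0 h1
    apply hv
    funext i
    fin_cases i
    · exact pow_eq_zero_iff two_ne_zero |>.mp (le_antisymm h0 (sq_nonneg _))
    · exact pow_eq_zero_iff two_ne_zero |>.mp (le_antisymm h1 (sq_nonneg _))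
    · exact pow_eq_zero_iff two_ne_zero |>.mp h2'

theorem isSemialgebraicRP2_regionII : IsSemialgebraicRP2 regionII := by
  have h := (IsSemialgebraic.pos (MvPolynomial.X 2 ^ 2 : MvPolynomial (Fin 3) ℝ)).inter
    ((IsSemialgebraic.pos (-(MvPolynomial.X 2 * realLineForm))).compl.inter
    ((IsSemialgebraic.pos (MvPolynomial.X 1 ^ 2 * MvPolynomial.X 2 ^ 2 -
      MvPolynomial.X 0 ^ 3 * MvPolynomial.X 2 : MvPolynomial (Fin 3) ℝ)).compl.inter
    (IsSemialgebraic.pos (MvPolynomial.X 1 * MvPolynomial.X 2 -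
      MvPolynomial.X 2 ^ 2 : MvPolynomial (Fin 3) ℝ)).compl))
  rw [IsSemialgebraicRP2]
  convert h using 1
  ext v
  simp only [Set.mem_ofPred_eq, Set.mem_inter_iff, Set.mem_compl_iff, realLineForm, map_neg, map_mul,
    map_add, map_sub, map_pow, MvPolynomial.eval_X, MvPolynomial.eval_C, not_lt, sub_nonpos,
    neg_nonpos]
  constructor
  · rintro ⟨hv, h⟩
    exact (mk_mem_regionII_iff hv).mp h
  · intro h
    have hv : v ≠ 0 := by
      rintro rfl
      simp at h
    exact ⟨hv, (mk_mem_regionII_iff hv).mpr h⟩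

/-- The open set of points of the chart with `y² < x³`, `y < 1` and positive linear form. -/
theorem affinePoint_mem_interior_regionII {x y : ℝ} (h1 : 0 < y - 3 / 2 * x + 1 / 2)
    (h2 : y ^ 2 < x ^ 3) (h3 : y < 1) : affinePoint x y ∈ interior regionII := by
  have hS : IsOpen {q : ℝ × ℝ | 0 < q.2 - 3 / 2 * q.1 + 1 / 2 ∧ q.2 ^ 2 < q.1 ^ 3 ∧ q.2 < 1} := by
    refine IsOpen.and (isOpen_lt ?_ ?_) (IsOpen.and (isOpen_lt ?_ ?_) (isOpen_lt ?_ ?_)) <;> fun_prop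
  refine interior_maximal ?_ (isOpen_chartSet hS) ⟨x, y, ⟨h1, h2, h3⟩, rfl⟩
  rintro _ ⟨x, y, ⟨h1, h2, h3⟩, rfl⟩
  exact affinePoint_mem_regionII_iff.mpr ⟨h1.le, h2.le, h3.le⟩

theorem line_mem_frontier {x : ℝ} (h1 : 1 / 4 ≤ x) (h2 : x ≤ 1) :
    affinePoint x (3 / 2 * x - 1 / 2) ∈ frontier regionII := by
  rw [isClosed_regionII.frontier_eq]
  refine ⟨affinePoint_mem_regionII_iff.mpr ⟨by linarith, ?_, by linarith⟩, ?_⟩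
  -- On the line, `x³ - y² = (x - 1)² (x - 1/4)`.
  · nlinarith [mul_nonneg (sq_nonneg (x - 1)) (sub_nonneg.mpr h1)]
  · have := notMem_interior_of_forall_pos (S := regionII)
      (f := fun t => affinePoint x (3 / 2 * x - 1 / 2 - t))
      (continuous_affinePoint continuous_const (by fun_prop)) (by
        intro t ht h
        have := (affinePoint_mem_regionII_iff.mp h).1
        linarith)
    simpa using this

/-- The linear form restricted to the cubic factors as `(t - 1)² (t + 1/2)`. -/
theorem cubic_nonneg {t : ℝ} (h1 : -1 / 2 ≤ t) : 0 ≤ t ^ 3 - 3 / 2 * t ^ 2 + 1 / 2 := by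
  nlinarith [mul_nonneg (sq_nonneg (t - 1)) (show 0 ≤ t + 1 / 2 by linarith)]

theorem cube_le_one {t : ℝ} (h2 : t ≤ 1) : t ^ 3 ≤ 1 := by
  nlinarith [sq_nonneg (t + 1 / 2), mul_nonneg (sub_nonneg.mpr h2) (sq_nonneg (t + 1 / 2))]

theorem cubic_mem_regionII {t : ℝ} (h1 : -1 / 2 ≤ t) (h2 : t ≤ 1) :
    affinePoint (t ^ 2) (t ^ 3) ∈ regionII :=
  affinePoint_mem_regionII_iff.mpr ⟨cubic_nonneg h1, le_of_eq (by ring), cube_le_one h2⟩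

theorem cubic_mem_frontier {t : ℝ} (h1 : -1 / 2 ≤ t) (h2 : t ≤ 1) :
    affinePoint (t ^ 2) (t ^ 3) ∈ frontier regionII := by
  rw [isClosed_regionII.frontier_eq]
  refine ⟨cubic_mem_regionII h1 h2, ?_⟩
  -- Decreasing `x` at fixed `y` violates `y² ≤ x³` at once, even at the cusp.
  have := notMem_interior_of_forall_pos (S := regionII)
    (f := fun e => affinePoint (t ^ 2 - e) (t ^ 3))
    (continuous_affinePoint (by fun_prop) continuous_const) (by
      intro e he h
      have h3 := (affinePoint_mem_regionII_iff.mp h).2.1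
      have h4 : (t ^ 2 - e) ^ 3 < (t ^ 2) ^ 3 := Odd.strictMono_pow (by decide) (by linarith)
      nlinarith)
  simpa using this

/-- The line as a prime divisor. -/
def lineCurve : PlaneCurve where
  F := lineForm
  homogeneous := by
    rw [isHomogeneous_lineForm.totalDegree irreducible_lineForm.ne_zero]
    exact isHomogeneous_lineForm
  irreducible := irreducible_lineForm

/-- The cuspidal cubic as a prime divisor. -/
def cubicCurve : PlaneCurve where
  F := cubicForm
  homogeneous := by
    rw [isHomogeneous_cubicForm.totalDegree irreducible_cubicForm.ne_zero]
    exact isHomogeneous_cubicForm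
  irreducible := irreducible_cubicForm

/-- The pullback of `G` along `γ` is a polynomial in one variable with infinitely many roots, hence
zero; so `G` vanishes in the function field of `D`. -/
theorem PlaneCurve.IsParametrization.dvd_of_infinite {D : PlaneCurve} {γ : Fin 3 → Polynomial ℂ}
    {τ : D.FunctionField} (h : D.IsParametrization γ τ) {n : ℕ} {G : MvPolynomial (Fin 3) ℂ}
    (hG : G.IsHomogeneous n) {T : Set ℂ} (hT : T.Infinite)
    (hz : ∀ t ∈ T, MvPolynomial.eval (fun j => (γ j).eval t) G = 0) : D.F ∣ G := by
  rw [← D.residue_aeval_affineCoord_eq_zero_iff (h.not_dvd_X 2) hG,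
    D.residue_aeval h.residue_affineCoord]
  have h0 : MvPolynomial.aeval γ G = 0 := by
    refine Polynomial.eq_zero_of_infinite_isRoot _ (hT.mono fun t ht => ?_)
    change (MvPolynomial.aeval γ G).eval t = 0
    rw [← hz t ht, ← Polynomial.coe_evalRingHom, MvPolynomial.map_aeval]
    simp only [Polynomial.coe_evalRingHom]
    have hid : (Polynomial.evalRingHom t).comp (algebraMap ℂ (Polynomial ℂ)) = RingHom.id ℂ := by
      ext c
      simp
    rw [hid]
    rfl
  rw [h0, map_zero]

theorem infinite_ofReal_Ioo {a b : ℝ} (hab : a < b) :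
    ((fun t : ℝ => (t : ℂ)) '' Set.Ioo a b).Infinite :=
  (Set.Ioo_infinite hab).image Complex.ofReal_injective.injOn

theorem zariskiClosure_frontier_regionII :
    zariskiClosure (frontier regionII) = lineII ∪ cuspidalCubic := by
  rw [← zeroLocus_lineForm, ← zeroLocus_cubicForm]
  apply Set.Subset.antisymm
  · intro p hp
    rw [← zeroLocus_mul]
    refine hp 4 _ isHomogeneous_lineForm_mul_cubicForm ?_
    intro s hs
    rw [isClosed_regionII.frontier_eq] at hs
    obtain ⟨⟨x, y, h1, h2, h3, rfl⟩, hs⟩ := hs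
    rw [vanishesAt_affinePoint_iff isHomogeneous_lineForm_mul_cubicForm, map_mul, mul_eq_zero]
    by_contra! hne
    apply hs
    have hl : y - 3 / 2 * x + 1 / 2 ≠ 0 := by
      intro h0
      apply hne.1
      simp only [lineForm, map_add, map_sub, map_mul, MvPolynomial.eval_X, MvPolynomial.eval_C]
      simp only [Matrix.cons_val, mul_one]
      simpa using congrArg (fun r : ℝ => (r : ℂ)) h0
    have hc : y ^ 2 ≠ x ^ 3 := by
      intro h0
      apply hne.2
      simp only [cubicForm, map_sub, map_mul, map_pow, MvPolynomial.eval_X]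
      simp only [Matrix.cons_val, mul_one]
      exact_mod_cast sub_eq_zero.mpr h0
    have h1' := lt_of_le_of_ne h1 (Ne.symm hl)
    have h2' := lt_of_le_of_ne h2 hc
    -- The third inequality is automatically strict: `y = 1` would give `x < 1` from the line and `1
    -- < x³` from the cubic.
    refine affinePoint_mem_interior_regionII h1' h2' (lt_of_le_of_ne h3 ?_)
    rintro rfl
    have hx : x < 1 := by linarith
    have := pow_le_one₀ (n := 3) (regionII_bounds h1 h2 h3).1 hx.le
    linarith
  · rintro p (hp | hp) n G hG hz
    · refine zeroLocus_subset_of_dvd ((PlaneCurve.isParametrization_line (D := lineCurve)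
        (Associated.refl _)).dvd_of_infinite hG
        (infinite_ofReal_Ioo (show (1 / 4 : ℝ) < 1 by norm_num)) ?_) hp
      rintro _ ⟨t, ⟨ht1, ht2⟩, rfl⟩
      have := (vanishesAt_affinePoint_iff hG _ _).mp (hz _ (line_mem_frontier ht1.le ht2.le))
      have hv : (fun j => (lineParam j).eval (t : ℂ)) =
          ![(t : ℂ), ((3 / 2 * t - 1 / 2 : ℝ) : ℂ), 1] := by
        funext j
        fin_cases j <;> simp [lineParam]
      rwa [hv]
    · refine zeroLocus_subset_of_dvd ((PlaneCurve.isParametrization_cubic (D := cubicCurve)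
        (Associated.refl _)).dvd_of_infinite hG
        (infinite_ofReal_Ioo (show (-1 / 2 : ℝ) < 1 by norm_num)) ?_) hp
      rintro _ ⟨t, ⟨ht1, ht2⟩, rfl⟩
      have := (vanishesAt_affinePoint_iff hG _ _).mp (hz _ (cubic_mem_frontier ht1.le ht2.le))
      have hv : (fun j => (cubicParam j).eval (t : ℂ)) =
          ![((t ^ 2 : ℝ) : ℂ), ((t ^ 3 : ℝ) : ℂ), 1] := by
        funext j
        fin_cases j <;> simp [cubicParam]
      rwa [hv]

/-! ### The boundary segments -/

namespace PlaneCurve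

variable {D : PlaneCurve}

theorem affinePoint_mem_line_iff (hD : Associated D.F lineForm) {x y : ℝ} :
    affinePoint x y ∈ D.realPoints ↔ y - 3 / 2 * x + 1 / 2 = 0 := by
  rw [affinePoint, mk_mem_realPoints_iff (P := realLineForm)
    (by rw [map_realLineForm]; exact isHomogeneous_lineForm) (by rwa [map_realLineForm])]
  simp [realLineForm, Matrix.cons_val]

theorem affinePoint_mem_cubic_iff (hD : Associated D.F cubicForm) {x y : ℝ} :
    affinePoint x y ∈ D.realPoints ↔ y ^ 2 = x ^ 3 := by
  rw [affinePoint, mk_mem_realPoints_iff (P := realCubicForm)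
    (by rw [map_realCubicForm]; exact isHomogeneous_cubicForm) (by rwa [map_realCubicForm])]
  simp [realCubicForm, Matrix.cons_val, sub_eq_zero]

theorem mem_boundary_of_path {f : ℝ → RP2} (hf : Continuous f) {A : Set RP2}
    (h0 : f 0 ∈ D.realPoints ∩ A) (hD : ∀ t > 0, f t ∈ D.realPoints) (hA : ∀ t > 0, f t ∉ A) :
    f 0 ∈ D.boundary (D.realPoints ∩ A) :=
  ⟨⟨h0.1, subset_closure h0⟩, mem_closure_of_forall_pos hf fun t ht =>
    ⟨hD t ht, fun h => hA t ht h.2⟩⟩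

theorem notMem_boundary_of_isOpen {A U : Set RP2} (hU : IsOpen U) (hUA : U ∩ D.realPoints ⊆ A)
    {p : RP2} (hp : p ∈ U) : p ∉ D.boundary (D.realPoints ∩ A) := by
  rintro ⟨-, h⟩
  obtain ⟨q, hqU, hqD, hqA⟩ := mem_closure_iff.mp h U hU hp
  exact hqA ⟨hqD, hUA ⟨hqU, hqD⟩⟩

theorem boundary_subset {A : Set RP2} (hA : IsClosed A) (hD : IsClosed D.realPoints) :
    D.boundary (D.realPoints ∩ A) ⊆ D.realPoints ∩ A := by
  rintro p ⟨⟨-, h⟩, -⟩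
  rwa [(hD.inter hA).closure_eq] at h

theorem boundary_line (hD : Associated D.F lineForm) : D.boundary (D.realPoints ∩ regionII) =
    {affinePoint 1 1, affinePoint (1 / 4) (-1 / 8)} := by
  have hcl : IsClosed D.realPoints := isClosed_realPoints (P := realLineForm)
    (by rw [map_realLineForm]; exact isHomogeneous_lineForm) (by rwa [map_realLineForm])
  apply Set.Subset.antisymm
  · intro p hp
    obtain ⟨hpD, x, y, h1, h2, h3, rfl⟩ := boundary_subset isClosed_regionII hcl hp
    rw [affinePoint_mem_line_iff hD] at hpD
    have hy : y = 3 / 2 * x - 1 / 2 := by linarith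
    subst hy
    rw [Set.mem_insert_iff, Set.mem_singleton_iff, affinePoint_eq_iff, affinePoint_eq_iff]
    by_contra! hne
    have hx1 : x < 1 := lt_of_le_of_ne (by linarith) fun h => hne.1 h (by rw [h]; norm_num)
    have hx4 : x ≠ 1 / 4 := fun h => hne.2 h (by rw [h]; norm_num)
    have hkey : 0 ≤ (x - 1) ^ 2 * (x - 1 / 4) := by linarith
    have hpos : 0 < (x - 1) ^ 2 := sq_pos_of_ne_zero (by linarith)
    have hx : 0 < x - 1 / 4 := lt_of_le_of_ne (nonneg_of_mul_nonneg_right hkey hpos)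
      (Ne.symm (sub_ne_zero.mpr hx4))
    -- On the curve itself the linear inequality holds with equality, so strictness of the other two
    -- keeps a whole neighbourhood in the curve inside the region.
    have hS : IsOpen {q : ℝ × ℝ | q.2 ^ 2 < q.1 ^ 3 ∧ q.2 < 1} := by
      refine IsOpen.and (isOpen_lt ?_ ?_) (isOpen_lt ?_ ?_) <;> fun_prop
    refine notMem_boundary_of_isOpen (isOpen_chartSet hS) ?_ ?_ hp
    · rintro _ ⟨⟨x, y, ⟨h1, h2⟩, rfl⟩, hq⟩
      rw [affinePoint_mem_line_iff hD] at hq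
      exact affinePoint_mem_regionII_iff.mpr ⟨hq.ge, h1.le, h2.le⟩
    · exact ⟨_, _, ⟨by nlinarith [mul_pos hpos hx], by linarith⟩, rfl⟩
  · rintro p (rfl | rfl)
    · have := mem_boundary_of_path (D := D) (A := regionII)
        (f := fun t => affinePoint (1 + t) (1 + 3 / 2 * t))
        (continuous_affinePoint (by fun_prop) (by fun_prop)) ?_ ?_ ?_
      · simpa using this
      · exact ⟨(affinePoint_mem_line_iff hD).mpr (by norm_num),
          affinePoint_mem_regionII_iff.mpr (by norm_num)⟩
      · exact fun t _ => (affinePoint_mem_line_iff hD).mpr (by ring)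
      · intro t ht h
        have := (affinePoint_mem_regionII_iff.mp h).2.2
        linarith
    · have := mem_boundary_of_path (D := D) (A := regionII)
        (f := fun t => affinePoint (1 / 4 - t) (-1 / 8 - 3 / 2 * t))
        (continuous_affinePoint (by fun_prop) (by fun_prop)) ?_ ?_ ?_
      · simpa using this
      · exact ⟨(affinePoint_mem_line_iff hD).mpr (by norm_num),
          affinePoint_mem_regionII_iff.mpr (by norm_num)⟩
      · exact fun t _ => (affinePoint_mem_line_iff hD).mpr (by ring)
      · intro t ht h
        have := (affinePoint_mem_regionII_iff.mp h).2.1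
        -- Beyond the crossing point, `x³ - y² = -t (t + 3/4)²`.
        nlinarith [mul_pos ht (sq_pos_of_pos (show 0 < t + 3 / 4 by linarith))]

/-- On the cubic `y² ≤ x³` holds with equality, so only the other two inequalities can cut out an
end point. Both are strict at the cusp, which is therefore not a boundary point of the arc. -/
theorem boundary_cubic (hD : Associated D.F cubicForm) : D.boundary (D.realPoints ∩ regionII) =
    {affinePoint 1 1, affinePoint (1 / 4) (-1 / 8)} := by
  have hcl : IsClosed D.realPoints := isClosed_realPoints (P := realCubicForm)
    (by rw [map_realCubicForm]; exact isHomogeneous_cubicForm) (by rwa [map_realCubicForm])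
  apply Set.Subset.antisymm
  · intro p hp
    obtain ⟨hpD, x, y, h1, h2, h3, rfl⟩ := boundary_subset isClosed_regionII hcl hp
    rw [affinePoint_mem_cubic_iff hD] at hpD
    rw [Set.mem_insert_iff, Set.mem_singleton_iff, affinePoint_eq_iff, affinePoint_eq_iff]
    by_contra! hne
    obtain ⟨t, rfl, rfl⟩ : ∃ t, x = t ^ 2 ∧ y = t ^ 3 := by
      by_cases hx : x = 0
      · subst hx
        exact ⟨0, by norm_num, by simpa using hpD⟩
      · refine ⟨y / x, ?_, ?_⟩
        · field_simp
          linarith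
        · field_simp
          linear_combination -y * hpD
    have ht1 : t ≠ 1 := fun h => hne.1 (by rw [h]; norm_num) (by rw [h]; norm_num)
    have ht2 : t + 1 / 2 ≠ 0 := fun h => by
      have h' : t = -1 / 2 := by linarith
      exact hne.2 (by rw [h']; norm_num) (by rw [h']; norm_num)
    have hpos : 0 < (t - 1) ^ 2 := sq_pos_of_ne_zero (sub_ne_zero.mpr ht1)
    have hkey : 0 ≤ (t - 1) ^ 2 * (t + 1 / 2) := by linarith
    have ht : 0 < t + 1 / 2 :=
      lt_of_le_of_ne (nonneg_of_mul_nonneg_right hkey hpos) (Ne.symm ht2)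
    have hlt : t < 1 := by
      refine lt_of_le_of_ne ?_ ht1
      by_contra! h
      nlinarith [sq_nonneg (t + 1 / 2)]
    have hS : IsOpen {q : ℝ × ℝ | 0 < q.2 - 3 / 2 * q.1 + 1 / 2 ∧ q.2 < 1} := by
      refine IsOpen.and (isOpen_lt ?_ ?_) (isOpen_lt ?_ ?_) <;> fun_prop
    refine notMem_boundary_of_isOpen (isOpen_chartSet hS) ?_ ?_ hp
    · rintro _ ⟨⟨x, y, ⟨h1, h2⟩, rfl⟩, hq⟩
      rw [affinePoint_mem_cubic_iff hD] at hq
      exact affinePoint_mem_regionII_iff.mpr ⟨h1.le, hq.le, h2.le⟩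
    · exact ⟨_, _, ⟨by nlinarith [mul_pos hpos ht], by
        nlinarith [mul_pos (sub_pos.mpr hlt) (show 0 < t ^ 2 + t + 1 by
          nlinarith [sq_nonneg (t + 1 / 2)])]⟩, rfl⟩
  · rintro p (rfl | rfl)
    · have := mem_boundary_of_path (D := D) (A := regionII)
        (f := fun t => affinePoint ((1 + t) ^ 2) ((1 + t) ^ 3))
        (continuous_affinePoint (by fun_prop) (by fun_prop)) ?_ ?_ ?_
      · simpa using this
      · exact ⟨(affinePoint_mem_cubic_iff hD).mpr (by norm_num),
          affinePoint_mem_regionII_iff.mpr (by norm_num)⟩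
      · exact fun t _ => (affinePoint_mem_cubic_iff hD).mpr (by ring)
      · intro t ht h
        have := (affinePoint_mem_regionII_iff.mp h).2.2
        nlinarith [pow_pos ht 2, pow_pos ht 3]
    · have := mem_boundary_of_path (D := D) (A := regionII)
        (f := fun t => affinePoint ((-1 / 2 - t) ^ 2) ((-1 / 2 - t) ^ 3))
        (continuous_affinePoint (by fun_prop) (by fun_prop)) ?_ ?_ ?_
      · convert this using 1
        norm_num
      · exact ⟨(affinePoint_mem_cubic_iff hD).mpr (by norm_num),
          affinePoint_mem_regionII_iff.mpr (by norm_num)⟩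
      · exact fun t _ => (affinePoint_mem_cubic_iff hD).mpr (by ring)
      · intro t ht h
        have := (affinePoint_mem_regionII_iff.mp h).1
        -- Beyond the crossing point, the linear form equals `-t (t + 3/2)²`.
        nlinarith [mul_pos ht (sq_pos_of_pos (show 0 < t + 3 / 2 by linarith))]

theorem zariskiClosure_boundary_line (hD : Associated D.F lineForm) :
    zariskiClosure (D.boundary (D.realPoints ∩ regionII)) = {tangencyPoint, crossingPoint} := by
  rw [boundary_line hD, zariskiClosure_pair]
  rfl

theorem zariskiClosure_boundary_cubic (hD : Associated D.F cubicForm) :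
    zariskiClosure (D.boundary (D.realPoints ∩ regionII)) = {tangencyPoint, crossingPoint} := by
  rw [boundary_cubic hD, zariskiClosure_pair]
  rfl

theorem exists_unique_canonicalForm {A : Set RP2} {θ₀ : D.Form1}
    (h : ∀ θ, D.IsCanonicalForm A θ ↔ ∃ ε, IsCanonicalPointForm ε ∧ θ = ε • θ₀) :
    ∃ θ, D.IsCanonicalForm A θ ∧ ∀ θ', D.IsCanonicalForm A θ' → θ' = θ ∨ θ' = -θ := by
  refine ⟨θ₀, (h _).mpr ⟨1, Or.inl rfl, (one_smul _ _).symm⟩, fun θ' hθ' => ?_⟩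
  obtain ⟨ε, rfl | rfl, rfl⟩ := (h _).mp hθ'
  · exact Or.inl (one_smul _ _)
  · exact Or.inr (by rw [neg_smul, one_smul])

theorem isPositiveGeometry_line (hD : Associated D.F lineForm) :
    D.IsPositiveGeometry (D.realPoints ∩ regionII) := by
  have h1 : (MvPolynomial.map (algebraMap ℝ ℂ) realLineForm).IsHomogeneous 1 := by
    rw [map_realLineForm]; exact isHomogeneous_lineForm
  have h2 : Associated D.F (MvPolynomial.map (algebraMap ℝ ℂ) realLineForm) := by
    rwa [map_realLineForm]
  have hinf : (D.realPoints ∩ regionII).Infinite := by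
    refine ((Set.Ioo_infinite (show (1 / 4 : ℝ) < 1 by norm_num)).image
      (f := fun x => affinePoint x (3 / 2 * x - 1 / 2))
      fun x _ y _ h => (affinePoint_eq_iff.mp h).1).mono ?_
    rintro _ ⟨x, hx, rfl⟩
    exact ⟨(affinePoint_mem_line_iff hD).mpr (by ring),
      isClosed_regionII.frontier_subset (line_mem_frontier hx.1.le hx.2.le)⟩
  exact ⟨⟨_, h2⟩, Set.inter_subset_left, hinf.nonempty,
    (isClosed_realPoints h1 h2).inter isClosed_regionII,
    isSemialgebraicRP2_realPoints_inter h1 h2 isSemialgebraicRP2_regionII, hinf,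
    exists_unique_canonicalForm
      (isCanonicalForm_line_iff (zariskiClosure_boundary_line hD) hD)⟩

theorem isPositiveGeometry_cubic (hD : Associated D.F cubicForm) :
    D.IsPositiveGeometry (D.realPoints ∩ regionII) := by
  have h1 : (MvPolynomial.map (algebraMap ℝ ℂ) realCubicForm).IsHomogeneous 3 := by
    rw [map_realCubicForm]; exact isHomogeneous_cubicForm
  have h2 : Associated D.F (MvPolynomial.map (algebraMap ℝ ℂ) realCubicForm) := by
    rwa [map_realCubicForm]
  have hinf : (D.realPoints ∩ regionII).Infinite := by
    refine ((Set.Ioo_infinite (show (-1 / 2 : ℝ) < 1 by norm_num)).image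
      (f := fun t => affinePoint (t ^ 2) (t ^ 3)) fun x _ y _ h => ?_).mono ?_
    · exact Odd.strictMono_pow (by decide : Odd 3) |>.injective (affinePoint_eq_iff.mp h).2
    · rintro _ ⟨t, ht, rfl⟩
      exact ⟨(affinePoint_mem_cubic_iff hD).mpr (by ring), cubic_mem_regionII ht.1.le ht.2.le⟩
  exact ⟨⟨_, h2⟩, Set.inter_subset_left, hinf.nonempty,
    (isClosed_realPoints h1 h2).inter isClosed_regionII,
    isSemialgebraicRP2_realPoints_inter h1 h2 isSemialgebraicRP2_regionII, hinf,
    exists_unique_canonicalForm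
      (isCanonicalForm_cubic_iff (zariskiClosure_boundary_cubic hD) hD)⟩

end PlaneCurve
end PosGeom

namespace PosGeom

/-! ### Differential forms on the plane -/

theorem derivation_mvAeval {σ A M : Type*} [Fintype σ] [CommRing A] [Algebra ℂ A]
    [AddCommGroup M] [Module A M] [Module ℂ M] [IsScalarTower ℂ A M] (δ : Derivation ℂ A M)
    (w : σ → A) (P : MvPolynomial σ ℂ) : δ (MvPolynomial.aeval w P) =
      ∑ i, MvPolynomial.aeval w (MvPolynomial.pderiv i P) • δ (w i) := by
  classical
  induction P using MvPolynomial.induction_on with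
  | C a => simp
  | add P Q hP hQ => simp only [map_add, hP, hQ, add_smul, Finset.sum_add_distrib]
  | mul_X P i hP =>
    simp only [map_mul, Derivation.leibniz, MvPolynomial.aeval_X, hP, smul_eq_mul, map_add,
      MvPolynomial.pderiv_X, add_smul, Finset.sum_add_distrib, Finset.smul_sum, smul_smul]
    congr 1
    rw [Finset.sum_eq_single i (fun j _ hj => by simp [hj.symm]) (by simp)]
    simp

theorem d_add (f g : K2) : d (f + g) = d f + d g := map_add _ f g

theorem d_sub (f g : K2) : d (f - g) = d f - d g := map_sub _ f g

theorem d_algebraMap (c : ℂ) : d (algebraMap ℂ K2 c) = 0 := Derivation.map_algebraMap _ c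

theorem d_mul (f g : K2) : d (f * g) = f • d g + g • d f := Derivation.leibniz _ f g

theorem d_div (f g : K2) : d (f / g) = (g⁻¹ ^ 2) • (g • d f - f • d g) :=
  Derivation.leibniz_div _ f g

theorem d_one : d 1 = 0 := Derivation.map_one_eq_zero _

theorem d_mvAeval (u v : K2) (P : MvPolynomial (Fin 2) ℂ) :
    d (MvPolynomial.aeval ![u, v] P) =
      MvPolynomial.aeval ![u, v] (MvPolynomial.pderiv 0 P) • d u +
        MvPolynomial.aeval ![u, v] (MvPolynomial.pderiv 1 P) • d v := by
  rw [d, derivation_mvAeval, Fin.sum_univ_two]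
  rfl

theorem wedge_add_left (a b c : Ω[K2⁄ℂ]) : wedge (a + b) c = wedge a c + wedge b c := by
  have := (exteriorPower.ιMulti K2 2 (M := Ω[K2⁄ℂ])).map_update_add ![a, c] 0 a b
  have e : ∀ z, Function.update ![a, c] 0 z = ![z, c] := by
    intro z
    funext i
    fin_cases i <;> simp
  rwa [e, e, e] at this

theorem wedge_smul_left (r : K2) (a c : Ω[K2⁄ℂ]) : wedge (r • a) c = r • wedge a c := by
  have := (exteriorPower.ιMulti K2 2 (M := Ω[K2⁄ℂ])).map_update_smul ![a, c] 0 r a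
  have e : ∀ z, Function.update ![a, c] 0 z = ![z, c] := by
    intro z
    funext i
    fin_cases i <;> simp
  rwa [e, e] at this

theorem wedge_self (a : Ω[K2⁄ℂ]) : wedge a a = 0 :=
  (exteriorPower.ιMulti K2 2 (M := Ω[K2⁄ℂ])).map_eq_zero_of_eq ![a, a] (i := 0) (j := 1) rfl
    (by decide)

theorem wedge_swap (a b : Ω[K2⁄ℂ]) : wedge b a = -wedge a b := by
  have := (exteriorPower.ιMulti K2 2 (M := Ω[K2⁄ℂ])).map_swap ![a, b] (i := 0) (j := 1) (by decide)
  rw [wedge, wedge, ← this]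
  congr 1
  funext i
  fin_cases i <;> simp

theorem wedge_add_right (a b c : Ω[K2⁄ℂ]) : wedge a (b + c) = wedge a b + wedge a c := by
  rw [wedge_swap, wedge_add_left, wedge_swap a b, wedge_swap a c, neg_add, neg_neg, neg_neg]

theorem wedge_smul_right (r : K2) (a c : Ω[K2⁄ℂ]) : wedge a (r • c) = r • wedge a c := by
  rw [wedge_swap, wedge_smul_left, wedge_swap a c, smul_neg, neg_neg]

theorem wedge_combination (a b c e : K2) (α β : Ω[K2⁄ℂ]) :
    wedge (a • α + b • β) (c • α + e • β) = (a * e - b * c) • wedge α β := by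
  simp only [wedge_add_left, wedge_add_right, wedge_smul_left, wedge_smul_right, wedge_self,
    wedge_swap α β, smul_zero, zero_add, add_zero, smul_neg, smul_smul]
  refine Eq.trans ?_ (sub_smul (a * e) (b * c) (wedge α β)).symm
  rw [mul_comm c b, mul_comm e a, neg_add_eq_sub]

theorem algebraMap_eq_aeval (P : MvPolynomial (Fin 2) ℂ) :
    algebraMap (MvPolynomial (Fin 2) ℂ) K2 P = MvPolynomial.aeval ![xCoord, yCoord] P := by
  have h : ![xCoord, yCoord] = fun i => algebraMap (MvPolynomial (Fin 2) ℂ) K2 (MvPolynomial.X i) := by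
    funext i
    fin_cases i <;> rfl
  rw [h]
  have h1 := MvPolynomial.aeval_algebraMap_apply (R := ℂ) K2
    (MvPolynomial.X : Fin 2 → MvPolynomial (Fin 2) ℂ) P
  rw [MvPolynomial.aeval_X_left_apply] at h1
  exact h1.symm

theorem exists_eq_div (f : K2) : ∃ P Q : MvPolynomial (Fin 2) ℂ, Q ≠ 0 ∧ IsRelPrime P Q ∧
    f = MvPolynomial.aeval ![xCoord, yCoord] P / MvPolynomial.aeval ![xCoord, yCoord] Q := by
  obtain ⟨P, Q, h1, h2⟩ := IsFractionRing.exists_reduced_fraction (A := MvPolynomial (Fin 2) ℂ) (K := K2) f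
  refine ⟨P, Q, nonZeroDivisors.coe_ne_zero Q, h1, ?_⟩
  rw [← algebraMap_eq_aeval, ← algebraMap_eq_aeval, ← h2]
  exact IsFractionRing.mk'_eq_div (A := MvPolynomial (Fin 2) ℂ) (K := K2) _

theorem exists_eq_combination (η : Ω[K2⁄ℂ]) : ∃ a b : K2, η = a • d xCoord + b • d yCoord := by
  have hmem : ∀ P : MvPolynomial (Fin 2) ℂ, d (MvPolynomial.aeval ![xCoord, yCoord] P) ∈
      Submodule.span K2 {d xCoord, d yCoord} := by
    intro P
    rw [d_mvAeval]
    exact Submodule.mem_span_pair.mpr ⟨_, _, rfl⟩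
  have h : (⊤ : Submodule K2 Ω[K2⁄ℂ]) ≤ Submodule.span K2 {d xCoord, d yCoord} := by
    rw [← KaehlerDifferential.span_range_derivation, Submodule.span_le]
    rintro _ ⟨f, rfl⟩
    obtain ⟨P, Q, -, -, rfl⟩ := exists_eq_div f
    rw [Derivation.leibniz_div]
    exact Submodule.smul_mem _ _ (Submodule.sub_mem _ (Submodule.smul_mem _ _ (hmem _))
      (Submodule.smul_mem _ _ (hmem _)))
  obtain ⟨a, b, hab⟩ := Submodule.mem_span_pair.mp (h (Submodule.mem_top (x := η)))
  exact ⟨a, b, hab.symm⟩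

theorem exists_eq_smul_wedge (ω : Form2) : ∃ k : K2, ω = k • wedge (d xCoord) (d yCoord) := by
  have h : (⊤ : Submodule K2 Form2) ≤ Submodule.span K2 {wedge (d xCoord) (d yCoord)} := by
    rw [← exteriorPower.ιMulti_span, Submodule.span_le]
    rintro _ ⟨m, rfl⟩
    obtain ⟨a, b, h0⟩ := exists_eq_combination (m 0)
    obtain ⟨c, e, h1⟩ := exists_eq_combination (m 1)
    have hm : m = ![m 0, m 1] := by
      funext i
      fin_cases i <;> rfl
    have : exteriorPower.ιMulti K2 2 m = wedge (m 0) (m 1) := by rw [wedge, ← hm]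
    rw [this, h0, h1, wedge_combination]
    exact Submodule.smul_mem _ _ (Submodule.mem_span_singleton_self _)
  obtain ⟨k, hk⟩ := Submodule.mem_span_singleton.mp (h (Submodule.mem_top (x := ω)))
  exact ⟨k, hk.symm⟩

/-- Localizing the basis of the differentials of `ℂ[x, y]` shows that `dx, dy` is a basis, and the
determinant in this basis takes the value one on it. -/
theorem wedge_dx_dy_ne_zero : wedge (d xCoord) (d yCoord) ≠ 0 := by
  let b := (KaehlerDifferential.mvPolynomialBasis ℂ (Fin 2)).ofIsLocalizedModule K2
    (nonZeroDivisors (MvPolynomial (Fin 2) ℂ))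
    (KaehlerDifferential.map ℂ ℂ (MvPolynomial (Fin 2) ℂ) K2)
  have hb : (b : Fin 2 → Ω[K2⁄ℂ]) = ![d xCoord, d yCoord] := by
    funext i
    rw [Module.Basis.ofIsLocalizedModule_apply, KaehlerDifferential.mvPolynomialBasis_apply,
      KaehlerDifferential.map_D]
    fin_cases i <;> rfl
  intro h
  have h1 := congrArg (exteriorPower.alternatingMapLinearEquiv b.det) h
  rw [wedge, exteriorPower.alternatingMapLinearEquiv_apply_ιMulti, ← hb, b.det_self, map_zero] at h1
  exact one_ne_zero h1

theorem smul_wedge_injective {u v : K2} (h : wedge (d u) (d v) ≠ 0) {a b : K2}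
    (hab : a • wedge (d u) (d v) = b • wedge (d u) (d v)) : a = b :=
  smul_left_injective K2 h hab

theorem totalDegree_pderiv_lt {P : MvPolynomial (Fin 2) ℂ} (i : Fin 2)
    (h : MvPolynomial.pderiv i P ≠ 0) :
    (MvPolynomial.pderiv i P).totalDegree < P.totalDegree := by
  have key : ∀ m ∈ (MvPolynomial.pderiv i P).support,
      (m.sum fun _ e => e) < P.totalDegree := by
    intro m hm
    rw [MvPolynomial.mem_support_iff, MvPolynomial.coeff_pderiv] at hm
    have h1 := MvPolynomial.le_totalDegree
      (MvPolynomial.mem_support_iff.mpr (left_ne_zero_of_mul hm))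
    rw [Finsupp.sum_add_index' (fun _ => rfl) (fun _ _ _ => rfl),
      Finsupp.sum_single_index rfl] at h1
    exact h1
  obtain ⟨m, hm⟩ := MvPolynomial.support_nonempty.mpr h
  exact (Finset.sup_lt_iff (Nat.zero_le _ |>.trans_lt (key m hm))).mpr key

/-- Functions with linearly independent differentials are algebraically independent. -/
theorem mvAeval_injective {u v : K2} (h : wedge (d u) (d v) ≠ 0) :
    Function.Injective (MvPolynomial.aeval (R := ℂ) ![u, v]) := by
  rw [injective_iff_map_eq_zero]
  suffices H : ∀ n, ∀ P : MvPolynomial (Fin 2) ℂ, P.totalDegree = n →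
      MvPolynomial.aeval ![u, v] P = 0 → P = 0 from fun P => H _ P rfl
  intro n
  induction n using Nat.strong_induction_on with
  | _ n ih =>
    intro P hn hP
    -- Differentiating a relation and wedging with `dv` and `du` shows that both partial derivatives
    -- are again relations, of smaller degree unless zero. By induction they vanish, so `P` is
    -- constant.
    have h0 := d_mvAeval u v P
    rw [hP, show d 0 = 0 from map_zero _] at h0
    have h1 := congrArg (fun η => wedge η (d v)) h0
    have h2 := congrArg (fun η => wedge (d u) η) h0
    simp only [wedge_add_left, wedge_smul_left, wedge_self, smul_zero, add_zero] at h1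
    simp only [wedge_add_right, wedge_smul_right, wedge_self, smul_zero, zero_add] at h2
    have e1 : wedge 0 (d v) = 0 := by simpa using wedge_smul_left 0 0 (d v)
    have e2 : wedge (d u) 0 = 0 := by simpa using wedge_smul_right 0 (d u) 0
    rw [e1, eq_comm, smul_eq_zero_iff_left h] at h1
    rw [e2, eq_comm, smul_eq_zero_iff_left h] at h2
    have h3 : ∀ i, MvPolynomial.aeval ![u, v] (MvPolynomial.pderiv i P) = 0 := by
      intro i
      fin_cases i
      · exact h1
      · exact h2
    have h4 : ∀ i, MvPolynomial.pderiv i P = 0 := by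
      intro i
      by_contra hne
      exact hne (ih _ (hn ▸ totalDegree_pderiv_lt i hne) _ rfl (h3 i))
    have h5 : P = MvPolynomial.C (MvPolynomial.coeff 0 P) := by
      ext m
      rw [MvPolynomial.coeff_C]
      split_ifs with hm
      · rw [hm]
      · obtain ⟨i, hi⟩ := Finsupp.ne_iff.mp (Ne.symm hm)
        have h6 := congrArg (MvPolynomial.coeff (m - Finsupp.single i 1)) (h4 i)
        have h7 : m - Finsupp.single i 1 + Finsupp.single i 1 = m :=
          tsub_add_cancel_of_le (Finsupp.single_le_iff.mpr (Nat.one_le_iff_ne_zero.mpr hi))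
        rw [MvPolynomial.coeff_pderiv, h7, MvPolynomial.coeff_zero] at h6
        exact (mul_eq_zero.mp h6).resolve_right (Nat.cast_add_one_ne_zero _)
    rw [h5, MvPolynomial.aeval_C] at hP
    rw [h5, (map_eq_zero_iff _ (algebraMap ℂ K2).injective).mp hP, map_zero]

end PosGeom

namespace PosGeom

/-! ### Logarithmic forms in local coordinates -/

/-- Evaluation of a polynomial at a pair of rational functions. -/
def evalAt (u v : K2) : MvPolynomial (Fin 2) ℂ →ₐ[ℂ] K2 := MvPolynomial.aeval ![u, v]

@[simp] theorem evalAt_X_zero (u v : K2) : evalAt u v (MvPolynomial.X 0) = u := by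
  simp [evalAt]

@[simp] theorem evalAt_X_one (u v : K2) : evalAt u v (MvPolynomial.X 1) = v := by
  simp [evalAt]

@[simp] theorem evalAt_C (u v : K2) (c : ℂ) :
    evalAt u v (MvPolynomial.C c) = algebraMap ℂ K2 c := by
  simp [evalAt]

theorem hasValue_div (u v : K2) (P : MvPolynomial (Fin 2) ℂ) {Q : MvPolynomial (Fin 2) ℂ}
    (hQ : MvPolynomial.constantCoeff Q ≠ 0) : HasValue u v (evalAt u v P / evalAt u v Q)
      (MvPolynomial.constantCoeff P / MvPolynomial.constantCoeff Q) :=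
  ⟨P, Q, hQ, rfl, rfl⟩

theorem hasValue_evalAt (u v : K2) (P : MvPolynomial (Fin 2) ℂ) :
    HasValue u v (evalAt u v P) (MvPolynomial.constantCoeff P) := by
  simpa using hasValue_div u v P (Q := 1) (by simp)

theorem exists_eq_mul_X_add (P : MvPolynomial (Fin 2) ℂ) :
    ∃ A B, P = A * MvPolynomial.X 0 + B * MvPolynomial.X 1 +
      MvPolynomial.C (MvPolynomial.constantCoeff P) := by
  induction P using MvPolynomial.induction_on with
  | C a => exact ⟨0, 0, by simp⟩
  | add P Q hP hQ =>
    obtain ⟨A, B, h⟩ := hP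
    obtain ⟨A', B', h'⟩ := hQ
    refine ⟨A + A', B + B', ?_⟩
    rw [map_add, map_add]
    linear_combination h + h'
  | mul_X P i _ =>
    fin_cases i
    · exact ⟨P, 0, by simp⟩
    · exact ⟨0, P, by simp⟩

theorem evalAt_ne_zero {u v : K2} (hw : wedge (d u) (d v) ≠ 0) {P : MvPolynomial (Fin 2) ℂ}
    (hP : MvPolynomial.constantCoeff P ≠ 0) : evalAt u v P ≠ 0 := by
  intro h
  have : P = 0 := mvAeval_injective hw (by rw [map_zero]; exact h)
  rw [this, map_zero] at hP
  exact hP rfl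

/-- The jacobian determinant of two polynomials in two variables. -/
def jacobian (S T : MvPolynomial (Fin 2) ℂ) : MvPolynomial (Fin 2) ℂ :=
  MvPolynomial.pderiv 0 S * MvPolynomial.pderiv 1 T -
    MvPolynomial.pderiv 1 S * MvPolynomial.pderiv 0 T

theorem wedge_d_evalAt (u v : K2) (S T : MvPolynomial (Fin 2) ℂ) :
    wedge (d (evalAt u v S)) (d (evalAt u v T)) =
      evalAt u v (jacobian S T) • wedge (d u) (d v) := by
  rw [evalAt, d_mvAeval, d_mvAeval, wedge_combination, jacobian, map_sub, map_mul, map_mul]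

/-- Write `S = A X + B Y` and `T = A' X + B' Y`. The determinant `A B' - B A'` has the same constant
coefficient as the jacobian, so it is a unit and Cramer's rule recovers `u` and `v`. -/
theorem isParameters_of_jacobian {u v : K2} (hw : wedge (d u) (d v) ≠ 0)
    {S T : MvPolynomial (Fin 2) ℂ} (hS : MvPolynomial.constantCoeff S = 0)
    (hT : MvPolynomial.constantCoeff T = 0)
    (hJ : MvPolynomial.constantCoeff (jacobian S T) ≠ 0) :
    IsParameters u v (evalAt u v S) (evalAt u v T) := by
  obtain ⟨A, B, hAB⟩ := exists_eq_mul_X_add S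
  obtain ⟨A', B', hAB'⟩ := exists_eq_mul_X_add T
  rw [hS, MvPolynomial.C_0, add_zero] at hAB
  rw [hT, MvPolynomial.C_0, add_zero] at hAB'
  have hΔ : MvPolynomial.constantCoeff (A * B' - B * A') ≠ 0 := by
    convert hJ using 1
    rw [hAB, hAB']
    simp [jacobian, MvPolynomial.pderiv_X]
  have h0 := evalAt_ne_zero hw hΔ
  have es : evalAt u v S = evalAt u v A * u + evalAt u v B * v := by
    rw [hAB, map_add, map_mul, map_mul, evalAt_X_zero, evalAt_X_one]
  have et : evalAt u v T = evalAt u v A' * u + evalAt u v B' * v := by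
    rw [hAB', map_add, map_mul, map_mul, evalAt_X_zero, evalAt_X_one]
  refine ⟨hS ▸ hasValue_evalAt u v S, hT ▸ hasValue_evalAt u v T,
    evalAt u v B' / evalAt u v (A * B' - B * A'), evalAt u v (-B) / evalAt u v (A * B' - B * A'),
    evalAt u v (-A') / evalAt u v (A * B' - B * A'), evalAt u v A / evalAt u v (A * B' - B * A'),
    ⟨_, hasValue_div u v _ hΔ⟩, ⟨_, hasValue_div u v _ hΔ⟩, ⟨_, hasValue_div u v _ hΔ⟩,
    ⟨_, hasValue_div u v _ hΔ⟩, ?_, ?_⟩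
  · rw [div_mul_eq_mul_div, div_mul_eq_mul_div, ← add_div, eq_div_iff h0, es, et]
    simp only [map_sub, map_mul, map_neg]
    ring
  · rw [div_mul_eq_mul_div, div_mul_eq_mul_div, ← add_div, eq_div_iff h0, es, et]
    simp only [map_sub, map_mul, map_neg]
    ring

/-- The normal crossings case is reduced to polynomial identities. The nonzero factors `q` and `r`
account for common factors of `N` and `M`, so that `N / M` becomes `H` over the unit `W` times the
components dividing `g`. -/
theorem isLogAt_of_jacobian {ω : Form2} {u v g N M : K2} (hw : wedge (d u) (d v) ≠ 0)
    (hω : ω = (N / M) • wedge (d u) (d v)) (S T E H W : MvPolynomial (Fin 2) ℂ) (a b : ℕ)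
    (q r : K2) (hq : q ≠ 0) (hr : r ≠ 0) (hS : MvPolynomial.constantCoeff S = 0)
    (hT : MvPolynomial.constantCoeff T = 0)
    (hJ : MvPolynomial.constantCoeff (jacobian S T) ≠ 0)
    (hE : MvPolynomial.constantCoeff E ≠ 0) (hW : MvPolynomial.constantCoeff W ≠ 0)
    (hg : g = evalAt u v E * evalAt u v S ^ a * evalAt u v T ^ b)
    (hN : q * N = r * evalAt u v H)
    (hM : q * M = r * (evalAt u v W * (evalAt u v S ^ min a 1 * evalAt u v T ^ min b 1))) :
    IsLogAt ω u v g := by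
  have hJ' := evalAt_ne_zero hw hJ
  have hWJ : MvPolynomial.constantCoeff (W * jacobian S T) ≠ 0 := by
    rw [map_mul]
    exact mul_ne_zero hW hJ
  refine IsLogAt.snc (evalAt u v S) (evalAt u v T) (evalAt u v E)
    (evalAt u v H / evalAt u v (W * jacobian S T)) _ a b (isParameters_of_jacobian hw hS hT hJ)
    (hasValue_evalAt u v E) hE hg ⟨_, hasValue_div u v H hWJ⟩ ?_
  rw [wedge_d_evalAt, smul_smul, hω]
  congr 1
  rw [← mul_div_mul_left N M hq, hN, hM, mul_div_mul_left _ _ hr, map_mul, div_div,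
    div_mul_eq_mul_div, mul_right_comm, mul_div_mul_right _ _ hJ']

theorem isLogAt_of_monomial {ω : Form2} {u v g N M : K2} (hw : wedge (d u) (d v) ≠ 0)
    (hω : ω = (N / M) • wedge (d u) (d v)) (E H W : MvPolynomial (Fin 2) ℂ) (a b : ℕ)
    (q r : K2) (hq : q ≠ 0) (hr : r ≠ 0)
    (hE : MvPolynomial.constantCoeff E ≠ 0) (hW : MvPolynomial.constantCoeff W ≠ 0)
    (hg : g = evalAt u v E * u ^ a * v ^ b) (hN : q * N = r * evalAt u v H)
    (hM : q * M = r * (evalAt u v W * (u ^ min a 1 * v ^ min b 1))) :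
    IsLogAt ω u v g :=
  isLogAt_of_jacobian hw hω (MvPolynomial.X 0) (MvPolynomial.X 1) E H W a b q r hq hr (by simp)
    (by simp) (by simp [jacobian, MvPolynomial.pderiv_X]) hE hW (by simpa using hg) hN
    (by simpa using hM)

theorem left_ne_zero_of_wedge {u v : K2} (hw : wedge (d u) (d v) ≠ 0) : u ≠ 0 := by
  rintro rfl
  apply hw
  rw [show d 0 = (0 : K2) • d 0 by rw [zero_smul]; exact map_zero _, wedge_smul_left, zero_smul]

theorem right_ne_zero_of_wedge {u v : K2} (hw : wedge (d u) (d v) ≠ 0) : v ≠ 0 := by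
  rw [← neg_ne_zero, ← wedge_swap] at hw
  exact left_ne_zero_of_wedge hw

/-- In the charts, `du ∧ dv = u du ∧ dw` and `du ∧ dv = v dw ∧ dv`: each blow-up contributes one
factor of the exceptional equation to the numerator. -/
theorem isLogAt_of_blowup {ω : Form2} {u v g N M : K2} (hw : wedge (d u) (d v) ≠ 0)
    (hω : ω = (N / M) • wedge (d u) (d v))
    (h₁ : ∀ (c : ℂ) (w : K2), wedge (d u) (d w) ≠ 0 → v = u * (w + algebraMap ℂ K2 c) →
      ω = ((N * u) / M) • wedge (d u) (d w) → IsLogAt ω u w g)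
    (h₂ : ∀ w : K2, wedge (d w) (d v) ≠ 0 → u = w * v →
      ω = ((N * v) / M) • wedge (d w) (d v) → IsLogAt ω w v g) : IsLogAt ω u v g := by
  have hu := left_ne_zero_of_wedge hw
  have hv := right_ne_zero_of_wedge hw
  refine IsLogAt.blowup (fun c => ?_) ?_
  · have h0 : v = u * (v / u - algebraMap ℂ K2 c + algebraMap ℂ K2 c) := by
      rw [sub_add_cancel, mul_div_cancel₀ _ hu]
    have h1 : wedge (d u) (d v) = u • wedge (d u) (d (v / u - algebraMap ℂ K2 c)) := by
      conv_lhs => rw [h0]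
      rw [d_mul, wedge_add_right, wedge_smul_right, wedge_smul_right, wedge_self, smul_zero,
        add_zero, d_add, d_algebraMap, add_zero]
    refine h₁ c _ (fun h2 => hw (by rw [h1, h2, smul_zero])) h0 ?_
    rw [hω, h1, smul_smul, div_mul_eq_mul_div]
  · have h0 : u = u / v * v := (div_mul_cancel₀ _ hv).symm
    have h1 : wedge (d u) (d v) = v • wedge (d (u / v)) (d v) := by
      conv_lhs => rw [h0]
      rw [d_mul, wedge_add_left, wedge_smul_left, wedge_smul_left, wedge_self, smul_zero, zero_add]
    refine h₂ _ (fun h2 => hw (by rw [h1, h2, smul_zero])) h0 ?_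
    rw [hω, h1, smul_smul, div_mul_eq_mul_div]

/-! ### The form at the cusp and at the point of tangency -/

open MvPolynomial (X C)

set_option linter.unusedSimpArgs false

theorem algebraMap_two : algebraMap ℂ K2 2 = 2 := map_ofNat _ 2

theorem algebraMap_three : algebraMap ℂ K2 3 = 3 := map_ofNat _ 3

theorem algebraMap_eight : algebraMap ℂ K2 8 = 8 := map_ofNat _ 8

theorem min_succ_one (n : ℕ) : min (n + 1) 1 = 1 := by simp

/-- This is the situation after two blow-ups, with `x = z w` and `y = z w²`. The exceptional curves
`z = 0` and `w = 0` and the strict transform `w = z` pass through one point with distinct tangents;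
a third blow-up separates them. -/
theorem isLogAt_cusp_second {ω : Form2} {z w g : K2} (hw : wedge (d z) (d w) ≠ 0)
    (hω : ω = (3 / 2 * (w - 1) / ((z * w * w - 3 / 2 * (z * w) + 1 / 2) * (w - z))) •
      wedge (d z) (d w))
    (hg : g = (z * w * w - 3 / 2 * (z * w) + 1 / 2) * z ^ 2 * w ^ 3 * (w - z)) :
    IsLogAt ω z w g := by
  refine isLogAt_of_blowup hw hω ?_ ?_
  · rintro c t ht rfl hω
    by_cases hc0 : c = 0
    · subst hc0
      -- The normal form divides by every component of the total transform. The numerator `H` has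
      -- the compensating factors `X 0` and `X 1`, as the form has no pole on any of the exceptional
      -- curves over the cusp.
      refine isLogAt_of_monomial ht hω
        ((X 0 * (X 0 * X 1) * (X 0 * X 1) - C (3 / 2) * (X 0 * (X 0 * X 1)) + C (1 / 2)) *
          (X 1 - 1)) (C (3 / 2) * (X 0 * X 1 - 1) * X 0 * X 1)
        ((X 0 * (X 0 * X 1) * (X 0 * X 1) - C (3 / 2) * (X 0 * (X 0 * X 1)) + C (1 / 2)) *
          (X 1 - 1)) 6 3 t 1 (right_ne_zero_of_wedge ht) one_ne_zero (by simp) (by simp) ?_ ?_ ?_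
      all_goals
        simp only [hg, map_add, map_sub, map_mul, map_pow, map_one, map_zero, map_div₀, evalAt_X_zero,
          evalAt_X_one, evalAt_C, algebraMap_two, algebraMap_three, algebraMap_eight, min_succ_one, Nat.zero_min]
        ring
    -- The strict transform of the cubic meets the third exceptional curve at `c = 1`.
    by_cases hc1 : c = 1
    · subst hc1
      refine isLogAt_of_monomial ht hω
        ((X 0 * (X 0 * (X 1 + 1)) * (X 0 * (X 1 + 1)) - C (3 / 2) * (X 0 * (X 0 * (X 1 + 1))) +
          C (1 / 2)) * (X 1 + 1) ^ 3) (C (3 / 2) * (X 0 * (X 1 + 1) - 1) * X 0)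
        (X 0 * (X 0 * (X 1 + 1)) * (X 0 * (X 1 + 1)) - C (3 / 2) * (X 0 * (X 0 * (X 1 + 1))) +
          C (1 / 2)) 6 1 1 1 one_ne_zero one_ne_zero (by simp) (by simp) ?_ ?_ ?_
      all_goals
        simp only [hg, map_add, map_sub, map_mul, map_pow, map_one, map_zero, map_div₀, evalAt_X_zero,
          evalAt_X_one, evalAt_C, algebraMap_two, algebraMap_three, algebraMap_eight, min_succ_one, Nat.zero_min]
        try ring
    · have hc1' := sub_ne_zero.mpr hc1
      refine isLogAt_of_monomial ht hω
        ((X 0 * (X 0 * (X 1 + C c)) * (X 0 * (X 1 + C c)) -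
          C (3 / 2) * (X 0 * (X 0 * (X 1 + C c))) + C (1 / 2)) * (X 1 + C c) ^ 3 * (X 1 + C c - 1))
        (C (3 / 2) * (X 0 * (X 1 + C c) - 1) * X 0)
        ((X 0 * (X 0 * (X 1 + C c)) * (X 0 * (X 1 + C c)) -
          C (3 / 2) * (X 0 * (X 0 * (X 1 + C c))) + C (1 / 2)) * (X 1 + C c - 1)) 6 0 1 1
        one_ne_zero one_ne_zero (by simp [hc0, hc1']) (by simp [hc1']) ?_ ?_ ?_
      all_goals
        simp only [hg, map_add, map_sub, map_mul, map_pow, map_one, map_zero, map_div₀, evalAt_X_zero,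
          evalAt_X_one, evalAt_C, algebraMap_two, algebraMap_three, algebraMap_eight, min_succ_one, Nat.zero_min]
        try ring
  · rintro t ht rfl hω
    refine isLogAt_of_monomial ht hω
      ((X 0 * X 1 * X 1 * X 1 - C (3 / 2) * (X 0 * X 1 * X 1) + C (1 / 2)) * (1 - X 0))
      (C (3 / 2) * (X 1 - 1) * X 0 * X 1)
      ((X 0 * X 1 * X 1 * X 1 - C (3 / 2) * (X 0 * X 1 * X 1) + C (1 / 2)) * (1 - X 0)) 2 6 t 1
      (left_ne_zero_of_wedge ht) one_ne_zero (by simp) (by simp) ?_ ?_ ?_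
    all_goals
      simp only [hg, map_add, map_sub, map_mul, map_pow, map_one, map_zero, map_div₀, evalAt_X_zero,
        evalAt_X_one, evalAt_C, algebraMap_two, algebraMap_three, algebraMap_eight, min_succ_one, Nat.zero_min]
      ring

/-- After one blow-up the strict transform `w² = u` is smooth but tangent to the exceptional curve
`u = 0`. At the next blow-up it appears only in the chart `u = z w`. -/
theorem isLogAt_cusp_first {ω : Form2} {u w g : K2} (hw : wedge (d u) (d w) ≠ 0)
    (hω : ω = (3 / 2 * (w - 1) / ((u * w - 3 / 2 * u + 1 / 2) * (w ^ 2 - u))) •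
      wedge (d u) (d w))
    (hg : g = (u * w - 3 / 2 * u + 1 / 2) * u ^ 2 * (w ^ 2 - u)) :
    IsLogAt ω u w g := by
  refine isLogAt_of_blowup hw hω ?_ ?_
  · rintro c z hz rfl hω
    refine isLogAt_of_monomial hz hω
      ((X 0 * (X 0 * (X 1 + C c)) - C (3 / 2) * X 0 + C (1 / 2)) * (X 0 * (X 1 + C c) ^ 2 - 1))
      (C (3 / 2) * (X 0 * (X 1 + C c) - 1) * X 0)
      ((X 0 * (X 0 * (X 1 + C c)) - C (3 / 2) * X 0 + C (1 / 2)) * (X 0 * (X 1 + C c) ^ 2 - 1))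
      3 0 1 1 one_ne_zero one_ne_zero (by simp) (by simp) ?_ ?_ ?_
    all_goals
      simp only [hg, map_add, map_sub, map_mul, map_pow, map_one, map_zero, map_div₀, evalAt_X_zero,
        evalAt_X_one, evalAt_C, algebraMap_two, algebraMap_three, algebraMap_eight, min_succ_one, Nat.zero_min]
      try ring
  · rintro z hz rfl hω
    refine isLogAt_cusp_second hz ?_ ?_
    · rw [hω, ← mul_div_mul_left (3 / 2 * (w - 1)) _ (right_ne_zero_of_wedge hz)]
      congr 2 <;> ring
    · rw [hg]
      ring

theorem isLogAt_cusp {ω : Form2} {u v g : K2} (hw : wedge (d u) (d v) ≠ 0)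
    (hω : ω = (3 / 2 * (v - u) / ((v - 3 / 2 * u + 1 / 2) * (v ^ 2 - u ^ 3))) •
      wedge (d u) (d v))
    (hg : g = (v - 3 / 2 * u + 1 / 2) * (v ^ 2 - u ^ 3)) :
    IsLogAt ω u v g := by
  refine isLogAt_of_blowup hw hω ?_ ?_
  · rintro c w hw' rfl hω
    have hu := left_ne_zero_of_wedge hw'
    by_cases hc0 : c = 0
    · subst hc0
      refine isLogAt_cusp_first hw' ?_ ?_
      · rw [hω, ← mul_div_mul_left (3 / 2 * (w - 1)) _ (pow_ne_zero 2 hu), map_zero]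
        congr 2 <;> ring
      · rw [hg, map_zero]
        ring
    · refine isLogAt_of_monomial hw' hω
        ((X 0 * (X 1 + C c) - C (3 / 2) * X 0 + C (1 / 2)) * ((X 1 + C c) ^ 2 - X 0))
        (C (3 / 2) * (X 1 + C c - 1) * X 0)
        ((X 0 * (X 1 + C c) - C (3 / 2) * X 0 + C (1 / 2)) * ((X 1 + C c) ^ 2 - X 0))
        2 0 1 u one_ne_zero hu (by simp [hc0]) (by simp [hc0]) ?_ ?_ ?_
      all_goals
        simp only [hg, map_add, map_sub, map_mul, map_pow, map_one, map_zero, map_div₀, evalAt_X_zero,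
          evalAt_X_one, evalAt_C, algebraMap_two, algebraMap_three, algebraMap_eight, min_succ_one, Nat.zero_min]
        ring
  · rintro w hw' rfl hω
    refine isLogAt_of_monomial hw' hω
      ((X 1 - C (3 / 2) * (X 0 * X 1) + C (1 / 2)) * (1 - X 0 ^ 3 * X 1))
      (C (3 / 2) * (1 - X 0) * X 1)
      ((X 1 - C (3 / 2) * (X 0 * X 1) + C (1 / 2)) * (1 - X 0 ^ 3 * X 1))
      0 2 1 v one_ne_zero (right_ne_zero_of_wedge hw') (by simp) (by simp) ?_ ?_ ?_
    all_goals
      simp only [hg, map_add, map_sub, map_mul, map_pow, map_one, map_zero, map_div₀, evalAt_X_zero,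
        evalAt_X_one, evalAt_C, algebraMap_two, algebraMap_three, algebraMap_eight, min_succ_one, Nat.zero_min]
      ring

/-- After one blow-up the line `w = 0` and the branch of the cubic, `w = 3u/8` to first order, cross
on the exceptional curve, so three branches are concurrent. The next blow-up separates them and
leaves a simple pole along the new exceptional curve. -/
theorem isLogAt_tacnode_first {ω : Form2} {u w g : K2} (hw : wedge (d u) (d w) ≠ 0)
    (hω : ω = (3 / 2 * (w + 1 / 2) / (w * (2 * w + u * ((w + 3 / 2) ^ 2 - 3 - u)))) •
      wedge (d u) (d w))
    (hg : g = u ^ 2 * (w * (2 * w + u * ((w + 3 / 2) ^ 2 - 3 - u)))) :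
    IsLogAt ω u w g := by
  refine isLogAt_of_blowup hw hω ?_ ?_
  · rintro c z hz rfl hω
    have hu := left_ne_zero_of_wedge hz
    by_cases hc0 : c = 0
    · subst hc0
      refine isLogAt_of_monomial hz hω
        (C 2 * X 1 + (X 0 * X 1 + C (3 / 2)) ^ 2 - C 3 - X 0)
        (C (3 / 2) * (X 0 * X 1 + C (1 / 2)))
        (C 2 * X 1 + (X 0 * X 1 + C (3 / 2)) ^ 2 - C 3 - X 0) 4 1 1 u one_ne_zero hu
        (by simp; norm_num) (by simp; norm_num) ?_ ?_ ?_
      all_goals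
        simp only [hg, map_add, map_sub, map_mul, map_pow, map_one, map_zero, map_div₀, evalAt_X_zero,
          evalAt_X_one, evalAt_C, algebraMap_two, algebraMap_three, algebraMap_eight, min_succ_one, Nat.zero_min]
        ring
    -- The root of `2c + (3/2)² - 3`, where the cubic meets the second exceptional curve. Its
    -- equation is not a coordinate there, so it is taken as the second parameter.
    by_cases hc1 : c = 3 / 8
    · subst hc1
      refine isLogAt_of_jacobian hz hω (X 0)
        (C 2 * (X 1 + C (3 / 8)) + (X 0 * (X 1 + C (3 / 8)) + C (3 / 2)) ^ 2 - C 3 - X 0)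
        (X 1 + C (3 / 8)) (C (3 / 2) * (X 0 * (X 1 + C (3 / 8)) + C (1 / 2)))
        (X 1 + C (3 / 8)) 4 1 1 u one_ne_zero hu (by simp) (by simp; norm_num)
        (by simp [jacobian, MvPolynomial.pderiv_X]) (by simp) (by simp) ?_ ?_ ?_
      all_goals
        simp only [hg, map_add, map_sub, map_mul, map_pow, map_one, map_zero, map_div₀, evalAt_X_zero,
          evalAt_X_one, evalAt_C, algebraMap_two, algebraMap_three, algebraMap_eight, min_succ_one, Nat.zero_min]
        ring
    · have hc1' : 2 * c + (3 / 2) ^ 2 - 3 ≠ 0 := fun h => hc1 (by linear_combination h / 2)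
      refine isLogAt_of_monomial hz hω
        ((X 1 + C c) * (C 2 * (X 1 + C c) + (X 0 * (X 1 + C c) + C (3 / 2)) ^ 2 - C 3 - X 0))
        (C (3 / 2) * (X 0 * (X 1 + C c) + C (1 / 2)))
        ((X 1 + C c) * (C 2 * (X 1 + C c) + (X 0 * (X 1 + C c) + C (3 / 2)) ^ 2 - C 3 - X 0))
        4 0 1 u one_ne_zero hu (by simpa [hc0] using hc1') (by simpa [hc0] using hc1') ?_ ?_ ?_
      all_goals
        simp only [hg, map_add, map_sub, map_mul, map_pow, map_one, map_zero, map_div₀, evalAt_X_zero,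
          evalAt_X_one, evalAt_C, algebraMap_two, algebraMap_three, algebraMap_eight, min_succ_one, Nat.zero_min]
        ring
  · rintro z hz rfl hω
    refine isLogAt_of_monomial hz hω
      (C 2 + X 0 * ((X 1 + C (3 / 2)) ^ 2 - C 3 - X 0 * X 1))
      (C (3 / 2) * (X 1 + C (1 / 2)) * X 0)
      (C 2 + X 0 * ((X 1 + C (3 / 2)) ^ 2 - C 3 - X 0 * X 1)) 2 4 z w
      (left_ne_zero_of_wedge hz) (right_ne_zero_of_wedge hz) (by simp) (by simp) ?_ ?_ ?_
    all_goals
      simp only [hg, map_add, map_sub, map_mul, map_pow, map_one, map_zero, map_div₀, evalAt_X_zero,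
        evalAt_X_one, evalAt_C, algebraMap_two, algebraMap_three, algebraMap_eight, min_succ_one, Nat.zero_min]
      ring

/-- The coordinates are `u = x - 1` and `v = y - 1`, and the common tangent direction is `v = 3u/2`.
-/
theorem isLogAt_tacnode {ω : Form2} {u v g : K2} (hw : wedge (d u) (d v) ≠ 0)
    (hω : ω = (3 / 2 * (v - u) / ((v - 3 / 2 * u) *
      (2 * (v - 3 / 2 * u) + v ^ 2 - 3 * u ^ 2 - u ^ 3))) • wedge (d u) (d v))
    (hg : g = (v - 3 / 2 * u) * (2 * (v - 3 / 2 * u) + v ^ 2 - 3 * u ^ 2 - u ^ 3)) :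
    IsLogAt ω u v g := by
  refine isLogAt_of_blowup hw hω ?_ ?_
  · rintro c w hw' rfl hω
    have hu := left_ne_zero_of_wedge hw'
    by_cases hc : c = 3 / 2
    · subst hc
      refine isLogAt_tacnode_first hw' ?_ ?_
      · rw [hω, ← mul_div_mul_left (3 / 2 * (w + 1 / 2)) _ (pow_ne_zero 2 hu), map_div₀,
          algebraMap_two, algebraMap_three]
        congr 2 <;> ring
      · rw [hg, map_div₀, algebraMap_two, algebraMap_three]
        ring
    · have hc' := sub_ne_zero.mpr hc
      refine isLogAt_of_monomial hw' hω
        ((X 1 + C c - C (3 / 2)) * (C 2 * (X 1 + C c - C (3 / 2)) +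
          X 0 * ((X 1 + C c) ^ 2 - C 3 - X 0)))
        (C (3 / 2) * (X 1 + C c - 1) * X 0)
        ((X 1 + C c - C (3 / 2)) * (C 2 * (X 1 + C c - C (3 / 2)) +
          X 0 * ((X 1 + C c) ^ 2 - C 3 - X 0)))
        2 0 1 u one_ne_zero hu (by simp [hc']) (by simp [hc']) ?_ ?_ ?_
      all_goals
        simp only [hg, map_add, map_sub, map_mul, map_pow, map_one, map_zero, map_div₀, evalAt_X_zero,
          evalAt_X_one, evalAt_C, algebraMap_two, algebraMap_three, algebraMap_eight, min_succ_one, Nat.zero_min]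
        ring
  · rintro w hw' rfl hω
    refine isLogAt_of_monomial hw' hω
      ((1 - C (3 / 2) * X 0) * (C 2 * (1 - C (3 / 2) * X 0) + X 1 - C 3 * X 0 ^ 2 * X 1 -
        X 0 ^ 3 * X 1 ^ 2))
      (C (3 / 2) * (1 - X 0) * X 1)
      ((1 - C (3 / 2) * X 0) * (C 2 * (1 - C (3 / 2) * X 0) + X 1 - C 3 * X 0 ^ 2 * X 1 -
        X 0 ^ 3 * X 1 ^ 2))
      0 2 1 v one_ne_zero (right_ne_zero_of_wedge hw') (by simp) (by simp) ?_ ?_ ?_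
    all_goals
      simp only [hg, map_add, map_sub, map_mul, map_pow, map_one, map_zero, map_div₀, evalAt_X_zero,
        evalAt_X_one, evalAt_C, algebraMap_two, algebraMap_three, algebraMap_eight, min_succ_one, Nat.zero_min]
      ring

end PosGeom

namespace PosGeom

/-! ### Local coordinates and dehomogenization -/

/-- The homogeneous coordinates of `p` normalized in the chart at `p`. -/
def normalizedRep (p : CP2) (j : Fin 3) : ℂ := p.rep j / p.rep (chart p)

theorem normalizedRep_chart (p : CP2) : normalizedRep p (chart p) = 1 :=
  div_self (chart_ne_zero p)

theorem eval_normalizedRep_eq_zero_iff (p : CP2) {n : ℕ} {Q : MvPolynomial (Fin 3) ℂ}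
    (hQ : Q.IsHomogeneous n) : MvPolynomial.eval (normalizedRep p) Q = 0 ↔ VanishesAt Q p := by
  have h : normalizedRep p = (p.rep (chart p))⁻¹ • p.rep := by
    funext j
    rw [normalizedRep, Pi.smul_apply, smul_eq_mul, div_eq_inv_mul]
  rw [h, eval_smul_of_isHomogeneous hQ, VanishesAt,
    mul_eq_zero_iff_left (pow_ne_zero _ (inv_ne_zero (chart_ne_zero p)))]

/-- The affine coordinates of the chart at `p`, in terms of the local coordinates at `p`. -/
def chartCoord (p : CP2) (j : Fin 3) : MvPolynomial (Fin 2) ℂ :=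
  (if j = chart p + 1 then MvPolynomial.X 0 else if j = chart p + 2 then MvPolynomial.X 1 else 0) +
    MvPolynomial.C (normalizedRep p j)

/-- The dehomogenization of a homogeneous polynomial in the local coordinates at `p`. -/
def dehomogenize (p : CP2) : MvPolynomial (Fin 3) ℂ →ₐ[ℂ] MvPolynomial (Fin 2) ℂ :=
  MvPolynomial.aeval (chartCoord p)

theorem evalAt_chartCoord (p : CP2) (j : Fin 3) :
    evalAt (uAt p) (vAt p) (chartCoord p j) = xi j / xi (chart p) := by
  have key : evalAt (uAt p) (vAt p) (if j = chart p + 1 then MvPolynomial.X 0 else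
      if j = chart p + 2 then MvPolynomial.X 1 else 0) = localCoord p j := by
    rcases eq_chart_or p j with h | h | h
    · have h1 : ∀ k : Fin 3, k ≠ k + 1 ∧ k ≠ k + 2 := by decide
      rw [if_neg (h ▸ (h1 _).1), if_neg (h ▸ (h1 _).2), map_zero, h, localCoord_chart]
    · rw [if_pos h, evalAt_X_zero, h, uAt]
    · have h1 : ∀ k : Fin 3, k + 2 ≠ k + 1 := by decide
      rw [if_neg (h ▸ h1 _), if_pos h, evalAt_X_one, h, vAt]
  rw [chartCoord, map_add, key, evalAt_C, localCoord, normalizedRep, sub_add_cancel]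

theorem aeval_div_of_isHomogeneous {σ K : Type*} [Fintype σ] [Field K] [Algebra ℂ K] {n : ℕ}
    {Q : MvPolynomial σ ℂ} (hQ : Q.IsHomogeneous n) {t : K} (ht : t ≠ 0) (w : σ → K) :
    MvPolynomial.aeval (fun j => w j / t) Q = MvPolynomial.aeval w Q / t ^ n := by
  rw [eq_div_iff (pow_ne_zero _ ht), MvPolynomial.aeval_def, MvPolynomial.aeval_def,
    MvPolynomial.eval₂_eq', MvPolynomial.eval₂_eq', Finset.sum_mul]
  refine Finset.sum_congr rfl fun m hm => ?_
  have h1 : ∑ i, m i = n := by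
    have := hQ (MvPolynomial.mem_support_iff.mp hm)
    rw [← this, Finsupp.weight_apply, Finsupp.sum_fintype _ _ (by simp)]
    simp
  rw [mul_assoc, ← h1, ← Finset.prod_pow_eq_pow_sum, ← Finset.prod_mul_distrib]
  congr 1
  refine Finset.prod_congr rfl fun i _ => ?_
  rw [← mul_pow, div_mul_cancel₀ _ ht]

theorem evalAt_dehomogenize (p : CP2) {n : ℕ} {Q : MvPolynomial (Fin 3) ℂ}
    (hQ : Q.IsHomogeneous n) : evalAt (uAt p) (vAt p) (dehomogenize p Q) =
      MvPolynomial.aeval xi Q / xi (chart p) ^ n := by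
  rw [dehomogenize, ← AlgHom.comp_apply, MvPolynomial.comp_aeval,
    ← aeval_div_of_isHomogeneous hQ (xi_ne_zero _)]
  congr 2
  funext j
  exact evalAt_chartCoord p j

theorem localEquation_eq (p : CP2) {n : ℕ} {Q : MvPolynomial (Fin 3) ℂ} (hQ : Q.IsHomogeneous n) :
    localEquation p n Q = evalAt (uAt p) (vAt p) (dehomogenize p Q) :=
  (evalAt_dehomogenize p hQ).symm

theorem constantCoeff_dehomogenize (p : CP2) (Q : MvPolynomial (Fin 3) ℂ) :
    MvPolynomial.constantCoeff (dehomogenize p Q) = MvPolynomial.eval (normalizedRep p) Q := by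
  induction Q using MvPolynomial.induction_on with
  | C a => simp [dehomogenize]
  | add P Q hP hQ => simp only [map_add, hP, hQ]
  | mul_X P j hP =>
    rw [map_mul, map_mul, hP, map_mul, MvPolynomial.eval_X]
    congr 1
    rw [dehomogenize, MvPolynomial.aeval_X, chartCoord]
    split_ifs <;> simp

theorem pderiv_dehomogenize (p : CP2) (i : Fin 2) (Q : MvPolynomial (Fin 3) ℂ) :
    MvPolynomial.pderiv i (dehomogenize p Q) =
      dehomogenize p (MvPolynomial.pderiv (![chart p + 1, chart p + 2] i) Q) := by
  have h1 : ∀ k : Fin 3, k + 2 ≠ k + 1 := by decide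
  induction Q using MvPolynomial.induction_on with
  | C a => simp [dehomogenize]
  | add P Q hP hQ => simp only [map_add, hP, hQ]
  | mul_X P j hP =>
    rw [map_mul, Derivation.leibniz, Derivation.leibniz, hP, map_add]
    simp only [smul_eq_mul, map_mul]
    congr 2
    rw [dehomogenize, MvPolynomial.aeval_X, chartCoord, map_add, MvPolynomial.pderiv_C, add_zero,
      MvPolynomial.pderiv_X, Pi.single_apply]
    fin_cases i
    · by_cases h : j = chart p + 1
      · simp [h]
      · by_cases h' : j = chart p + 2 <;> simp [h, h']
    · by_cases h : j = chart p + 1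
      · simp [h, (h1 _).symm]
      · by_cases h' : j = chart p + 2 <;> simp [h, h', h1]

theorem chart_eq_two_iff (p : CP2) : chart p = 2 ↔ p.rep 2 ≠ 0 := by
  rw [chart]
  split_ifs <;> simp [*]

/-- The exponent `3` expresses that the canonical bundle of the plane is `O(-3)`. The sign is `+1`
in all charts because local coordinates are taken in cyclic order. -/
theorem wedge_dx_dy_eq (p : CP2) : wedge (d xCoord) (d yCoord) =
    xi (chart p) ^ 3 • wedge (d (uAt p)) (d (vAt p)) := by
  have hx : xCoord ≠ 0 := xi_ne_zero 0
  have hy : yCoord ≠ 0 := xi_ne_zero 1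
  rw [uAt, vAt, localCoord, localCoord, d_sub, d_sub, d_algebraMap, d_algebraMap, sub_zero,
    sub_zero]
  generalize chart p = k
  have e0 : xi 0 = xCoord := rfl
  have e1 : xi 1 = yCoord := rfl
  have e2 : xi 2 = 1 := rfl
  have h : ∀ a b c e : K2, a * e - b * c = 1 → wedge (d xCoord) (d yCoord) =
      wedge (a • d xCoord + b • d yCoord) (c • d xCoord + e • d yCoord) := by
    intro a b c e h
    rw [wedge_combination, h, one_smul]
  have h' : ∀ (t a b c e : K2), t * (a * e - b * c) = 1 → wedge (d xCoord) (d yCoord) =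
      t • wedge (a • d xCoord + b • d yCoord) (c • d xCoord + e • d yCoord) := by
    intro t a b c e h
    rw [wedge_combination, smul_smul, h, one_smul]
  fin_cases k
  · change _ = xi 0 ^ 3 • wedge (d (xi 1 / xi 0)) (d (xi 2 / xi 0))
    rw [e0, e1, e2, d_div, d_div, d_one, smul_zero, zero_sub,
      h' (xCoord ^ 3) (-(xCoord⁻¹ ^ 2 * yCoord)) (xCoord⁻¹ ^ 2 * xCoord) (-(xCoord⁻¹ ^ 2)) 0
      (by field_simp; ring)]
    congr 2 <;> simp only [smul_sub, smul_neg, smul_smul, one_smul, neg_smul, zero_smul, add_zero]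
    abel
  · change _ = xi 1 ^ 3 • wedge (d (xi 2 / xi 1)) (d (xi 0 / xi 1))
    rw [e0, e1, e2, d_div, d_div, d_one, smul_zero, zero_sub,
      h' (yCoord ^ 3) 0 (-(yCoord⁻¹ ^ 2)) (yCoord⁻¹ ^ 2 * yCoord) (-(yCoord⁻¹ ^ 2 * xCoord))
      (by field_simp; ring)]
    congr 2 <;> simp only [smul_sub, smul_neg, smul_smul, one_smul, neg_smul, zero_smul, zero_add]
    abel
  · change _ = xi 2 ^ 3 • wedge (d (xi 0 / xi 2)) (d (xi 1 / xi 2))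
    rw [e0, e1, e2, div_one, div_one, one_pow, one_smul]

theorem wedge_uAt_vAt_ne_zero (p : CP2) : wedge (d (uAt p)) (d (vAt p)) ≠ 0 := by
  intro h
  apply wedge_dx_dy_ne_zero
  rw [wedge_dx_dy_eq p, h, smul_zero]

/-- The numerator of the canonical form. -/
def numeratorForm : MvPolynomial (Fin 3) ℂ :=
  MvPolynomial.C (3 / 2) * (MvPolynomial.X 1 - MvPolynomial.X 0)

theorem isHomogeneous_numeratorForm : numeratorForm.IsHomogeneous 1 := by
  rw [numeratorForm, mul_sub]
  exact (MvPolynomial.isHomogeneous_C_mul_X _ _).sub (MvPolynomial.isHomogeneous_C_mul_X _ _)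

theorem algebraMap_div_two (c : ℂ) : algebraMap ℂ K2 (c / 2) = algebraMap ℂ K2 c / 2 := by
  rw [map_div₀, algebraMap_two]

theorem aeval_xi_numeratorForm : MvPolynomial.aeval xi numeratorForm =
    3 / 2 * (yCoord - xCoord) := by
  simp only [numeratorForm, map_mul, map_sub, MvPolynomial.aeval_X, MvPolynomial.aeval_C,
    algebraMap_div_two, algebraMap_three]
  rfl

theorem aeval_xi_lineForm : MvPolynomial.aeval xi lineForm =
    yCoord - 3 / 2 * xCoord + 1 / 2 := by
  simp only [lineForm, map_mul, map_sub, map_add, MvPolynomial.aeval_X, MvPolynomial.aeval_C,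
    algebraMap_div_two, algebraMap_three, map_one]
  exact congrArg _ (mul_one (1 / 2 : K2))

theorem aeval_xi_cubicForm : MvPolynomial.aeval xi cubicForm = yCoord ^ 2 - xCoord ^ 3 := by
  simp only [cubicForm, map_mul, map_sub, map_pow, MvPolynomial.aeval_X]
  exact congrArg (· - xCoord ^ 3) (mul_one (yCoord ^ 2))

theorem omegaII_eq_aeval : omegaII = (MvPolynomial.aeval xi numeratorForm /
    (MvPolynomial.aeval xi lineForm * MvPolynomial.aeval xi cubicForm)) •
      wedge (d xCoord) (d yCoord) := by
  rw [aeval_xi_numeratorForm, aeval_xi_lineForm, aeval_xi_cubicForm, omegaII, mul_div_assoc]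

/-- The degrees `1 - 4 + 3 = 0` balance, so the powers of `xi (chart p)` cancel and the same formula
holds at infinity. -/
theorem omegaII_eq (p : CP2) : omegaII =
    (evalAt (uAt p) (vAt p) (dehomogenize p numeratorForm) /
      (evalAt (uAt p) (vAt p) (dehomogenize p lineForm) *
        evalAt (uAt p) (vAt p) (dehomogenize p cubicForm))) • wedge (d (uAt p)) (d (vAt p)) := by
  have h := xi_ne_zero (chart p)
  have h1 := aeval_xi_ne_zero isHomogeneous_lineForm irreducible_lineForm.ne_zero
  have h2 := aeval_xi_ne_zero isHomogeneous_cubicForm irreducible_cubicForm.ne_zero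
  rw [omegaII_eq_aeval, wedge_dx_dy_eq p, smul_smul, evalAt_dehomogenize p isHomogeneous_numeratorForm,
    evalAt_dehomogenize p isHomogeneous_lineForm, evalAt_dehomogenize p isHomogeneous_cubicForm]
  congr 1
  field_simp

end PosGeom

namespace PosGeom

/-! ### The poles of the canonical form -/

theorem pderiv_lineForm (j : Fin 3) : MvPolynomial.pderiv j lineForm =
    MvPolynomial.C (![-(3 / 2), 1, 1 / 2] j) := by
  fin_cases j <;> simp [lineForm, MvPolynomial.pderiv_X]

theorem pderiv_cubicForm (j : Fin 3) : MvPolynomial.pderiv j cubicForm =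
    ![-(3 * MvPolynomial.X 0 ^ 2), 2 * MvPolynomial.X 1 * MvPolynomial.X 2,
      MvPolynomial.X 1 ^ 2] j := by
  fin_cases j <;> simp [cubicForm, MvPolynomial.pderiv_X]; ring

theorem pderiv_numeratorForm (j : Fin 3) : MvPolynomial.pderiv j numeratorForm =
    MvPolynomial.C (![-(3 / 2), 3 / 2, 0] j) := by
  fin_cases j <;> simp [numeratorForm, MvPolynomial.pderiv_X]

theorem eval_lineForm (a : Fin 3 → ℂ) :
    MvPolynomial.eval a lineForm = a 1 - 3 / 2 * a 0 + 1 / 2 * a 2 := by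
  simp [lineForm]

theorem eval_cubicForm (a : Fin 3 → ℂ) :
    MvPolynomial.eval a cubicForm = a 1 ^ 2 * a 2 - a 0 ^ 3 := by
  simp [cubicForm]

theorem eval_numeratorForm (a : Fin 3 → ℂ) :
    MvPolynomial.eval a numeratorForm = 3 / 2 * (a 1 - a 0) := by
  simp [numeratorForm]

theorem constantCoeff_pderiv_dehomogenize (p : CP2) (i : Fin 2) (Q : MvPolynomial (Fin 3) ℂ) :
    MvPolynomial.constantCoeff (MvPolynomial.pderiv i (dehomogenize p Q)) =
      MvPolynomial.eval (normalizedRep p)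
        (MvPolynomial.pderiv (![chart p + 1, chart p + 2] i) Q) := by
  rw [pderiv_dehomogenize, constantCoeff_dehomogenize]

theorem normalizedRep_two_of_chart {p : CP2} (h : chart p = 2) : normalizedRep p 2 = 1 := by
  simpa [h] using normalizedRep_chart p

theorem chart_eq_two_or (p : CP2) : chart p = 2 ∨ normalizedRep p 2 = 0 := by
  by_cases h : p.rep 2 = 0
  · exact Or.inr (by rw [normalizedRep, h, zero_div])
  · exact Or.inl ((chart_eq_two_iff p).mpr h)

/-- By the jacobian criterion, checked in each chart, the cusp is the only singular point of the
cubic. -/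
theorem normalizedRep_of_singular {p : CP2} (h : VanishesAt cubicForm p)
    (h' : ∀ i, MvPolynomial.constantCoeff (MvPolynomial.pderiv i (dehomogenize p cubicForm)) = 0) :
    chart p = 2 ∧ normalizedRep p 0 = 0 ∧ normalizedRep p 1 = 0 := by
  rw [← eval_normalizedRep_eq_zero_iff p isHomogeneous_cubicForm, eval_cubicForm] at h
  simp only [constantCoeff_pderiv_dehomogenize, pderiv_cubicForm] at h'
  have h0 := h' 0
  have h1 := h' 1
  have h2 := normalizedRep_chart p
  clear h'
  generalize normalizedRep p = a at *
  generalize chart p = k at *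
  fin_cases k
  · simp_all
  · simp_all
  · simp_all

/-- Eliminating `y` leaves `(x - 1)² (x - 1/4) = 0`, and there is no common point at infinity. -/
theorem normalizedRep_of_mem_inter {p : CP2} (h : VanishesAt lineForm p)
    (h' : VanishesAt cubicForm p) : chart p = 2 ∧
      (normalizedRep p 0 = 1 ∧ normalizedRep p 1 = 1 ∨
        normalizedRep p 0 = 1 / 4 ∧ normalizedRep p 1 = -1 / 8) := by
  rw [← eval_normalizedRep_eq_zero_iff p isHomogeneous_cubicForm, eval_cubicForm] at h'
  rw [← eval_normalizedRep_eq_zero_iff p isHomogeneous_lineForm, eval_lineForm] at h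
  rcases chart_eq_two_or p with h2 | h2
  · refine ⟨h2, ?_⟩
    rw [normalizedRep_two_of_chart h2] at h h'
    have h1 : normalizedRep p 1 = 3 / 2 * normalizedRep p 0 - 1 / 2 := by linear_combination h
    have h3 : (normalizedRep p 0 - 1) ^ 2 * (normalizedRep p 0 - 1 / 4) = 0 := by
      rw [h1] at h'
      linear_combination -h'
    rcases mul_eq_zero.mp h3 with h4 | h4
    · have h5 := sub_eq_zero.mp (pow_eq_zero_iff two_ne_zero |>.mp h4)
      refine Or.inl ⟨h5, ?_⟩
      rw [h1, h5]
      norm_num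
    · have h5 := sub_eq_zero.mp h4
      refine Or.inr ⟨h5, ?_⟩
      rw [h1, h5]
      norm_num
  · exfalso
    rw [h2] at h h'
    have h0 : normalizedRep p 0 = 0 := by simpa using h'
    have h1 : normalizedRep p 1 = 0 := by simpa [h0] using h
    have h3 := normalizedRep_chart p
    generalize chart p = k at h3
    fin_cases k <;> simp_all

theorem uAt_of_chart {p : CP2} (h : chart p = 2) :
    uAt p = xCoord - algebraMap ℂ K2 (normalizedRep p 0) := by
  rw [uAt, localCoord, normalizedRep, h]
  exact congrArg (· - _) (div_one xCoord)

theorem vAt_of_chart {p : CP2} (h : chart p = 2) :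
    vAt p = yCoord - algebraMap ℂ K2 (normalizedRep p 1) := by
  rw [vAt, localCoord, normalizedRep, h]
  exact congrArg (· - _) (div_one yCoord)

theorem wedge_d_uAt_d_vAt_of_chart {p : CP2} (h : chart p = 2) :
    wedge (d (uAt p)) (d (vAt p)) = wedge (d xCoord) (d yCoord) := by
  rw [uAt_of_chart h, vAt_of_chart h, d_sub, d_sub, d_algebraMap, d_algebraMap, sub_zero, sub_zero]

theorem localEquation_of_chart {p : CP2} (h : chart p = 2) (n : ℕ) (Q : MvPolynomial (Fin 3) ℂ) :
    localEquation p n Q = MvPolynomial.aeval xi Q := by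
  rw [localEquation, h, show xi 2 = 1 from rfl, one_pow, div_one]

theorem isLogAt_omegaII_of_singular {p : CP2} (h : chart p = 2) (h0 : normalizedRep p 0 = 0)
    (h1 : normalizedRep p 1 = 0) :
    IsLogAt omegaII (uAt p) (vAt p) (localEquation p 4 (lineForm * cubicForm)) := by
  have hw := wedge_uAt_vAt_ne_zero p
  have hd := wedge_d_uAt_d_vAt_of_chart h
  refine isLogAt_cusp hw ?_ ?_
  · rw [hd, uAt_of_chart h, vAt_of_chart h, h0, h1, map_zero, sub_zero, sub_zero, omegaII,
      mul_div_assoc]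
  · rw [localEquation_of_chart h, map_mul, aeval_xi_lineForm, aeval_xi_cubicForm, uAt_of_chart h,
      vAt_of_chart h, h0, h1, map_zero, sub_zero, sub_zero]

theorem isLogAt_omegaII_of_tangent {p : CP2} (h : chart p = 2) (h0 : normalizedRep p 0 = 1)
    (h1 : normalizedRep p 1 = 1) :
    IsLogAt omegaII (uAt p) (vAt p) (localEquation p 4 (lineForm * cubicForm)) := by
  have hw := wedge_uAt_vAt_ne_zero p
  have hd := wedge_d_uAt_d_vAt_of_chart h
  refine isLogAt_tacnode hw ?_ ?_
  · rw [hd, uAt_of_chart h, vAt_of_chart h, h0, h1, map_one, omegaII, ← mul_div_assoc]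
    congr 3 <;> ring
  · rw [localEquation_of_chart h, map_mul, aeval_xi_lineForm, aeval_xi_cubicForm, uAt_of_chart h,
      vAt_of_chart h, h0, h1, map_one]
    ring

/-- Away from the cusp and the tangency the divisor already has normal crossings: it is empty, one
smooth branch, or two transversal branches at `(1/4, -1/8)`. -/
theorem isLogAt_omegaII (p : CP2) :
    IsLogAt omegaII (uAt p) (vAt p) (localEquation p 4 (lineForm * cubicForm)) := by
  have hw := wedge_uAt_vAt_ne_zero p
  have hg := localEquation_eq p isHomogeneous_lineForm_mul_cubicForm
  rw [map_mul, map_mul] at hg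
  have hL := constantCoeff_dehomogenize p lineForm
  have hC := constantCoeff_dehomogenize p cubicForm
  have eL := eval_normalizedRep_eq_zero_iff p isHomogeneous_lineForm
  have eC := eval_normalizedRep_eq_zero_iff p isHomogeneous_cubicForm
  by_cases h1 : VanishesAt lineForm p <;> by_cases h2 : VanishesAt cubicForm p
  · obtain ⟨hc, ⟨h3, h4⟩ | ⟨h3, h4⟩⟩ := normalizedRep_of_mem_inter h1 h2
    · exact isLogAt_omegaII_of_tangent hc h3 h4
    refine isLogAt_of_jacobian hw (omegaII_eq p) (dehomogenize p lineForm)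
      (dehomogenize p cubicForm) 1 (dehomogenize p numeratorForm) 1 1 1 1 1 one_ne_zero one_ne_zero
      (hL.trans (eL.mpr h1)) (hC.trans (eC.mpr h2)) ?_ (by simp) (by simp) (by simp [hg]) (by simp)
      (by simp)
    rw [jacobian, map_sub, map_mul, map_mul]
    simp only [constantCoeff_pderiv_dehomogenize, pderiv_lineForm, pderiv_cubicForm, hc]
    have h5 := normalizedRep_two_of_chart hc
    change MvPolynomial.eval _ (MvPolynomial.C (-(3 / 2))) *
      MvPolynomial.eval _ (2 * MvPolynomial.X 1 * MvPolynomial.X 2) -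
      MvPolynomial.eval _ (MvPolynomial.C 1) *
      MvPolynomial.eval _ (-(3 * MvPolynomial.X 0 ^ 2)) ≠ 0
    simp [h3, h4, h5]
    norm_num
  · have h3 := mt (hC.symm.trans ·) (mt eC.mp h2)
    refine isLogAt_of_jacobian hw (omegaII_eq p) (dehomogenize p lineForm)
      (MvPolynomial.X 1) (dehomogenize p cubicForm) (dehomogenize p numeratorForm)
      (dehomogenize p cubicForm) 1 0 1 1 one_ne_zero one_ne_zero (hL.trans (eL.mpr h1)) (by simp)
      ?_ h3 h3 (by rw [hg]; ring) (by simp) (by simp [mul_comm])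
    -- All three partial derivatives of the linear form are nonzero constants, so `X 1` completes it
    -- to parameters in every chart.
    rw [jacobian, map_sub, map_mul, map_mul]
    simp only [constantCoeff_pderiv_dehomogenize, pderiv_lineForm]
    simp only [MvPolynomial.pderiv_X_self, MvPolynomial.pderiv_X_of_ne (one_ne_zero : (1 : Fin 2) ≠ 0)]
    generalize chart p = k
    fin_cases k <;> simp
  · have h3 := mt (hL.symm.trans ·) (mt eL.mp h1)
    by_cases h4 : MvPolynomial.constantCoeff
        (MvPolynomial.pderiv 0 (dehomogenize p cubicForm)) = 0
    · by_cases h5 : MvPolynomial.constantCoeff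
          (MvPolynomial.pderiv 1 (dehomogenize p cubicForm)) = 0
      · obtain ⟨hc, h6, h7⟩ := normalizedRep_of_singular h2 (by
          intro i
          fin_cases i
          exacts [h4, h5])
        exact isLogAt_omegaII_of_singular hc h6 h7
      · exact isLogAt_of_jacobian hw (omegaII_eq p) (dehomogenize p cubicForm)
          (MvPolynomial.X 0) (dehomogenize p lineForm) (dehomogenize p numeratorForm)
          (dehomogenize p lineForm) 1 0 1 1 one_ne_zero one_ne_zero (hC.trans (eC.mpr h2)) (by simp)
          (by simpa [jacobian, MvPolynomial.pderiv_X] using h5) h3 h3 (by simp [hg]) (by simp)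
          (by simp)
    · exact isLogAt_of_jacobian hw (omegaII_eq p) (dehomogenize p cubicForm)
        (MvPolynomial.X 1) (dehomogenize p lineForm) (dehomogenize p numeratorForm)
        (dehomogenize p lineForm) 1 0 1 1 one_ne_zero one_ne_zero (hC.trans (eC.mpr h2)) (by simp)
        (by simpa [jacobian, MvPolynomial.pderiv_X] using h4) h3 h3 (by simp [hg]) (by simp)
        (by simp)
  · have h3 := mt (hL.symm.trans ·) (mt eL.mp h1)
    have h4 := mt (hC.symm.trans ·) (mt eC.mp h2)
    have h5 : MvPolynomial.constantCoeff (dehomogenize p lineForm * dehomogenize p cubicForm) ≠ 0 := by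
      rw [map_mul]
      exact mul_ne_zero h3 h4
    exact isLogAt_of_monomial hw (omegaII_eq p) (dehomogenize p lineForm * dehomogenize p cubicForm)
      (dehomogenize p numeratorForm) (dehomogenize p lineForm * dehomogenize p cubicForm) 0 0 1 1
      one_ne_zero one_ne_zero h5 h5 (by simp [hg]) (by simp) (by simp)

theorem hasSimplePoleAt_omegaII (p : CP2) :
    HasSimplePoleAt omegaII (uAt p) (vAt p) (localEquation p 4 (lineForm * cubicForm)) := by
  refine ⟨_, ⟨_, hasValue_evalAt _ _ (dehomogenize p numeratorForm)⟩, ?_⟩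
  have h := aeval_xi_ne_zero isHomogeneous_lineForm_mul_cubicForm
    (mul_ne_zero irreducible_lineForm.ne_zero irreducible_cubicForm.ne_zero)
  have h' : localEquation p 4 (lineForm * cubicForm) ≠ 0 :=
    div_ne_zero h (pow_ne_zero _ (xi_ne_zero _))
  rw [localEquation_eq p isHomogeneous_lineForm_mul_cubicForm, map_mul, map_mul] at h' ⊢
  rw [omegaII_eq p, smul_smul, mul_div_cancel₀ _ h']

/-- Holomorphy would make the denominator divide the numerator locally, so `y = x` at `p`. On the
union this leaves the cusp and the tangency, where the denominator has multiplicity at least two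
while the numerator has a nonzero derivative. -/
theorem not_isHolomorphicAt_omegaII {p : CP2} (hp : VanishesAt (lineForm * cubicForm) p) :
    ¬ IsHolomorphicAt omegaII (uAt p) (vAt p) := by
  rintro ⟨_, ⟨_, P, Q, hQ, rfl, -⟩, hω⟩
  have hw := wedge_uAt_vAt_ne_zero p
  have h := aeval_xi_ne_zero isHomogeneous_lineForm_mul_cubicForm
    (mul_ne_zero irreducible_lineForm.ne_zero irreducible_cubicForm.ne_zero)
  have h' : localEquation p 4 (lineForm * cubicForm) ≠ 0 :=
    div_ne_zero h (pow_ne_zero _ (xi_ne_zero _))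
  rw [localEquation_eq p isHomogeneous_lineForm_mul_cubicForm] at h'
  have key : dehomogenize p numeratorForm * Q = P * dehomogenize p (lineForm * cubicForm) := by
    apply mvAeval_injective hw
    rw [omegaII_eq p] at hω
    have h1 := smul_wedge_injective hw hω
    change _ = evalAt _ _ P / evalAt _ _ Q at h1
    rw [← map_mul, ← map_mul, div_eq_div_iff h' (evalAt_ne_zero hw hQ)] at h1
    rw [map_mul, map_mul]
    exact h1
  have e0 := congrArg MvPolynomial.constantCoeff key
  have h0 := (eval_normalizedRep_eq_zero_iff p isHomogeneous_lineForm_mul_cubicForm).mpr hp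
  rw [map_mul, map_mul, constantCoeff_dehomogenize, constantCoeff_dehomogenize, h0, mul_zero,
    mul_eq_zero_iff_right hQ, eval_numeratorForm] at e0
  have e1 : normalizedRep p 1 = normalizedRep p 0 := by linear_combination 2 / 3 * e0
  have e2 : chart p = 2 := by
    refine (chart_eq_two_or p).resolve_right fun h2 => ?_
    rw [map_mul, eval_lineForm, eval_cubicForm, h2, e1] at h0
    have h3 : normalizedRep p 0 = 0 := by
      rw [← pow_eq_zero_iff (four_ne_zero)]
      linear_combination 2 * h0
    have h4 := normalizedRep_chart p
    generalize chart p = k at h4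
    fin_cases k <;> simp_all
  have e3 := normalizedRep_two_of_chart e2
  have e4 : normalizedRep p 0 = 0 ∨ normalizedRep p 0 = 1 := by
    rw [map_mul, eval_lineForm, eval_cubicForm, e3, e1] at h0
    have h3 : normalizedRep p 0 ^ 2 * (normalizedRep p 0 - 1) ^ 2 = 0 := by
      linear_combination 2 * h0
    rcases mul_eq_zero.mp h3 with h4 | h4
    · exact Or.inl ((pow_eq_zero_iff two_ne_zero).mp h4)
    · exact Or.inr (sub_eq_zero.mp ((pow_eq_zero_iff two_ne_zero).mp h4))
  -- At the two remaining points the right side has zero first derivative, whereas the left side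
  -- gives `-3/2` times the nonzero constant coefficient of `Q`.
  have e5 := congrArg (fun R => MvPolynomial.constantCoeff (MvPolynomial.pderiv 0 R)) key
  simp only [Derivation.leibniz, smul_eq_mul, map_add, map_mul, constantCoeff_pderiv_dehomogenize,
    constantCoeff_dehomogenize, eval_numeratorForm, pderiv_numeratorForm, pderiv_lineForm,
    pderiv_cubicForm, eval_lineForm, eval_cubicForm, e1, e2, e3] at e5
  rcases e4 with h4 | h4 <;> simp [h4] at e5
  · exact hQ e5
  · exact hQ (by linear_combination 2 / 3 * e5)

theorem hasLogPolesPrecisely_omegaII :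
    HasLogPolesPrecisely omegaII (zeroLocus (lineForm * cubicForm)) :=
  ⟨4, lineForm * cubicForm, isHomogeneous_lineForm_mul_cubicForm, squarefree_lineForm_mul_cubicForm,
    rfl, fun p => ⟨hasSimplePoleAt_omegaII p, isLogAt_omegaII p, not_isHolomorphicAt_omegaII⟩⟩

end PosGeom

namespace PosGeom

/-- Used with `x, y` the differentials of the coordinates on a curve: the relation `p dx + q dy = 0`
eliminates `dy`. -/
theorem smul_combination_eq {R M : Type*} [CommRing R] [AddCommGroup M] [Module R M] {p q : R}
    {x y : M} (h : p • x + q • y = 0) (a b : R) :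
    q • (a • x + b • y) = -(p * b - q * a) • x := by
  have h1 : q • y = -(p • x) := eq_neg_of_add_eq_zero_right h
  rw [smul_add, smul_comm q b y, h1]
  module

namespace PlaneCurve

/-! ### Residues along a plane curve -/

section Residue

variable {D : PlaneCurve} (h2 : ¬ D.F ∣ MvPolynomial.X 2)
include h2

theorem isUnit_aeval_affineCoord {n : ℕ} {Q : MvPolynomial (Fin 3) ℂ} (hQ : Q.IsHomogeneous n)
    (hd : ¬ D.F ∣ Q) : IsUnit (MvPolynomial.aeval (D.affineCoord h2) Q) :=
  (IsLocalRing.residue_ne_zero_iff_isUnit _).mp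
    (mt (D.residue_aeval_affineCoord_eq_zero_iff h2 hQ).mp hd)

theorem exists_mul_aeval_affineCoord (f : D.localRing) :
    ∃ (n : ℕ) (P Q : MvPolynomial (Fin 3) ℂ), P.IsHomogeneous n ∧ Q.IsHomogeneous n ∧ ¬ D.F ∣ Q ∧
      f * MvPolynomial.aeval (D.affineCoord h2) Q = MvPolynomial.aeval (D.affineCoord h2) P := by
  obtain ⟨n, P, Q, hP, hQ, hd, hf⟩ := f.2
  refine ⟨n, P, Q, hP, hQ, hd, Subtype.ext ?_⟩
  change (f : K2) * ((MvPolynomial.aeval (D.affineCoord h2) Q : D.localRing) : K2) = _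
  rw [coe_aeval_affineCoord, coe_aeval_affineCoord, hf, div_mul_cancel₀ _ (D.aeval_ne_zero hQ hd)]

/-- A nonunit has a numerator divisible by the equation of the curve, and its denominator is a unit.
Hence the dehomogenized equation is a local equation. -/
theorem maximalIdeal_eq_span {P : MvPolynomial (Fin 3) ℂ} (hP : Associated D.F P) :
    IsLocalRing.maximalIdeal D.localRing =
      Ideal.span {MvPolynomial.aeval (D.affineCoord h2) P} := by
  obtain ⟨u, hu⟩ := hP
  have hF := (D.residue_aeval_affineCoord_eq_zero_iff h2 D.homogeneous).mpr dvd_rfl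
  apply le_antisymm
  · intro f hf
    obtain ⟨n, A, B, hA, hB, hd, hAB⟩ := exists_mul_aeval_affineCoord h2 f
    have hdA : D.F ∣ A := by
      rw [← D.residue_aeval_affineCoord_eq_zero_iff h2 hA, ← hAB, map_mul,
        (IsLocalRing.residue_eq_zero_iff _).mpr hf, zero_mul]
    have hdP : P ∣ A := (Associated.dvd ⟨u⁻¹, by rw [← hu]; simp⟩).trans hdA
    rw [Ideal.mem_span_singleton, ← (isUnit_aeval_affineCoord h2 hB hd).dvd_mul_right, hAB]
    exact map_dvd _ hdP
  · rw [Ideal.span_singleton_le_iff_mem, ← IsLocalRing.residue_eq_zero_iff, ← hu, map_mul, map_mul,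
      hF, zero_mul]

theorem affineCoord_two : D.affineCoord h2 2 = 1 :=
  Subtype.ext (by rw [coe_affineCoord]; rfl)

theorem D_aeval_affineCoord (P : MvPolynomial (Fin 3) ℂ) :
    KaehlerDifferential.D ℂ D.localRing (MvPolynomial.aeval (D.affineCoord h2) P) =
      MvPolynomial.aeval (D.affineCoord h2) (MvPolynomial.pderiv 0 P) •
        KaehlerDifferential.D ℂ D.localRing (D.affineCoord h2 0) +
      MvPolynomial.aeval (D.affineCoord h2) (MvPolynomial.pderiv 1 P) •
        KaehlerDifferential.D ℂ D.localRing (D.affineCoord h2 1) := by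
  rw [derivation_mvAeval, Fin.sum_univ_three, affineCoord_two, Derivation.map_one_eq_zero,
    smul_zero, add_zero]

theorem exists_eq_combination_D (η : Ω[D.localRing⁄ℂ]) : ∃ a b : D.localRing,
    η = a • KaehlerDifferential.D ℂ D.localRing (D.affineCoord h2 0) +
      b • KaehlerDifferential.D ℂ D.localRing (D.affineCoord h2 1) := by
  have h : (⊤ : Submodule D.localRing Ω[D.localRing⁄ℂ]) ≤ Submodule.span D.localRing
      {KaehlerDifferential.D ℂ D.localRing (D.affineCoord h2 0),
        KaehlerDifferential.D ℂ D.localRing (D.affineCoord h2 1)} := by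
    rw [← KaehlerDifferential.span_range_derivation, Submodule.span_le]
    rintro _ ⟨f, rfl⟩
    obtain ⟨n, P, Q, hP, hQ, hd, hPQ⟩ := exists_mul_aeval_affineCoord h2 f
    obtain ⟨w, hw⟩ := (isUnit_aeval_affineCoord h2 hQ hd).exists_left_inv
    have h1 := congrArg (KaehlerDifferential.D ℂ D.localRing) hPQ
    rw [Derivation.leibniz] at h1
    have h3 : KaehlerDifferential.D ℂ D.localRing f = w •
        (KaehlerDifferential.D ℂ D.localRing (MvPolynomial.aeval (D.affineCoord h2) P) -
          f • KaehlerDifferential.D ℂ D.localRing (MvPolynomial.aeval (D.affineCoord h2) Q)) := by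
      rw [← h1, add_sub_cancel_left, smul_smul, hw, one_smul]
    rw [h3, D_aeval_affineCoord, D_aeval_affineCoord]
    exact Submodule.smul_mem _ _ (Submodule.sub_mem _ (Submodule.mem_span_pair.mpr ⟨_, _, rfl⟩)
      (Submodule.smul_mem _ _ (Submodule.mem_span_pair.mpr ⟨_, _, rfl⟩)))
  obtain ⟨a, b, hab⟩ := Submodule.mem_span_pair.mp (h (Submodule.mem_top (x := η)))
  exact ⟨a, b, hab.symm⟩

theorem map_combination_D (a b : D.localRing) : KaehlerDifferential.map ℂ ℂ D.localRing K2
    (a • KaehlerDifferential.D ℂ D.localRing (D.affineCoord h2 0) +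
      b • KaehlerDifferential.D ℂ D.localRing (D.affineCoord h2 1)) =
    (a : K2) • d xCoord + (b : K2) • d yCoord := by
  rw [map_add, map_smul, map_smul, KaehlerDifferential.map_D, KaehlerDifferential.map_D,
    ← algebraMap_smul K2 a, ← algebraMap_smul K2 b]
  congr 2
  · exact congrArg d (coe_affineCoord D h2 0)
  · exact congrArg d (coe_affineCoord D h2 1)

set_option synthInstance.maxHeartbeats 400000 in
theorem map_combination_D_functionField (a b : D.localRing) :
    KaehlerDifferential.map ℂ ℂ D.localRing D.FunctionField
      (a • KaehlerDifferential.D ℂ D.localRing (D.affineCoord h2 0) +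
        b • KaehlerDifferential.D ℂ D.localRing (D.affineCoord h2 1)) =
    IsLocalRing.residue D.localRing a • KaehlerDifferential.D ℂ D.FunctionField
        (IsLocalRing.residue D.localRing (D.affineCoord h2 0)) +
      IsLocalRing.residue D.localRing b • KaehlerDifferential.D ℂ D.FunctionField
        (IsLocalRing.residue D.localRing (D.affineCoord h2 1)) := by
  rw [map_add, map_smul, map_smul, KaehlerDifferential.map_D, KaehlerDifferential.map_D]
  rfl

theorem exists_d_eq (f : D.localRing) :
    ∃ a b : D.localRing, d (f : K2) = (a : K2) • d xCoord + (b : K2) • d yCoord := by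
  obtain ⟨a, b, hab⟩ := exists_eq_combination_D h2 (KaehlerDifferential.D ℂ D.localRing f)
  refine ⟨a, b, ?_⟩
  rw [← map_combination_D h2, ← hab, KaehlerDifferential.map_D]
  rfl

theorem exists_eq_smul_of_mem_holomorphicForms {ω : Form2} (hω : ω ∈ D.holomorphicForms) :
    ∃ r : D.localRing, ω = (r : K2) • wedge (d xCoord) (d yCoord) := by
  have h : D.holomorphicForms ≤ Submodule.span D.localRing {wedge (d xCoord) (d yCoord)} := by
    rw [holomorphicForms, Submodule.span_le]
    rintro _ ⟨f, g, rfl⟩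
    obtain ⟨a, b, hf⟩ := exists_d_eq h2 f
    obtain ⟨a', b', hg⟩ := exists_d_eq h2 g
    rw [hf, hg, wedge_combination]
    exact Submodule.mem_span_singleton.mpr ⟨a * b' - b * a', rfl⟩
  obtain ⟨r, hr⟩ := Submodule.mem_span_singleton.mp (h hω)
  exact ⟨r, hr.symm⟩

variable {P : MvPolynomial (Fin 3) ℂ} (hP : Associated D.F P)
include hP

theorem residue_equation_eq_zero :
    IsLocalRing.residue D.localRing (MvPolynomial.aeval (D.affineCoord h2) P) = 0 := by
  rw [IsLocalRing.residue_eq_zero_iff, maximalIdeal_eq_span h2 hP]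
  exact Ideal.mem_span_singleton_self _

theorem residue_D_equation :
    IsLocalRing.residue D.localRing (MvPolynomial.aeval (D.affineCoord h2)
      (MvPolynomial.pderiv 0 P)) • KaehlerDifferential.D ℂ D.FunctionField
        (IsLocalRing.residue D.localRing (D.affineCoord h2 0)) +
    IsLocalRing.residue D.localRing (MvPolynomial.aeval (D.affineCoord h2)
      (MvPolynomial.pderiv 1 P)) • KaehlerDifferential.D ℂ D.FunctionField
        (IsLocalRing.residue D.localRing (D.affineCoord h2 1)) = 0 := by
  have h := congrArg (KaehlerDifferential.map ℂ ℂ D.localRing D.FunctionField)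
    (D_aeval_affineCoord h2 P)
  rw [map_add, map_smul, map_smul, KaehlerDifferential.map_D, KaehlerDifferential.map_D,
    KaehlerDifferential.map_D, IsLocalRing.ResidueField.algebraMap_eq,
    residue_equation_eq_zero h2 hP, map_zero] at h
  exact h.symm

/-- Any two local equations differ by a unit `e`, and `d(c e) / (c e) = dc / c + de / e` with the
last term holomorphic. So the residue is independent of the presentation, and eliminating `dy` on
the curve gives the formula in terms of `dx`. -/
theorem exists_of_isResidue {κ : K2} {θ : D.Form1}
    (hθ : D.IsResidue (κ • wedge (d xCoord) (d yCoord)) θ) :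
    ∃ g : D.localRing, (g : K2) = κ * MvPolynomial.aeval xi P ∧
      IsLocalRing.residue D.localRing (MvPolynomial.aeval (D.affineCoord h2)
        (MvPolynomial.pderiv 1 P)) • θ = -IsLocalRing.residue D.localRing g •
        KaehlerDifferential.D ℂ D.FunctionField
          (IsLocalRing.residue D.localRing (D.affineCoord h2 0)) := by
  obtain ⟨f, η, η', hmax, hη', hω, rfl⟩ := hθ
  set c := MvPolynomial.aeval (D.affineCoord h2) P with hc
  set p := MvPolynomial.aeval (D.affineCoord h2) (MvPolynomial.pderiv 0 P) with hp
  set q := MvPolynomial.aeval (D.affineCoord h2) (MvPolynomial.pderiv 1 P) with hq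
  have hdc : d (c : K2) = (p : K2) • d xCoord + (q : K2) • d yCoord := by
    rw [← map_combination_D h2, ← D_aeval_affineCoord, KaehlerDifferential.map_D]
    rfl
  have hc0 : (c : K2) ≠ 0 := by
    rw [hc, coe_aeval_affineCoord]
    obtain ⟨u, hu⟩ := hP
    rw [← hu, map_mul]
    refine mul_ne_zero (aeval_xi_ne_zero D.homogeneous D.irreducible.ne_zero) ?_
    exact (u.isUnit.map (MvPolynomial.aeval xi)).ne_zero
  obtain ⟨e, he⟩ := (Ideal.span_singleton_eq_span_singleton.mp
    ((maximalIdeal_eq_span h2 hP).symm.trans hmax))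
  obtain ⟨a, b, rfl⟩ := exists_eq_combination_D h2 η
  obtain ⟨r, rfl⟩ := exists_eq_smul_of_mem_holomorphicForms h2 hη'
  obtain ⟨a', b', hde⟩ := exists_d_eq h2 (e : D.localRing)
  have he0 : ((e : D.localRing) : K2) * ((e⁻¹ : (D.localRing)ˣ) : D.localRing) = 1 :=
    congrArg Subtype.val e.mul_inv
  have hf : (f : K2) = (c : K2) * (e : D.localRing) := congrArg Subtype.val he.symm
  rw [map_combination_D h2, hf, d_mul, hdc, hde, wedge_smul_left,
    show ∀ α β : Ω[K2⁄ℂ], (c : K2) • (((a' : K2) • α + (b' : K2) • β)) +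
      ((e : D.localRing) : K2) • ((p : K2) • α + (q : K2) • β) =
      ((c : K2) * a' + (e : D.localRing) * p) • α + ((c : K2) * b' + (e : D.localRing) * q) • β by
      intro α β; simp only [smul_add, smul_smul, add_smul]; abel,
    wedge_combination, smul_smul, ← add_smul] at hω
  have hκ := smul_wedge_injective wedge_dx_dy_ne_zero hω
  have he1 := left_ne_zero_of_mul_eq_one he0
  -- The part multiplied by `c` collects `de / e` and `η'`; it vanishes on the curve, leaving `p b -
  -- q a`.
  refine ⟨c * (((e⁻¹ : (D.localRing)ˣ) : D.localRing) * (a' * b - b' * a) + r) +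
    (p * b - q * a), ?_, ?_⟩
  · change (c : K2) * ((((e⁻¹ : (D.localRing)ˣ) : D.localRing) : K2) *
      ((a' : K2) * b - b' * a) + r) + ((p : K2) * b - q * a) = _
    rw [hκ, ← coe_aeval_affineCoord D h2, ← hc, eq_inv_of_mul_eq_one_right he0]
    field_simp
    ring
  · have h := residue_D_equation h2 hP
    rw [← hp, ← hq] at h
    have hr : IsLocalRing.residue D.localRing (c * (((e⁻¹ : (D.localRing)ˣ) : D.localRing) *
        (a' * b - b' * a) + r) + (p * b - q * a)) = IsLocalRing.residue D.localRing p *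
        IsLocalRing.residue D.localRing b - IsLocalRing.residue D.localRing q *
        IsLocalRing.residue D.localRing a := by
      rw [map_add, map_mul, residue_equation_eq_zero h2 hP, zero_mul, zero_add, map_sub, map_mul,
        map_mul]
    rw [map_combination_D_functionField, hr]
    exact smul_combination_eq h _ _

/-- Where `∂P/∂y` is invertible, one may take `η = -(g / (∂P/∂y)) dx` and `η' = 0`. -/
theorem isResidue_of_mul_eq {κ : K2} (g : D.localRing) (hg : (g : K2) = κ * MvPolynomial.aeval xi P)
    (hq : IsUnit (MvPolynomial.aeval (D.affineCoord h2) (MvPolynomial.pderiv 1 P))) :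
    D.IsResidue (κ • wedge (d xCoord) (d yCoord))
      (-(IsLocalRing.residue D.localRing g / IsLocalRing.residue D.localRing
        (MvPolynomial.aeval (D.affineCoord h2) (MvPolynomial.pderiv 1 P))) •
        KaehlerDifferential.D ℂ D.FunctionField
          (IsLocalRing.residue D.localRing (D.affineCoord h2 0))) := by
  set c := MvPolynomial.aeval (D.affineCoord h2) P with hc
  set p := MvPolynomial.aeval (D.affineCoord h2) (MvPolynomial.pderiv 0 P) with hp
  set q := MvPolynomial.aeval (D.affineCoord h2) (MvPolynomial.pderiv 1 P) with hq'
  have hdc : d (c : K2) = (p : K2) • d xCoord + (q : K2) • d yCoord := by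
    rw [← map_combination_D h2, ← D_aeval_affineCoord, KaehlerDifferential.map_D]
    rfl
  have hc0 : (c : K2) ≠ 0 := by
    rw [hc, coe_aeval_affineCoord]
    obtain ⟨u, hu⟩ := hP
    rw [← hu, map_mul]
    refine mul_ne_zero (aeval_xi_ne_zero D.homogeneous D.irreducible.ne_zero) ?_
    exact (u.isUnit.map (MvPolynomial.aeval xi)).ne_zero
  obtain ⟨w, hw⟩ := hq.exists_right_inv
  have hw' : (q : K2) * w = 1 := congrArg Subtype.val hw
  refine ⟨c, (-(g * w)) • KaehlerDifferential.D ℂ D.localRing (D.affineCoord h2 0) +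
    (0 : D.localRing) • KaehlerDifferential.D ℂ D.localRing (D.affineCoord h2 1), 0,
    maximalIdeal_eq_span h2 hP, Submodule.zero_mem _, ?_, ?_⟩
  · rw [map_combination_D, hdc, wedge_smul_left, wedge_combination, smul_smul, add_zero]
    congr 1
    change κ = (c : K2)⁻¹ * ((p : K2) * 0 - q * (-((g : K2) * w)))
    rw [hg, ← coe_aeval_affineCoord D h2, ← hc]
    rw [show (c : K2)⁻¹ * ((p : K2) * 0 - q * (-(κ * c * w))) = (c : K2)⁻¹ * c * (κ * (q * w)) by
      ring, inv_mul_cancel₀ hc0, hw', one_mul, mul_one]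
  · have h := congrArg (IsLocalRing.residue D.localRing) hw
    rw [map_mul, map_one] at h
    rw [map_combination_D_functionField, map_zero, zero_smul, add_zero, map_neg, map_mul,
      eq_inv_of_mul_eq_one_right h, div_eq_mul_inv]

end Residue

end PlaneCurve
end PosGeom

namespace PosGeom

/-! ### Residues expressed in the parameter of a rational curve -/

namespace PlaneCurve

variable {D : PlaneCurve} {γ : Fin 3 → Polynomial ℂ} {τ : D.FunctionField}

theorem IsParametrization.aeval_ne_zero (h : D.IsParametrization γ τ) {n : ℕ}
    {Q : MvPolynomial (Fin 3) ℂ} (hQ : Q.IsHomogeneous n) (hd : ¬ D.F ∣ Q) :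
    Polynomial.aeval τ (MvPolynomial.aeval γ Q) ≠ 0 := by
  rw [← D.residue_aeval h.residue_affineCoord]
  exact mt (D.residue_aeval_affineCoord_eq_zero_iff (h.not_dvd_X 2) hQ).mp hd

theorem IsParametrization.D_residue (h : D.IsParametrization γ τ) :
    KaehlerDifferential.D ℂ D.FunctionField
      (IsLocalRing.residue D.localRing (D.affineCoord (h.not_dvd_X 2) 0)) =
    Polynomial.aeval τ (Polynomial.derivative (γ 0)) •
      KaehlerDifferential.D ℂ D.FunctionField τ := by
  rw [h.residue_affineCoord, Derivation.map_aeval]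

theorem IsParametrization.segmentForm_eq (h : D.IsParametrization γ τ) (a b : ℂ) :
    h.segmentForm a b = (Polynomial.aeval τ (Polynomial.C (a - b)) / Polynomial.aeval τ
      ((Polynomial.X - Polynomial.C a) * (Polynomial.X - Polynomial.C b))) •
        KaehlerDifferential.D ℂ D.FunctionField τ := by
  simp only [segmentForm, map_mul, map_sub, Polynomial.aeval_X, Polynomial.aeval_C]

theorem segmentDenominator_ne_zero (a b : ℂ) : (Polynomial.X - Polynomial.C a) *
    (Polynomial.X - Polynomial.C b) ≠ 0 :=
  mul_ne_zero (Polynomial.X_sub_C_ne_zero a) (Polynomial.X_sub_C_ne_zero b)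

/-- The residue along a parametrized curve with equation `P` of a form with the numerator `N` and
the denominator `P B`. -/
theorem IsParametrization.isResidue (h : D.IsParametrization γ τ) {N P B : MvPolynomial (Fin 3) ℂ}
    {l m n : ℕ} (hP : Associated D.F P) (hPm : P.IsHomogeneous m) (hB : B.IsHomogeneous n)
    (hdB : ¬ D.F ∣ B) (hPy : (MvPolynomial.pderiv 1 P).IsHomogeneous l)
    (hdP : ¬ D.F ∣ MvPolynomial.pderiv 1 P) {a b ε : ℂ}
    (hid : -(MvPolynomial.aeval γ N * Polynomial.derivative (γ 0) *
      ((Polynomial.X - Polynomial.C a) * (Polynomial.X - Polynomial.C b))) =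
      Polynomial.C ε * Polynomial.C (a - b) *
        (MvPolynomial.aeval γ B * MvPolynomial.aeval γ (MvPolynomial.pderiv 1 P))) :
    D.IsResidue ((MvPolynomial.aeval xi N / (MvPolynomial.aeval xi P * MvPolynomial.aeval xi B)) •
      wedge (d xCoord) (d yCoord)) (ε • h.segmentForm a b) := by
  have h2 := h.not_dvd_X 2
  have hP0 : MvPolynomial.aeval xi P ≠ 0 :=
    aeval_xi_ne_zero hPm (hP.ne_zero_iff.mp D.irreducible.ne_zero)
  have hB0 := D.aeval_ne_zero hB hdB
  obtain ⟨w, hw⟩ := (isUnit_aeval_affineCoord h2 hB hdB).exists_right_inv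
  have hw' : MvPolynomial.aeval xi B * (w : K2) = 1 := by
    rw [← coe_aeval_affineCoord D h2]
    exact congrArg Subtype.val hw
  have hg : ((MvPolynomial.aeval (D.affineCoord h2) N * w : D.localRing) : K2) =
      MvPolynomial.aeval xi N / (MvPolynomial.aeval xi P * MvPolynomial.aeval xi B) *
        MvPolynomial.aeval xi P := by
    change ((MvPolynomial.aeval (D.affineCoord h2) N : D.localRing) : K2) * (w : K2) = _
    rw [coe_aeval_affineCoord, eq_inv_of_mul_eq_one_right hw']
    field_simp
  convert isResidue_of_mul_eq h2 hP _ hg (isUnit_aeval_affineCoord h2 hPy hdP) using 1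
  have e1 := h.aeval_ne_zero hB hdB
  have e2 := h.aeval_ne_zero hPy hdP
  have e3 := h.generator.aeval_ne_zero (segmentDenominator_ne_zero a b)
  have e4 := congrArg (IsLocalRing.residue D.localRing) hw
  rw [map_mul, map_one, D.residue_aeval h.residue_affineCoord] at e4
  -- Evaluated at `τ`, the polynomial identity is the cross-multiplied equality of the two
  -- coefficients of `dτ`.
  have e5 := congrArg (Polynomial.aeval τ) hid
  simp only [map_neg, map_mul] at e5
  rw [map_mul] at e3
  rw [h.segmentForm_eq, h.D_residue, map_mul, map_mul, D.residue_aeval h.residue_affineCoord,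
    D.residue_aeval h.residue_affineCoord, eq_inv_of_mul_eq_one_right e4, smul_smul,
    ← algebraMap_smul D.FunctionField ε, smul_smul, ← Polynomial.aeval_C τ ε]
  congr 1
  rw [← mul_div_assoc, ← div_eq_mul_inv, div_div, ← neg_div, div_mul_eq_mul_div,
    div_eq_div_iff e3 (mul_ne_zero e1 e2)]
  linear_combination -e5

/-- A form with at most simple poles along two curves is determined on a parametrized one of them by
its residue there. -/
theorem IsParametrization.aeval_eq_of_isResidue (h : D.IsParametrization γ τ)
    {A P B : MvPolynomial (Fin 3) ℂ} (hP : Associated D.F P) {κ : K2}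
    (hκ : κ * (MvPolynomial.aeval xi P * MvPolynomial.aeval xi B) = MvPolynomial.aeval xi A)
    {a b ε : ℂ} (hres : D.IsResidue (κ • wedge (d xCoord) (d yCoord)) (ε • h.segmentForm a b)) :
    -(MvPolynomial.aeval γ A * Polynomial.derivative (γ 0) *
      ((Polynomial.X - Polynomial.C a) * (Polynomial.X - Polynomial.C b))) =
      Polynomial.C ε * Polynomial.C (a - b) *
        (MvPolynomial.aeval γ B * MvPolynomial.aeval γ (MvPolynomial.pderiv 1 P)) := by
  have h2 := h.not_dvd_X 2
  obtain ⟨g, hg, hres⟩ := exists_of_isResidue h2 hP hres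
  have hgB : g * MvPolynomial.aeval (D.affineCoord h2) B =
      MvPolynomial.aeval (D.affineCoord h2) A := by
    apply Subtype.ext
    change (g : K2) * ((MvPolynomial.aeval (D.affineCoord h2) B : D.localRing) : K2) = _
    rw [coe_aeval_affineCoord, coe_aeval_affineCoord, hg, ← hκ, mul_assoc]
  have e1 := congrArg (IsLocalRing.residue D.localRing) hgB
  rw [map_mul, D.residue_aeval h.residue_affineCoord, D.residue_aeval h.residue_affineCoord] at e1
  have e3 := h.generator.aeval_ne_zero (segmentDenominator_ne_zero a b)
  rw [h.segmentForm_eq, h.D_residue, D.residue_aeval h.residue_affineCoord, smul_smul,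
    ← algebraMap_smul D.FunctionField ε, smul_smul, smul_smul, ← Polynomial.aeval_C τ ε] at hres
  have e4 := smul_left_injective _ h.generator.D_ne_zero hres
  apply h.generator.aeval_injective
  simp only [map_neg, map_mul] at e3 ⊢
  rw [map_mul, ← mul_div_assoc, div_eq_iff e3] at e4
  rw [← e1]
  linear_combination -(Polynomial.aeval τ (MvPolynomial.aeval γ B)) * e4

end PlaneCurve

/-! ### The residues of the canonical form -/

/-- The double root is the tangency and the simple root the crossing point. -/
theorem aeval_cubicParam_lineForm : MvPolynomial.aeval cubicParam lineForm =
    (Polynomial.X - 1) ^ 2 * (Polynomial.X + Polynomial.C (1 / 2)) := by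
  apply Polynomial.funext
  intro t
  simp [lineForm, cubicParam, Matrix.cons_val]
  ring

theorem aeval_lineParam_cubicForm : MvPolynomial.aeval lineParam cubicForm =
    -((Polynomial.X - 1) ^ 2 * (Polynomial.X - Polynomial.C (1 / 4))) := by
  apply Polynomial.funext
  intro t
  simp [cubicForm, lineParam, Matrix.cons_val]
  ring

/-- The factor `t²`, together with `dx = 2t dt`, cancels `∂P/∂y = 2t³` at the cusp. The factor `t -
1` lowers the double pole at the tangency to a simple one. -/
theorem aeval_cubicParam_numeratorForm : MvPolynomial.aeval cubicParam numeratorForm =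
    Polynomial.C (3 / 2) * (Polynomial.X ^ 2 * (Polynomial.X - 1)) := by
  apply Polynomial.funext
  intro t
  simp [numeratorForm, cubicParam]
  ring

theorem aeval_lineParam_numeratorForm : MvPolynomial.aeval lineParam numeratorForm =
    Polynomial.C (3 / 4) * (Polynomial.X - 1) := by
  apply Polynomial.funext
  intro t
  simp [numeratorForm, lineParam]
  ring

namespace PlaneCurve

variable {D : PlaneCurve}

theorem not_dvd_cubicForm (hD : Associated D.F lineForm) : ¬ D.F ∣ cubicForm := fun h =>
  not_associated_lineForm_cubicForm
    (irreducible_lineForm.associated_of_dvd irreducible_cubicForm (hD.symm.dvd.trans h))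

theorem not_dvd_lineForm (hD : Associated D.F cubicForm) : ¬ D.F ∣ lineForm := fun h =>
  not_associated_lineForm_cubicForm
    (irreducible_cubicForm.associated_of_dvd irreducible_lineForm (hD.symm.dvd.trans h)).symm

theorem isResidue_line (hD : Associated D.F lineForm) : D.IsResidue omegaII
    ((1 : ℂ) • (isParametrization_line hD).segmentForm 1 (1 / 4)) := by
  rw [omegaII_eq_aeval]
  refine (isParametrization_line hD).isResidue (l := 0) hD isHomogeneous_lineForm
    isHomogeneous_cubicForm (not_dvd_cubicForm hD) ?_ ?_ ?_
  · rw [pderiv_lineForm]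
    exact MvPolynomial.isHomogeneous_C _ _
  · rw [pderiv_lineForm]
    exact fun h => D.irreducible.not_isUnit (isUnit_of_dvd_one (by simpa using h))
  -- The residue is `(3/4) dt / ((t - 1)(t - 1/4))`, and `1 - 1/4 = 3/4`.
  · rw [aeval_lineParam_numeratorForm, aeval_lineParam_cubicForm, pderiv_lineForm]
    apply Polynomial.funext
    intro t
    simp [lineParam]
    ring

theorem isResidue_cubic (hD : Associated D.F cubicForm) : D.IsResidue omegaII
    ((-1 : ℂ) • (isParametrization_cubic hD).segmentForm 1 (-1 / 2)) := by
  rw [omegaII_eq_aeval, mul_comm (MvPolynomial.aeval xi lineForm)]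
  refine (isParametrization_cubic hD).isResidue (l := 2) hD isHomogeneous_cubicForm
    isHomogeneous_lineForm (not_dvd_lineForm hD) isHomogeneous_cubicForm.pderiv ?_ ?_
  · rw [pderiv_cubicForm]
    change ¬ D.F ∣ 2 * MvPolynomial.X 1 * MvPolynomial.X 2
    have h2 : (2 : MvPolynomial (Fin 3) ℂ) = MvPolynomial.C 2 := (map_ofNat _ 2).symm
    refine D.not_dvd_mul (D.not_dvd_mul ?_ (cubic_not_dvd_X hD 1)) (cubic_not_dvd_X hD 2)
    exact fun h => D.irreducible.not_isUnit
      (isUnit_of_dvd_unit h (h2 ▸ (isUnit_iff_ne_zero.mpr (two_ne_zero (α := ℂ))).map MvPolynomial.C))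
  -- The residue is `-(3/2) dt / ((t - 1)(t + 1/2))`, and `1 + 1/2 = 3/2`, whence the sign `-1`.
  · rw [aeval_cubicParam_numeratorForm, aeval_cubicParam_lineForm, pderiv_cubicForm]
    apply Polynomial.funext
    intro t
    simp [cubicParam, Matrix.cons_val]
    ring

end PlaneCurve

theorem isCanonicalForm_omegaII : IsCanonicalForm regionII omegaII := by
  refine ⟨?_, fun D hD => ?_⟩
  · rw [zariskiClosure_frontier_regionII, ← zeroLocus_lineForm, ← zeroLocus_cubicForm,
      ← zeroLocus_mul]
    exact hasLogPolesPrecisely_omegaII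
  · rw [zariskiClosure_frontier_regionII] at hD
    rcases associated_lineForm_or_cubicForm D.homogeneous D.irreducible hD with h | h
    · exact ⟨PlaneCurve.isPositiveGeometry_line h, _, PlaneCurve.isResidue_line h,
        (PlaneCurve.isCanonicalForm_line_iff (PlaneCurve.zariskiClosure_boundary_line h) h _).mpr
          ⟨1, Or.inl rfl, rfl⟩⟩
    · exact ⟨PlaneCurve.isPositiveGeometry_cubic h, _, PlaneCurve.isResidue_cubic h,
        (PlaneCurve.isCanonicalForm_cubic_iff (PlaneCurve.zariskiClosure_boundary_cubic h) h _).mpr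
          ⟨-1, Or.inr rfl, rfl⟩⟩

end PosGeom

namespace PosGeom

/-! ### Uniqueness of the canonical form -/

/-- A rational function that is regular at all points of the affine plane is a polynomial. -/
theorem exists_eq_aeval_of_isRegular {q : K2} (hq : ∀ a b : ℂ,
    IsRegular (xCoord - algebraMap ℂ K2 a) (yCoord - algebraMap ℂ K2 b) q) :
    ∃ P : MvPolynomial (Fin 2) ℂ, q = MvPolynomial.aeval ![xCoord, yCoord] P := by
  obtain ⟨P, Q, hQ0, hPQ, rfl⟩ := exists_eq_div q
  have hinj := mvAeval_injective wedge_dx_dy_ne_zero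
  have hQ0' : MvPolynomial.aeval ![xCoord, yCoord] Q ≠ 0 := by
    rw [Ne, ← map_zero (MvPolynomial.aeval (R := ℂ) ![xCoord, yCoord]), hinj.eq_iff]
    exact hQ0
  -- At a zero of `Q`, a second expression of `q` with nonvanishing denominator forces the numerator
  -- `P` to vanish too. The Nullstellensatz then gives `Q ∣ P ^ k`, so the coprime denominator `Q`
  -- is a unit.
  have hzero : ∀ w : Fin 2 → ℂ, MvPolynomial.eval w Q = 0 → MvPolynomial.eval w P = 0 := by
    intro w hw
    obtain ⟨_, P', Q', hQ', h, -⟩ := hq (w 0) (w 1)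
    let shift : MvPolynomial (Fin 2) ℂ →ₐ[ℂ] MvPolynomial (Fin 2) ℂ :=
      MvPolynomial.aeval ![MvPolynomial.X 0 - MvPolynomial.C (w 0),
        MvPolynomial.X 1 - MvPolynomial.C (w 1)]
    have hshift : ∀ R, MvPolynomial.aeval
        ![xCoord - algebraMap ℂ K2 (w 0), yCoord - algebraMap ℂ K2 (w 1)] R =
        MvPolynomial.aeval ![xCoord, yCoord] (shift R) := by
      intro R
      rw [← AlgHom.comp_apply, MvPolynomial.comp_aeval]
      congr 2
      funext i
      fin_cases i <;> simp
    have heval : ∀ R, MvPolynomial.eval w (shift R) = MvPolynomial.constantCoeff R := by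
      intro R
      induction R using MvPolynomial.induction_on with
      | C a => simp [shift]
      | add R S hR hS => simp only [map_add, hR, hS]
      | mul_X R i hR =>
        rw [map_mul, map_mul, map_mul, hR]
        congr 1
        fin_cases i <;> simp [shift]
    have hQ1 : MvPolynomial.aeval ![xCoord, yCoord] (shift Q') ≠ 0 := by
      rw [Ne, ← map_zero (MvPolynomial.aeval (R := ℂ) ![xCoord, yCoord]), hinj.eq_iff]
      intro h0
      exact hQ' (by rw [← heval, h0, map_zero])
    rw [hshift, hshift, div_eq_div_iff hQ0' hQ1, ← map_mul, ← map_mul] at h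
    have h1 := congrArg (MvPolynomial.eval w) (hinj h)
    rw [map_mul, map_mul, hw, mul_zero, heval] at h1
    exact (mul_eq_zero.mp h1).resolve_right hQ'
  have hrad : P ∈ (Ideal.span {Q}).radical := by
    rw [← MvPolynomial.vanishingIdeal_zeroLocus_eq_radical (K := ℂ),
      MvPolynomial.mem_vanishingIdeal_iff]
    intro w hw
    rw [MvPolynomial.aeval_eq_eval]
    apply hzero
    have := hw Q (Ideal.mem_span_singleton_self Q)
    rwa [MvPolynomial.aeval_eq_eval] at this
  obtain ⟨k, hk⟩ := hrad
  have hu : IsUnit Q := (hPQ.pow_left (m := k)) (Ideal.mem_span_singleton.mp hk) dvd_rfl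
  obtain ⟨R, hR⟩ := hu.exists_right_inv
  refine ⟨P * R, ?_⟩
  have hR' := congrArg (MvPolynomial.aeval ![xCoord, yCoord]) hR
  rw [map_mul, map_one] at hR'
  rw [map_mul, eq_inv_of_mul_eq_one_right hR', div_eq_mul_inv]

theorem homogeneousComponent_totalDegree_ne_zero {P : MvPolynomial (Fin 2) ℂ} (hP : P ≠ 0) :
    MvPolynomial.homogeneousComponent P.totalDegree P ≠ 0 := by
  obtain ⟨m, hm, hd⟩ := Finset.exists_mem_eq_sup P.support (MvPolynomial.support_nonempty.mpr hP)
    (fun s => s.degree)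
  intro h
  have h1 := congrArg (MvPolynomial.coeff m) h
  have hd' : m.degree = P.totalDegree := hd.symm
  rw [MvPolynomial.coeff_homogeneousComponent, if_pos hd', MvPolynomial.coeff_zero] at h1
  exact MvPolynomial.mem_support_iff.mp hm h1

/-- A polynomial with at most a simple pole along the line at infinity has degree at most one. -/
theorem totalDegree_le_one_of_isRegular {P : MvPolynomial (Fin 2) ℂ}
    (hP : ∀ a : ℂ, IsRegular (1 / yCoord) (xCoord / yCoord - algebraMap ℂ K2 a)
      (MvPolynomial.aeval ![xCoord, yCoord] P / yCoord))
    (hw : ∀ a : ℂ, wedge (d (1 / yCoord)) (d (xCoord / yCoord - algebraMap ℂ K2 a)) ≠ 0) :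
    P.totalDegree ≤ 1 := by
  by_contra hm
  set m := P.totalDegree with hm'
  have hP0 : P ≠ 0 := by
    rintro rfl
    simp [hm'] at hm
  have hy : yCoord ≠ 0 := xi_ne_zero 1
  have key : ∀ a : ℂ,
      MvPolynomial.eval ![a, 1] (MvPolynomial.homogeneousComponent m P) = 0 := by
    intro a
    obtain ⟨_, P', Q', hQ', h, -⟩ := hP a
    set u := 1 / yCoord with hu
    set v := xCoord / yCoord - algebraMap ℂ K2 a with hv
    change _ = evalAt u v P' / evalAt u v Q' at h
    let S : ℕ → MvPolynomial (Fin 2) ℂ := fun i =>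
      MvPolynomial.aeval ![MvPolynomial.X 1 + MvPolynomial.C a, 1]
        (MvPolynomial.homogeneousComponent i P)
    have hS : ∀ i, evalAt u v (S i) = MvPolynomial.aeval ![xCoord, yCoord]
        (MvPolynomial.homogeneousComponent i P) / yCoord ^ i := by
      intro i
      rw [← aeval_div_of_isHomogeneous (MvPolynomial.homogeneousComponent_isHomogeneous i P) hy,
        ← AlgHom.comp_apply, MvPolynomial.comp_aeval]
      congr 2
      funext j
      fin_cases j
      · simp [hv]
      · simp [hy]
    have hSc : ∀ i, MvPolynomial.constantCoeff (S i) = MvPolynomial.eval ![a, 1]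
        (MvPolynomial.homogeneousComponent i P) := by
      intro i
      simp only [S]
      generalize MvPolynomial.homogeneousComponent i P = R
      induction R using MvPolynomial.induction_on with
      | C a => simp
      | add R S hR hS => simp only [map_add, hR, hS]
      | mul_X R i hR =>
        rw [map_mul, map_mul, map_mul, hR]
        congr 1
        fin_cases i <;> simp
    have hsum : MvPolynomial.aeval ![xCoord, yCoord] P * u ^ m =
        evalAt u v (∑ i ∈ Finset.range (m + 1), MvPolynomial.X 0 ^ (m - i) * S i) := by
      conv_lhs => rw [← MvPolynomial.sum_homogeneousComponent P, ← hm', map_sum, Finset.sum_mul]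
      rw [map_sum]
      refine Finset.sum_congr rfl fun i hi => ?_
      have him : m = (m - i) + i := by
        have := Finset.mem_range.mp hi
        omega
      rw [map_mul, map_pow, evalAt_X_zero, hS]
      conv_lhs => rw [him]
      rw [pow_add, hu, one_div, inv_pow _ i, div_eq_mul_inv]
      ring
    -- Multiplying by `u ^ m` clears the pole at infinity. Since `m ≥ 2`, a factor `X 0` remains on
    -- the right, so taking constant coefficients kills the top homogeneous component at `(a, 1)`.
    have hid : (∑ i ∈ Finset.range (m + 1), MvPolynomial.X 0 ^ (m - i) * S i) * Q' =
        P' * MvPolynomial.X 0 ^ (m - 1) := by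
      apply mvAeval_injective (hw a)
      change evalAt u v _ = evalAt u v _
      have hm1 : m = (m - 1) + 1 := by omega
      rw [map_mul, ← hsum, map_mul, map_pow, evalAt_X_zero]
      conv_lhs => rw [hm1]
      rw [div_eq_div_iff hy (evalAt_ne_zero (hw a) hQ')] at h
      rw [pow_succ]
      have huy : u * yCoord = 1 := by rw [hu, one_div, inv_mul_cancel₀ hy]
      linear_combination (u ^ (m - 1) * u) * h + evalAt u v P' * u ^ (m - 1) * huy
    have hc := congrArg MvPolynomial.constantCoeff hid
    rw [map_mul, map_mul, map_pow, MvPolynomial.constantCoeff_X, zero_pow (by omega), mul_zero,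
      mul_eq_zero_iff_right hQ', map_sum, Finset.sum_eq_single m] at hc
    · rw [← hSc]
      simpa using hc
    · intro i hi hne
      have := Finset.mem_range.mp hi
      rw [map_mul, map_pow, MvPolynomial.constantCoeff_X, zero_pow (by omega), zero_mul]
    · simp
  apply homogeneousComponent_totalDegree_ne_zero hP0
  refine (mul_eq_zero.mp
    (?_ : MvPolynomial.X 1 * MvPolynomial.homogeneousComponent m P = 0)).resolve_left (MvPolynomial.X_ne_zero 1)
  apply MvPolynomial.funext
  intro w
  rw [map_mul, MvPolynomial.eval_X, map_zero]
  by_cases hw1 : w 1 = 0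
  · rw [hw1, zero_mul]
  · have h1 := aeval_div_of_isHomogeneous
      (MvPolynomial.homogeneousComponent_isHomogeneous m P) hw1 w
    have h2 : (fun j => w j / w 1) = ![w 0 / w 1, 1] := by
      funext j
      fin_cases j
      · rfl
      · exact div_self hw1
    rw [h2, MvPolynomial.aeval_eq_eval, MvPolynomial.aeval_eq_eval] at h1
    have h3 := (key (w 0 / w 1)).symm.trans h1
    rw [eq_comm, div_eq_zero_iff] at h3
    rw [h3.resolve_right (pow_ne_zero _ hw1), mul_zero]

theorem eq_of_totalDegree_le_one {P : MvPolynomial (Fin 2) ℂ} (h : P.totalDegree ≤ 1) :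
    ∃ a b c : ℂ, P = MvPolynomial.C a + MvPolynomial.C b * MvPolynomial.X 0 +
      MvPolynomial.C c * MvPolynomial.X 1 := by
  refine ⟨MvPolynomial.coeff 0 P, MvPolynomial.coeff (Finsupp.single 0 1) P,
    MvPolynomial.coeff (Finsupp.single 1 1) P, ?_⟩
  ext m
  simp only [MvPolynomial.coeff_add, MvPolynomial.coeff_C, MvPolynomial.coeff_C_mul,
    MvPolynomial.coeff_X]
  by_cases h0 : m = 0
  · subst h0
    simp
  by_cases h1 : m = Finsupp.single 0 1
  · subst h1
    simp [Finsupp.single_left_inj, Ne.symm h0]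
  by_cases h2 : m = Finsupp.single 1 1
  · subst h2
    simp [Finsupp.single_left_inj, Ne.symm h0]
  rw [if_neg (Ne.symm h0), if_neg (Ne.symm h1), if_neg (Ne.symm h2)]
  simp only [mul_zero, add_zero]
  refine MvPolynomial.coeff_eq_zero_of_totalDegree_lt (h.trans_lt ?_)
  by_contra hlt
  have hsum : ∑ i ∈ m.support, m i = m 0 + m 1 := by
    rw [← Fin.sum_univ_two]
    exact Finset.sum_subset (Finset.subset_univ _) fun i _ hi => Finsupp.notMem_support_iff.mp hi
  rw [hsum] at hlt
  have hcases : (m 0 = 0 ∧ m 1 = 0) ∨ (m 0 = 1 ∧ m 1 = 0) ∨ (m 0 = 0 ∧ m 1 = 1) := by omega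
  have hext : ∀ m' : Fin 2 →₀ ℕ, m 0 = m' 0 → m 1 = m' 1 → m = m' := by
    intro m' e0 e1
    ext i
    fin_cases i
    exacts [e0, e1]
  rcases hcases with ⟨e0, e1⟩ | ⟨e0, e1⟩ | ⟨e0, e1⟩
  · exact h0 (hext _ e0 e1)
  · exact h1 (hext _ (by simp [e0]) (by simp [e1]))
  · exact h2 (hext _ (by simp [e0]) (by simp [e1]))

/-- The standard coordinates at a point of the affine plane. -/
theorem exists_chart_affine (a b : ℂ) : ∃ p : CP2, chart p = 2 ∧
    uAt p = xCoord - algebraMap ℂ K2 a ∧ vAt p = yCoord - algebraMap ℂ K2 b := by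
  have hv : (![a, b, 1] : Fin 3 → ℂ) ≠ 0 := fun h => one_ne_zero (congrFun h 2)
  obtain ⟨s, hs, h⟩ := exists_rep_mk hv
  have hc : chart (Projectivization.mk ℂ ![a, b, 1] hv) = 2 := by
    rw [chart_eq_two_iff, h]
    simpa using hs
  refine ⟨_, hc, ?_, ?_⟩
  · rw [uAt_of_chart hc, normalizedRep, hc, h, h]
    congr 2
    simp [hs]
  · rw [vAt_of_chart hc, normalizedRep, hc, h, h]
    congr 2
    simp [hs]

/-- The standard coordinates at a point of the line at infinity. -/
theorem exists_chart_infinity (a : ℂ) : ∃ p : CP2, chart p = 1 ∧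
    uAt p = 1 / yCoord ∧ vAt p = xCoord / yCoord - algebraMap ℂ K2 a := by
  have hv : (![a, 1, 0] : Fin 3 → ℂ) ≠ 0 := fun h => one_ne_zero (congrFun h 1)
  obtain ⟨s, hs, h⟩ := exists_rep_mk hv
  have h2 : (Projectivization.mk ℂ ![a, 1, 0] hv).rep 2 = 0 := by
    rw [h]
    simp
  have h1 : (Projectivization.mk ℂ ![a, 1, 0] hv).rep 1 ≠ 0 := by
    rw [h]
    simpa using hs
  have hc : chart (Projectivization.mk ℂ ![a, 1, 0] hv) = 1 := by
    rw [chart, if_neg (not_not.mpr h2), if_pos h1]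
  refine ⟨_, hc, ?_, ?_⟩
  · rw [uAt, localCoord, hc, show (1 + 1 : Fin 3) = 2 from rfl, h2, zero_div, map_zero, sub_zero]
    rfl
  · rw [vAt, localCoord, hc, show (1 + 2 : Fin 3) = 0 from rfl, h, h]
    congr 2
    simp [hs]

theorem isRegular_const_mul {u v f : K2} (c : ℂ) (h : IsRegular u v f) :
    IsRegular u v (algebraMap ℂ K2 c * f) := by
  obtain ⟨_, P, Q, hQ, rfl, -⟩ := h
  refine ⟨_, MvPolynomial.C c * P, Q, hQ, ?_, rfl⟩
  rw [map_mul, MvPolynomial.aeval_C, mul_div_assoc]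

/-- The local equation contributes `xi (chart p) ^ (-4)` and `dx ∧ dy` contributes the third power.
The single remaining power in the denominator is what bounds the numerator by degree one. -/
theorem isRegular_of_hasLogPolesPrecisely {κ : K2}
    (h : HasLogPolesPrecisely (κ • wedge (d xCoord) (d yCoord)) (lineII ∪ cuspidalCubic)) (p : CP2) :
    IsRegular (uAt p) (vAt p) (κ * (MvPolynomial.aeval xi lineForm *
      MvPolynomial.aeval xi cubicForm) / xi (chart p)) := by
  obtain ⟨n, G, hG, hs, hz, hp⟩ := h
  obtain ⟨⟨f, hf, hfω⟩, -, -⟩ := hp p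
  obtain ⟨e, he⟩ := (associated_lineForm_mul_cubicForm hG hs hz).symm
  obtain ⟨c, hc, hce⟩ := MvPolynomial.isUnit_iff_eq_C_of_isReduced.mp e.isUnit
  have hc0 := hc.ne_zero
  rw [hce, mul_comm] at he
  have hG' : G.IsHomogeneous 4 := by
    rw [← he]
    exact isHomogeneous_lineForm_mul_cubicForm.C_mul c
  obtain rfl : n = 4 := hG.inj_right hG' hs.ne_zero
  have hxi := xi_ne_zero (chart p)
  rw [wedge_dx_dy_eq p, smul_smul, smul_smul] at hfω
  have h1 := smul_wedge_injective (wedge_uAt_vAt_ne_zero p) hfω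
  convert isRegular_const_mul c⁻¹ hf using 1
  have hcc : algebraMap ℂ K2 c ≠ 0 := by simpa using hc0
  rw [← h1, localEquation, ← he, map_mul, map_mul, MvPolynomial.aeval_C, map_inv₀]
  field_simp

/-- A form with at most simple poles along the line and the cubic is determined by a linear form. -/
theorem exists_linear_numerator {κ : K2}
    (h : HasLogPolesPrecisely (κ • wedge (d xCoord) (d yCoord)) (lineII ∪ cuspidalCubic)) :
    ∃ a b c : ℂ, κ * (MvPolynomial.aeval xi lineForm * MvPolynomial.aeval xi cubicForm) =
      MvPolynomial.aeval xi (MvPolynomial.C a * MvPolynomial.X 2 +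
        MvPolynomial.C b * MvPolynomial.X 0 + MvPolynomial.C c * MvPolynomial.X 1 :
        MvPolynomial (Fin 3) ℂ) := by
  have hreg := isRegular_of_hasLogPolesPrecisely h
  obtain ⟨P, hP⟩ := exists_eq_aeval_of_isRegular (q := κ * (MvPolynomial.aeval xi lineForm *
      MvPolynomial.aeval xi cubicForm)) (by
    intro a b
    obtain ⟨p, hc, hu, hv⟩ := exists_chart_affine a b
    have := hreg p
    rwa [hc, hu, hv, show xi 2 = 1 from rfl, div_one] at this)
  have hdeg : P.totalDegree ≤ 1 := by
    apply totalDegree_le_one_of_isRegular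
    · intro a
      obtain ⟨p, hc, hu, hv⟩ := exists_chart_infinity a
      have := hreg p
      rwa [hc, hu, hv, hP] at this
    · intro a
      obtain ⟨p, -, hu, hv⟩ := exists_chart_infinity a
      rw [← hu, ← hv]
      exact wedge_uAt_vAt_ne_zero p
  obtain ⟨a, b, c, habc⟩ := eq_of_totalDegree_le_one hdeg
  refine ⟨a, b, c, ?_⟩
  rw [hP, habc]
  simp [xi, Matrix.cons_val]

theorem neg_smul_form2 (k : K2) (ω : Form2) : (-k) • ω = -(k • ω) := neg_smul k ω

theorem eq_or_eq_neg_of_isCanonicalForm {ω : Form2} (h : IsCanonicalForm regionII ω) :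
    ω = omegaII ∨ ω = -omegaII := by
  obtain ⟨κ, rfl⟩ := exists_eq_smul_wedge ω
  obtain ⟨hlog, hres⟩ := h
  have hD : Associated cubicCurve.F cubicForm := Associated.refl _
  obtain ⟨-, θ, hθ, hcan⟩ := hres cubicCurve (by
    rw [zariskiClosure_frontier_regionII, ← zeroLocus_cubicForm]
    exact Set.subset_union_right)
  rw [zariskiClosure_frontier_regionII] at hlog
  obtain ⟨a, b, c, hκ⟩ := exists_linear_numerator hlog
  obtain ⟨ε, hε, rfl⟩ := (PlaneCurve.isCanonicalForm_cubic_iff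
    (PlaneCurve.zariskiClosure_boundary_cubic hD) hD _).mp hcan
  have key := (PlaneCurve.isParametrization_cubic hD).aeval_eq_of_isResidue hD
    (by rwa [mul_comm (MvPolynomial.aeval xi lineForm)] at hκ) hθ
  rw [aeval_cubicParam_lineForm, pderiv_cubicForm] at key
  -- Cancelling `-2t (t - 1)(t + 1/2)` from the residue identity leaves the numerator on the cubic
  -- as `-(3/2) ε t² (t - 1)`. The monomials `1, t², t³` are independent, so its coefficients are
  -- determined.
  have hpoly : Polynomial.C a + Polynomial.C b * Polynomial.X ^ 2 + Polynomial.C c *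
      Polynomial.X ^ 3 = Polynomial.C (-ε * (3 / 2)) * Polynomial.X ^ 3 -
        Polynomial.C (-ε * (3 / 2)) * Polynomial.X ^ 2 := by
    have hS := PlaneCurve.segmentDenominator_ne_zero 1 (-1 / 2)
    apply mul_left_cancel₀ (mul_ne_zero (Polynomial.X_ne_zero (R := ℂ)) hS)
    apply Polynomial.funext
    intro t
    have := congrArg (Polynomial.eval t) key
    simp [cubicParam, Matrix.cons_val, -mul_eq_mul_left_iff] at this ⊢
    linear_combination -this / 2
  have h0 := congrArg (fun R => Polynomial.coeff R 0) hpoly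
  have h2 := congrArg (fun R => Polynomial.coeff R 2) hpoly
  have h3 := congrArg (fun R => Polynomial.coeff R 3) hpoly
  simp only [Polynomial.coeff_add, Polynomial.coeff_sub, Polynomial.coeff_C_mul,
    Polynomial.coeff_X_pow, Polynomial.coeff_C] at h0 h2 h3
  norm_num at h0 h2 h3
  have hA : MvPolynomial.C a * MvPolynomial.X 2 + MvPolynomial.C b * MvPolynomial.X 0 +
      MvPolynomial.C c * MvPolynomial.X 1 = MvPolynomial.C (-ε) * numeratorForm := by
    rw [h0, h2, h3, numeratorForm]
    simp only [map_neg, map_mul, map_zero]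
    ring
  have hLC : MvPolynomial.aeval xi lineForm * MvPolynomial.aeval xi cubicForm ≠ 0 :=
    mul_ne_zero (aeval_xi_ne_zero isHomogeneous_lineForm irreducible_lineForm.ne_zero)
      (aeval_xi_ne_zero isHomogeneous_cubicForm irreducible_cubicForm.ne_zero)
  rw [hA, map_mul, MvPolynomial.aeval_C, ← eq_div_iff hLC, mul_div_assoc] at hκ
  rw [omegaII_eq_aeval, hκ]
  -- Since the residue of `omegaII` along the cubic is `-1` times the segment form, the case `ε = 1`
  -- yields `-omegaII`.
  rcases hε with rfl | rfl
  · right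
    rw [map_neg, map_one, neg_one_mul]
    exact neg_smul_form2 _ _
  · left
    rw [neg_neg, map_one, one_mul]

theorem isPositiveGeometry_regionII : IsPositiveGeometry regionII := by
  have h : affinePoint (1 / 4) 0 ∈ interior regionII :=
    affinePoint_mem_interior_regionII (by norm_num) (by norm_num) (by norm_num)
  exact ⟨⟨_, interior_subset h⟩, isClosed_regionII, isSemialgebraicRP2_regionII, ⟨_, h⟩, omegaII,
    isCanonicalForm_omegaII, fun _ => eq_or_eq_neg_of_isCanonicalForm⟩

end PosGeom

end

theorem mainTheorem11 :
    PosGeom.zariskiClosure (frontier PosGeom.regionII) = PosGeom.lineII ∪ PosGeom.cuspidalCubic ∧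
    PosGeom.IsPositiveGeometry PosGeom.regionII ∧
    PosGeom.IsCanonicalForm PosGeom.regionII PosGeom.omegaII :=
  ⟨PosGeom.zariskiClosure_frontier_regionII, PosGeom.isPositiveGeometry_regionII,
    PosGeom.isCanonicalForm_omegaII⟩
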